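/- A parameterized problem is a set $P\subseteq\Sigma^*\times\mathbb N$, $\Sigma$ a finite alphabet; $k$ is the parameter of the instance $(x,k)$. Write $|(x,k)|=|x|+k+1$ for its size ($k$ is written in unary). An fpt-reduction from $P\subseteq\Sigma^*\times\mathbb N$ to $Q\subseteq\Delta^*\times\mathbb N$ is a map $r:\Sigma^*\times\mathbb N\to\Delta^*\times\mathbb N$ such that (i) $I\in P\iff r(I)\in Q$ for every $I$; (ii) there is a computable $g:\mathbb N\to\mathbb N$ such that, for every $(x,k)$, the parameter of $r(x,k)$ is at most $g(k)$; (iii) there are a deterministic (multi-stack) Turing machine, a computable $f:\mathbb N\to\mathbb N$ and a constant $c$ such that the machine computes $r(I)$ from every $I=(x,k)$ in at most $f(k)\,|I|^c$ steps. Let $\tau$ be a finite relational vocabulary, $X$ a relation variable of some arity $s$, and $\varphi(X)=\forall x_1\cdots\forall x_p\,\exists y_1\cdots\exists y_q\,\psi$ a $\Pi_2$ formula, with $\psi$ quantifier-free first-order (with equality) over $\tau\cup\{X\}$. The weighted Fagin-defined problem of $\varphi$ asks, given (the binary encoding of) a finite $\tau$-structure $\mathcal A$ with non-empty universe $A$ and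 given $k\in\mathbb N$ (the parameter), whether there is $S\subseteq A^s$ with $|S|=k$ and $\mathcal A\models\varphi(S)$. The class $\mathsf{W}[2]$ consists of all parameterized problems (over any finite alphabet) that have an fpt-reduction to the weighted Fagin-defined problem of some $\Pi_2$ formula $\varphi(X)$. The class $\mathsf{coW}[2]$ consists of all parameterized problems $P\subseteq\Sigma^*\times\mathbb N$ whose complement $(\Sigma^*\times\mathbb N)\setminus P$ is in $\mathsf{W}[2]$. A parameterized problem $Q$ is $\mathsf{coW}[2]$-hard if every problem in $\mathsf{coW}[2]$ has an fpt-reduction to $Q$. The $k$-Well-Covered Graph problem, parameterized by $k$, asks, given a finite simple graph $G$ with at least one vertex (encoded by its adjacency matrix) and $k\in\mathbb N$, whether every inclusion-maximal independent set of $G$ has size exactly $k$. Corollary. The $k$-Well-Covered Graph problem, parameterized by $k$, is $\mathsf{coW}[2]$-hard. -/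

import Mathlib

namespace ParamComplexity

open Turing

/-! ### Parameterized problems and fpt-reductions -/

/-- A parameterized problem over the alphabet `Γ`: a set of pairs (string, parameter). -/
abbrev ParamProblem (Γ : Type) : Type := Set (List Γ × ℕ)

/-- The string that is written on the input (or output) of a machine for the instance `(x, k)`:
the letters of `x`, followed by `k` copies of the additional letter `none`. -/
def encodeInstance {Γ : Type} (I : List Γ × ℕ) : List (Option Γ) :=
  I.1.map some ++ List.replicate I.2 none

/-- The size of the instance `(x, k)`; the summand `1` makes it positive for the empty input. -/
def instanceSize {Γ : Type} (I : List Γ × ℕ) : ℕ := I.1.length + I.2 + 1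

/-- `M`, started on the instance `I`, halts within `t` steps with the instance `J` as output. -/
def OutputsWithin {Γ Δ : Type} (M : TM2ComputableAux (Option Γ) (Option Δ))
    (I : List Γ × ℕ) (J : List Δ × ℕ) (t : ℕ) : Prop :=
  Nonempty (TM2OutputsInTime M.tm ((encodeInstance I).map M.inputAlphabet.symm)
    (some ((encodeInstance J).map M.outputAlphabet.symm)) t)

/-- The map `r` is an fpt-reduction from `P` to `Q`: it maps instances to equivalent instances,
the new parameter is at most `g k` for a computable function `g` of the old parameter `k`, and `r`
is computed by a Turing machine in at most `f k * |I| ^ c` steps, for a computable function `f` and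
a constant `c`. -/
def IsFPTReduction {Γ Δ : Type} (P : ParamProblem Γ) (Q : ParamProblem Δ)
    (r : List Γ × ℕ → List Δ × ℕ) : Prop :=
  (∀ I, I ∈ P ↔ r I ∈ Q) ∧
  (∃ g : ℕ → ℕ, Computable g ∧ ∀ I, (r I).2 ≤ g I.2) ∧
  (∃ (M : TM2ComputableAux (Option Γ) (Option Δ)) (f : ℕ → ℕ) (c : ℕ), Computable f ∧
    ∀ I, OutputsWithin M I (r I) (f I.2 * instanceSize I ^ c))

/-- `P` is fpt-reducible to `Q`. -/
def FPTReducible {Γ Δ : Type} (P : ParamProblem Γ) (Q : ParamProblem Δ) : Prop :=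
  ∃ r : List Γ × ℕ → List Δ × ℕ, IsFPTReduction P Q r

/-! ### Finite relational structures -/

/-- The relational vocabulary with the relation symbols `0, …, m - 1`, of arities `ar i`. -/
def vocabulary {m : ℕ} (ar : Fin m → ℕ) : FirstOrder.Language.{0, 0} :=
  ⟨fun _ => Empty, fun a => {i : Fin m // ar i = a}⟩

/-- The interpretations of the relation symbols of `vocabulary ar` in the universe `Fin n`. -/
abbrev Interp {m : ℕ} (ar : Fin m → ℕ) (n : ℕ) : Type :=
  (i : Fin m) → (Fin (ar i) → Fin n) → Prop

/-- The first-order structure given by an interpretation of the relation symbols. -/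
@[reducible]
def Interp.toStructure {m : ℕ} {ar : Fin m → ℕ} {n : ℕ} (A : Interp ar n) :
    (vocabulary ar).Structure (Fin n) where
  funMap f := f.elim
  RelMap R v := A R.1 (fun j => v (Fin.cast R.2 j))

open Classical in
/-- The encoding of a structure as a binary string: the size of the universe in unary, a `false`,
and then, one relation symbol after the other, the truth table of its interpretation. -/
noncomputable def Interp.code {m : ℕ} {ar : Fin m → ℕ} {n : ℕ} (A : Interp ar n) : List Bool :=
  List.replicate n true ++ false ::
    (List.ofFn fun i : Fin m =>
      List.ofFn fun t : Fin (n ^ ar i) => decide (A i (finFunctionFinEquiv.symm t))).flatten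

/-! ### The classes W[2] and coW[2] -/

/-- The vocabulary `vocabulary ar`, extended by a relation variable `X` of arity `s`. -/
abbrev vocabularyWithVar {m : ℕ} (ar : Fin m → ℕ) (s : ℕ) : FirstOrder.Language.{0, 0} :=
  (vocabulary ar).sum (vocabulary fun _ : Fin 1 => s)

/-- The formula `∀ x₁ … x_p ∃ y₁ … y_q ψ(x, y, X)` holds in the structure `A` when the relation
variable `X` is interpreted as `S`. -/
def SatisfiesPiTwo {m : ℕ} {ar : Fin m → ℕ} {n s p q : ℕ} (A : Interp ar n)
    (S : Finset (Fin s → Fin n)) (ψ : (vocabularyWithVar ar s).BoundedFormula Empty (p + q)) :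
    Prop :=
  letI : (vocabulary ar).Structure (Fin n) := A.toStructure
  letI : (vocabulary fun _ : Fin 1 => s).Structure (Fin n) :=
    Interp.toStructure fun _ v => v ∈ S
  ∀ a : Fin p → Fin n, ∃ b : Fin q → Fin n, ψ.Realize (Empty.elim) (Fin.append a b)

/-- The weighted Fagin-defined problem of the formula `φ(X) = ∀ x₁ … x_p ∃ y₁ … y_q ψ(x, y, X)`:
given a finite structure `A` with a non-empty universe and `k`, is there a relation `S` with exactly
`k` elements such that `A` satisfies `φ(S)`? The parameter is `k`. -/
def weightedFagin {m : ℕ} (ar : Fin m → ℕ) {s p q : ℕ}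
    (ψ : (vocabularyWithVar ar s).BoundedFormula Empty (p + q)) : ParamProblem Bool :=
  {I | ∃ (n : ℕ) (A : Interp ar n), 0 < n ∧ I.1 = A.code ∧
    ∃ S : Finset (Fin s → Fin n), S.card = I.2 ∧ SatisfiesPiTwo A S ψ}

/-- W[2], as in the textbook of Flum and Grohe: the parameterized problems that are fpt-reducible
to the weighted Fagin-defined problem of some `Π₂` formula `φ(X)` (a block of universal quantifiers,
a block of existential quantifiers, and a quantifier-free formula) over some finite relational
vocabulary. -/
def InW2 {Γ : Type} (P : ParamProblem Γ) : Prop :=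
  ∃ (m : ℕ) (ar : Fin m → ℕ) (s p q : ℕ)
    (ψ : (vocabularyWithVar ar s).BoundedFormula Empty (p + q)),
    ψ.IsQF ∧ FPTReducible P (weightedFagin ar ψ)

/-- coW[2]: the parameterized problems whose complement is in W[2]. -/
def InCoW2 {Γ : Type} (P : ParamProblem Γ) : Prop := InW2 Pᶜ

/-- `Q` is coW[2]-hard: every problem in coW[2], over any finite alphabet, is fpt-reducible
to `Q`. -/
def IsCoW2Hard {Δ : Type} (Q : ParamProblem Δ) : Prop :=
  ∀ (Γ : Type) [Finite Γ] (P : ParamProblem Γ), InCoW2 P → FPTReducible P Q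

/-! ### The problem k-Well-Covered Graph -/

open Classical in
/-- The encoding of a graph with vertices `0, …, n - 1` as a binary string: the rows of its
adjacency matrix, one after the other. -/
noncomputable def graphCode {n : ℕ} (G : SimpleGraph (Fin n)) : List Bool :=
  (List.ofFn fun i : Fin n => List.ofFn fun j : Fin n => decide (G.Adj i j)).flatten

/-- Every (inclusion-)maximal independent set of `G` has exactly `k` elements. -/
def AllMaximalIndepSetsHaveSize {V : Type} (G : SimpleGraph V) (k : ℕ) : Prop :=
  ∀ S : Finset V, Maximal (fun T : Finset V => G.IsIndepSet (T : Set V)) S → S.card = k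

/-- The problem k-Well-Covered Graph, parameterized by `k`: given a graph `G` (finite, with at
least one vertex) and `k`, does every maximal independent set of `G` have size exactly `k`? -/
def kWellCoveredGraph : ParamProblem Bool :=
  {I | ∃ (n : ℕ) (G : SimpleGraph (Fin n)), 0 < n ∧ I.1 = graphCode G ∧
    AllMaximalIndepSetsHaveSize G I.2}

end ParamComplexity

/-! It suffices to map, in polynomial time and with a parameter bounded in `k`, each instance `(A,
k)` of a weighted Fagin-defined problem to a graph that fails to be well-covered with the new
parameter exactly when a solution `S` exists (`isCoW2Hard_of_exprMap`).

Number the tuples in `A^s` by `0, …, N - 1`, where `N = n ^ s`. A set of `k` numbers cuts the range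
into `k + 1` gaps, and the two ends of a gap decide membership for every number in it. Let `d` be
one more than the number of argument patterns that an atom `X(…)` can have over the `p + q`
variables. There are `K = (k + 1) ^ d` slots, one for each `d`-tuple of gap indices; a value of a
slot is a guess of the ends of these `d` gaps. Since one slot speaks of `d` gaps at once, a single
value can certify the truth of the whole matrix `ψ` for given `a`, `b`, including its negative
`X`-literals. Pairwise consistency of the values forces them to come from one set of exactly `k`
numbers (`exists_slot_values_iff`).

In the graph each slot is a clique of its values, inconsistent valid values of different slots are
adjacent, and the checks form one further clique. A universal tuple `a` gives a check that is
adjacent to the values certifying `ψ` for `a` and some `b`; further checks, one for each slot, are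
adjacent to the valid values of the slot. Each slot also has an invalid dummy value without
neighbours outside the slot, so that a maximal independent set meets every slot and has size `K` or
`K + 1`. Size `K` means that the chosen values dominate all checks, that is, that they describe a
solution (`not_allMaximalIndepSetsHaveSize_iff`). Thus all maximal independent sets have size `K +
1` if and only if there is no solution.

To obtain an actual machine, the adjacency matrix is written with arithmetical expressions that have
truncated subtraction, access to the input bits and bounded sums. These are evaluated by stack
programs in polynomial time (`Expr.exists_bounds`), and they are closed under Boolean operations,
bounded quantifiers, division and powers with fixed exponents, which covers the evaluation of `ψ`
(`exists_expressible_realizeWith`) and the whole graph. Since `s`, `p`, `q` and `d` depend only on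
the formula, all numbers involved stay polynomial. Finally, machines are composed
(`OutputsWithin.comp`) to precede this map by a given fpt-reduction. -/

namespace ParamComplexity

open Turing

/-! ### Runs of stack machines -/

/-- `b` is reached from `a` by exactly `n` steps of `f`. -/
def StepsTo {α : Type} (f : α → Option α) (n : ℕ) (a b : α) : Prop :=
  (flip bind f)^[n] (some a) = some b

namespace StepsTo

variable {α : Type} {f : α → Option α}

theorem trans {m n : ℕ} {a b c : α} (h₁ : StepsTo f m a b) (h₂ : StepsTo f n b c) :
    StepsTo f (m + n) a c := by
  unfold StepsTo at *
  rw [Nat.add_comm, Function.iterate_add_apply, h₁, h₂]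

theorem single {a b : α} (h : f a = some b) : StepsTo f 1 a b := h

theorem head {n : ℕ} {a b c : α} (h₁ : f a = some b) (h₂ : StepsTo f n b c) :
    StepsTo f (n + 1) a c := by
  rw [Nat.add_comm]
  exact (single h₁).trans h₂

theorem exists_of_succ {n : ℕ} {a c : α} (h : StepsTo f (n + 1) a c) :
    ∃ b, f a = some b ∧ StepsTo f n b c := by
  unfold StepsTo at h
  rw [Function.iterate_succ_apply] at h
  rcases hb : f a with _ | b
  · exfalso
    have : flip bind f (some a) = none := hb
    rw [this] at h
    have key : ∀ n, (flip bind f)^[n] (none : Option α) = none := by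
      intro n
      induction n with
      | zero => rfl
      | succ n ih => rw [Function.iterate_succ_apply]; exact ih
    rw [key] at h
    cases h
  · refine ⟨b, rfl, ?_⟩
    have : flip bind f (some a) = some b := hb
    rwa [this] at h

end StepsTo

theorem outputsInTime_iff {tm : FinTM2} {l : List (tm.Γ tm.k₀)} {l' : List (tm.Γ tm.k₁)} {t : ℕ} :
    Nonempty (TM2OutputsInTime tm l (some l') t) ↔
      ∃ n ≤ t, StepsTo tm.step n (initList tm l) (haltList tm l') :=
  ⟨fun ⟨h⟩ => ⟨h.steps, h.steps_le_m, h.evals_in_steps⟩, fun ⟨n, hn, h⟩ => ⟨⟨⟨n, h⟩, hn⟩⟩⟩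

theorem initList_stk (tm : FinTM2) (s : List (tm.Γ tm.k₀)) :
    (initList tm s).stk = Function.update (fun _ => []) tm.k₀ s := by
  funext k
  by_cases h : k = tm.k₀
  · subst h; simp [initList]
  · simp [initList, h]

theorem haltList_stk (tm : FinTM2) (s : List (tm.Γ tm.k₁)) :
    (haltList tm s).stk = Function.update (fun _ => []) tm.k₁ s := by
  funext k
  by_cases h : k = tm.k₁
  · subst h; simp [haltList]
  · simp [haltList, h]

/-! ### The length of the output -/

section pushes

variable {K : Type} [DecidableEq K] {Γ : K → Type} {Λ σ : Type}

/-- An upper bound on the number of letters that are pushed in one execution of a statement. -/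
def pushBound : TM2.Stmt Γ Λ σ → ℕ
  | .push _ _ q => pushBound q + 1
  | .peek _ _ q => pushBound q
  | .pop _ _ q => pushBound q
  | .load _ q => pushBound q
  | .branch _ q₁ q₂ => pushBound q₁ + pushBound q₂
  | .goto _ => 0
  | .halt => 0

theorem length_stepAux_le (q : TM2.Stmt Γ Λ σ) (v : σ) (S : ∀ k, List (Γ k)) (k : K) :
    ((TM2.stepAux q v S).stk k).length ≤ (S k).length + pushBound q := by
  induction q generalizing v S with
  | push k' f q ih =>
    refine (ih _ _).trans ?_
    by_cases h : k = k'
    · subst h; simp [pushBound]; omega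
    · simp [pushBound, h]
  | peek k' f q ih => exact ih _ _
  | pop k' f q ih =>
    refine (ih _ _).trans ?_
    by_cases h : k = k'
    · subst h; simp [pushBound]
    · simp [pushBound, h]
  | load a q ih => exact ih _ _
  | branch f q₁ q₂ ih₁ ih₂ =>
    rw [TM2.stepAux]
    cases f v
    · exact (ih₂ _ _).trans (by simp [pushBound])
    · exact (ih₁ _ _).trans (by simp [pushBound])
  | goto f => simp [pushBound]
  | halt => simp [pushBound]

/-- A step executes one of finitely many statements, so the sum of their push bounds is a uniform
bound for the growth of a stack per step. -/
theorem length_stk_le [Fintype Λ] (M : Λ → TM2.Stmt Γ Λ σ) {n : ℕ} {c d : TM2.Cfg Γ Λ σ}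
    (h : StepsTo (TM2.step M) n c d) (k : K) :
    (d.stk k).length ≤ (c.stk k).length + n * ∑ l, pushBound (M l) := by
  induction n generalizing c with
  | zero => cases h; simp
  | succ n ih =>
    obtain ⟨b, hb, hn⟩ := h.exists_of_succ
    refine (ih hn).trans ?_
    obtain ⟨_ | l, v, S⟩ := c
    · cases hb
    · simp only [TM2.step, Option.some.injEq] at hb
      subst hb
      have h1 := length_stepAux_le (M l) v S k
      have h2 : pushBound (M l) ≤ ∑ l, pushBound (M l) :=
        Finset.single_le_sum (f := fun l => pushBound (M l)) (fun _ _ => Nat.zero_le _)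
          (Finset.mem_univ l)
      simp only [add_mul, one_mul]
      omega

end pushes

/-- The length of the output of a machine is linear in its running time. -/
theorem OutputsWithin.length_le {Γ Δ : Type} (M : TM2ComputableAux (Option Γ) (Option Δ)) :
    ∃ C : ℕ, ∀ I J t, OutputsWithin M I J t → instanceSize J ≤ instanceSize I + C * t := by
  have := M.tm.ΛFin
  refine ⟨∑ l, pushBound (M.tm.m l), fun I J t h => ?_⟩
  obtain ⟨n, hn, h⟩ := outputsInTime_iff.1 h
  have key := length_stk_le M.tm.m h M.tm.k₁
  have h1 : ((haltList M.tm ((encodeInstance J).map M.outputAlphabet.symm)).stk M.tm.k₁).length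
      = J.1.length + J.2 := by
    rw [haltList_stk]; simp [encodeInstance]
  have h2 : ((initList M.tm ((encodeInstance I).map M.inputAlphabet.symm)).stk M.tm.k₁).length
      ≤ I.1.length + I.2 := by
    rw [initList_stk]
    by_cases hk : M.tm.k₁ = M.tm.k₀
    · have : ∀ k (hk : k = M.tm.k₀), ((Function.update (fun _ => []) M.tm.k₀
        ((encodeInstance I).map M.inputAlphabet.symm) : ∀ k, List (M.tm.Γ k)) k).length
          = I.1.length + I.2 := by
        intro k hk; subst hk; simp [encodeInstance]
      exact (this _ hk).le
    · simp [hk]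
  have h3 : n * ∑ l, pushBound (M.tm.m l) ≤ (∑ l, pushBound (M.tm.m l)) * t := by
    rw [mul_comm]; exact Nat.mul_le_mul_left _ hn
  rw [h1] at key
  unfold instanceSize
  omega

/-! ### Simulating a machine inside a larger one -/

section simulation

variable {K K' : Type} [DecidableEq K] [DecidableEq K'] {Γ : K → Type} {Γ' : K' → Type}
  {Λ Λ' σ σ' ρ : Type}

/-- The statement of a larger machine that simulates a statement of a smaller one; where the smaller
machine halts, the larger one goes to the label `hl` (or halts). -/
def embedStmt (ι : K → K') (up : ∀ k, Γ k ≃ Γ' (ι k)) (e : σ' ≃ σ × ρ) (lab : Λ → Λ')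
    (hl : Option Λ') : TM2.Stmt Γ Λ σ → TM2.Stmt Γ' Λ' σ'
  | .push k f q => .push (ι k) (fun v => up k (f (e v).1)) (embedStmt ι up e lab hl q)
  | .peek k f q => .peek (ι k) (fun v a => e.symm (f (e v).1 (a.map (up k).symm), (e v).2))
      (embedStmt ι up e lab hl q)
  | .pop k f q => .pop (ι k) (fun v a => e.symm (f (e v).1 (a.map (up k).symm), (e v).2))
      (embedStmt ι up e lab hl q)
  | .load f q => .load (fun v => e.symm (f (e v).1, (e v).2)) (embedStmt ι up e lab hl q)
  | .branch f q₁ q₂ => .branch (fun v => f (e v).1) (embedStmt ι up e lab hl q₁)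
      (embedStmt ι up e lab hl q₂)
  | .goto f => .goto fun v => lab (f (e v).1)
  | .halt => hl.elim .halt fun l => .goto fun _ => l

/-- The configuration `c'` of the larger machine represents the configuration `c` of the smaller
one; the remaining part of the internal state is `r`, the remaining stacks are as in `F`. -/
structure Represents (ι : K → K') (up : ∀ k, Γ k ≃ Γ' (ι k)) (e : σ' ≃ σ × ρ) (lab : Λ → Λ')
    (hl : Option Λ') (r : ρ) (F : ∀ k, List (Γ' k)) (c : TM2.Cfg Γ Λ σ) (c' : TM2.Cfg Γ' Λ' σ') :
    Prop where
  l : c'.l = c.l.elim hl fun l => some (lab l)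
  var : e c'.var = (c.var, r)
  stk : ∀ k, c'.stk (ι k) = (c.stk k).map (up k)
  frame : ∀ k', k' ∉ Set.range ι → c'.stk k' = F k'

variable {ι : K → K'} {up : ∀ k, Γ k ≃ Γ' (ι k)} {e : σ' ≃ σ × ρ} {lab : Λ → Λ'}
  {hl : Option Λ'} {r : ρ} {F : ∀ k, List (Γ' k)}

/-- An embedded statement touches only stacks in the range of `ι` and only the first component of
the state, and injectivity of `ι` keeps different stacks apart. A redirected `halt` changes nothing
but the label. -/
theorem represents_stepAux (hι : Function.Injective ι) (q : TM2.Stmt Γ Λ σ) {v : σ} {v' : σ'}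
    {S : ∀ k, List (Γ k)} {S' : ∀ k, List (Γ' k)} (hv : e v' = (v, r))
    (hS : ∀ k, S' (ι k) = (S k).map (up k)) (hF : ∀ k', k' ∉ Set.range ι → S' k' = F k') :
    Represents ι up e lab hl r F (TM2.stepAux q v S)
      (TM2.stepAux (embedStmt ι up e lab hl q) v' S') := by
  induction q generalizing v v' S S' with
  | push k f q ih =>
    refine ih hv (fun k₂ => ?_) (fun k' hk' => ?_)
    · by_cases h : k₂ = k
      · subst h; simp [hv, hS]
      · simp [h, hι.ne h, hS]
    · have : k' ≠ ι k := fun h => hk' ⟨k, h.symm⟩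
      simp [this, hF k' hk']
  | peek k f q ih =>
    refine ih ?_ hS hF
    simp [hv, hS, Function.comp_def]
  | pop k f q ih =>
    refine ih ?_ (fun k₂ => ?_) (fun k' hk' => ?_)
    · simp [hv, hS, Function.comp_def]
    · by_cases h : k₂ = k
      · subst h; simp [hS]
      · simp [h, hι.ne h, hS]
    · have : k' ≠ ι k := fun h => hk' ⟨k, h.symm⟩
      simp [this, hF k' hk']
  | load f q ih =>
    refine ih ?_ hS hF
    simp [hv]
  | branch f q₁ q₂ ih₁ ih₂ =>
    simp only [embedStmt, TM2.stepAux, hv]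
    cases f v
    · exact ih₂ hv hS hF
    · exact ih₁ hv hS hF
  | goto f => exact ⟨by simp [embedStmt, hv], hv, hS, hF⟩
  | halt => cases hl <;> exact ⟨by simp [embedStmt], hv, hS, hF⟩

/-- A machine that contains the statements of a smaller one simulates it step by step. -/
theorem stepsTo_of_represents (hι : Function.Injective ι) {M : Λ → TM2.Stmt Γ Λ σ}
    {M' : Λ' → TM2.Stmt Γ' Λ' σ'} (hM : ∀ l, M' (lab l) = embedStmt ι up e lab hl (M l)) {n : ℕ}
    {c d : TM2.Cfg Γ Λ σ} {c' : TM2.Cfg Γ' Λ' σ'} (h : StepsTo (TM2.step M) n c d)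
    (hc : Represents ι up e lab hl r F c c') :
    ∃ d', StepsTo (TM2.step M') n c' d' ∧ Represents ι up e lab hl r F d d' := by
  induction n generalizing c c' with
  | zero => cases h; exact ⟨c', rfl, hc⟩
  | succ n ih =>
    obtain ⟨b, hb, hn⟩ := h.exists_of_succ
    obtain ⟨_ | l, v, S⟩ := c
    · cases hb
    · simp only [TM2.step, Option.some.injEq] at hb
      subst hb
      obtain ⟨l', v', S'⟩ := c'
      have hl' : l' = some (lab l) := hc.l
      subst hl'
      obtain ⟨d', hd', hr⟩ := ih hn (represents_stepAux hι (M l) hc.var hc.stk hc.frame)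
      exact ⟨d', StepsTo.head (by rw [TM2.step, hM]) hd', hr⟩

end simulation

/-! ### Composition of machines -/

section composition

variable {B : Type} (M₁ M₂ : FinTM2) (φ₁ : M₁.Γ M₁.k₁ ≃ B) (φ₂ : M₂.Γ M₂.k₀ ≃ B)

/-- The stacks of the composition of two machines: those of the machines, and an auxiliary one. -/
abbrev compStacks (B : Type) (M₁ M₂ : FinTM2) : M₁.K ⊕ M₂.K ⊕ Unit → Type :=
  Sum.elim M₁.Γ (Sum.elim M₂.Γ fun _ => Option B)

/-- The internal state of the composition of two machines, seen from the second machine. -/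
def compStateEquiv (α β γ : Type) : α × β × γ ≃ β × α × γ where
  toFun v := (v.2.1, v.1, v.2.2)
  invFun v := (v.2.1, v.1, v.2.2)
  left_inv _ := rfl
  right_inv _ := rfl

/-- The program that runs `M₁`, moves its output to the input stack of `M₂` (over an auxiliary
stack, which restores the order of the letters), and runs `M₂`. -/
def compProgram [Inhabited B] : M₁.Λ ⊕ M₂.Λ ⊕ Bool →
    TM2.Stmt (compStacks B M₁ M₂) (M₁.Λ ⊕ M₂.Λ ⊕ Bool) (M₁.σ × M₂.σ × Option B)
  | .inl l => embedStmt (Γ' := compStacks B M₁ M₂) Sum.inl (fun _ => Equiv.refl _) (Equiv.refl _)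
      Sum.inl (some (.inr (.inr false))) (M₁.m l)
  | .inr (.inl l) => embedStmt (Γ' := compStacks B M₁ M₂) (fun k => Sum.inr (Sum.inl k))
      (fun _ => Equiv.refl _) (compStateEquiv _ _ _) (fun l => Sum.inr (Sum.inl l)) none (M₂.m l)
  | .inr (.inr false) =>
      .pop (.inl M₁.k₁) (fun v a => (v.1, v.2.1, a.map φ₁)) <|
      .branch (fun v => v.2.2.isSome)
        (.push (.inr (.inr ())) (fun v => v.2.2) <| .goto fun _ => .inr (.inr false))
        (.goto fun _ => .inr (.inr true))
  | .inr (.inr true) =>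
      .pop (.inr (.inr ())) (fun v a => (v.1, v.2.1, Option.join a)) <|
      .branch (fun v => v.2.2.isSome)
        (.push (.inr (.inl M₂.k₀)) (fun v => φ₂.symm (v.2.2.getD default)) <|
          .goto fun _ => .inr (.inr true))
        (.goto fun _ => .inr (.inl M₂.main))

/-- The contents of the stacks of the composition of two machines. -/
def compStk {B : Type} {M₁ M₂ : FinTM2} (S₁ : ∀ k, List (M₁.Γ k)) (S₂ : ∀ k, List (M₂.Γ k))
    (u : List (Option B)) : ∀ k, List (compStacks B M₁ M₂ k)
  | .inl k => S₁ k
  | .inr (.inl k) => S₂ k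
  | .inr (.inr _) => u

section compStk

variable {M₁ M₂ : FinTM2} (S₁ : ∀ k, List (M₁.Γ k)) (S₂ : ∀ k, List (M₂.Γ k)) (u : List (Option B))

theorem update_compStk₁ (k : M₁.K) (s : List (M₁.Γ k)) :
    Function.update (β := fun k => List (compStacks B M₁ M₂ k)) (compStk S₁ S₂ u) (.inl k) s =
      compStk (Function.update S₁ k s) S₂ u := by
  funext k'
  rcases k' with k' | k' | k'
  · by_cases h : k' = k
    · subst h
      exact (Function.update_self ..).trans
        (Function.update_self (β := fun k => List (M₁.Γ k)) ..).symm
    · exact (Function.update_of_ne (Sum.inl_injective.ne h) ..).trans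
        (Function.update_of_ne (β := fun k => List (M₁.Γ k)) h ..).symm
  · exact Function.update_of_ne (by simp) ..
  · exact Function.update_of_ne (by simp) ..

theorem update_compStk₂ (k : M₂.K) (s : List (M₂.Γ k)) :
    Function.update (β := fun k => List (compStacks B M₁ M₂ k)) (compStk S₁ S₂ u)
      (.inr (.inl k)) s = compStk S₁ (Function.update S₂ k s) u := by
  funext k'
  rcases k' with k' | k' | k'
  · exact Function.update_of_ne (by simp) ..
  · by_cases h : k' = k
    · subst h
      exact (Function.update_self ..).trans
        (Function.update_self (β := fun k => List (M₂.Γ k)) ..).symm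
    · exact (Function.update_of_ne ((Sum.inr_injective.comp Sum.inl_injective).ne h) ..).trans
        (Function.update_of_ne (β := fun k => List (M₂.Γ k)) h ..).symm
  · exact Function.update_of_ne (by simp) ..

theorem update_compStk₃ (s : List (Option B)) :
    Function.update (β := fun k => List (compStacks B M₁ M₂ k)) (compStk S₁ S₂ u)
      (.inr (.inr ())) s = compStk S₁ S₂ s := by
  funext k'
  rcases k' with k' | k' | k'
  · exact Function.update_of_ne (by simp) ..
  · exact Function.update_of_ne (by simp) ..
  · exact Function.update_self ..

theorem compStk_nil :
    (compStk (fun _ => []) (fun _ => []) [] : ∀ k, List (compStacks B M₁ M₂ k)) = fun _ => [] := by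
  funext k
  rcases k with k | k | k <;> rfl

end compStk

/-- The configurations of `compProgram` while the output of `M₁` is moved: `s`, `u` and `t` are
the contents of the output stack of `M₁`, the auxiliary stack and the input stack of `M₂`. -/
def moveCfg (l : M₁.Λ ⊕ M₂.Λ ⊕ Bool) (o : Option B) (s u t : List B) :
    TM2.Cfg (compStacks B M₁ M₂) (M₁.Λ ⊕ M₂.Λ ⊕ Bool) (M₁.σ × M₂.σ × Option B) where
  l := some l
  var := (M₁.initialState, M₂.initialState, o)
  stk := compStk (Function.update (fun _ => []) M₁.k₁ (s.map φ₁.symm))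
    (Function.update (fun _ => []) M₂.k₀ (t.map φ₂.symm)) (u.map some)

variable [Inhabited B]

theorem moveCfg_step_cons₁ (o : Option B) (b : B) (s u t : List B) :
    TM2.step (compProgram M₁ M₂ φ₁ φ₂) (moveCfg M₁ M₂ φ₁ φ₂ (.inr (.inr false)) o (b :: s) u t) =
      some (moveCfg M₁ M₂ φ₁ φ₂ (.inr (.inr false)) (some b) s (b :: u) t) := by
  simp only [TM2.step, moveCfg, compProgram, TM2.stepAux]
  simp [update_compStk₁, update_compStk₃, compStk]

theorem moveCfg_step_nil₁ (o : Option B) (u t : List B) :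
    TM2.step (compProgram M₁ M₂ φ₁ φ₂) (moveCfg M₁ M₂ φ₁ φ₂ (.inr (.inr false)) o [] u t) =
      some (moveCfg M₁ M₂ φ₁ φ₂ (.inr (.inr true)) none [] u t) := by
  simp only [TM2.step, moveCfg, compProgram, TM2.stepAux]
  simp [update_compStk₁, update_compStk₃, compStk]

theorem moveCfg_step_cons₂ (o : Option B) (b : B) (u t : List B) :
    TM2.step (compProgram M₁ M₂ φ₁ φ₂) (moveCfg M₁ M₂ φ₁ φ₂ (.inr (.inr true)) o [] (b :: u) t) =
      some (moveCfg M₁ M₂ φ₁ φ₂ (.inr (.inr true)) (some b) [] u (b :: t)) := by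
  simp only [TM2.step, moveCfg, compProgram, TM2.stepAux]
  simp [update_compStk₂, update_compStk₃, compStk]

theorem moveCfg_step_nil₂ (o : Option B) (t : List B) :
    TM2.step (compProgram M₁ M₂ φ₁ φ₂) (moveCfg M₁ M₂ φ₁ φ₂ (.inr (.inr true)) o [] [] t) =
      some (moveCfg M₁ M₂ φ₁ φ₂ (.inr (.inl M₂.main)) none [] [] t) := by
  simp only [TM2.step, moveCfg, compProgram, TM2.stepAux]
  simp [update_compStk₂, update_compStk₃, compStk]

theorem moveCfg_stepsTo (o : Option B) (s : List B) :
    StepsTo (TM2.step (compProgram M₁ M₂ φ₁ φ₂)) (2 * s.length + 2)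
      (moveCfg M₁ M₂ φ₁ φ₂ (.inr (.inr false)) o s [] [])
      (moveCfg M₁ M₂ φ₁ φ₂ (.inr (.inl M₂.main)) none [] [] s) := by
  have h₁ : ∀ (s : List B) o u, StepsTo (TM2.step (compProgram M₁ M₂ φ₁ φ₂)) (s.length + 1)
      (moveCfg M₁ M₂ φ₁ φ₂ (.inr (.inr false)) o s u [])
      (moveCfg M₁ M₂ φ₁ φ₂ (.inr (.inr true)) none [] (s.reverse ++ u) []) := by
    intro s
    induction s with
    | nil => intro o u; exact StepsTo.single (moveCfg_step_nil₁ M₁ M₂ φ₁ φ₂ o u [])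
    | cons b s ih =>
      intro o u
      have := ih (some b) (b :: u)
      rw [List.reverse_cons, List.append_assoc]
      exact StepsTo.head (moveCfg_step_cons₁ M₁ M₂ φ₁ φ₂ o b s u []) this
  have h₂ : ∀ (u : List B) o t, StepsTo (TM2.step (compProgram M₁ M₂ φ₁ φ₂)) (u.length + 1)
      (moveCfg M₁ M₂ φ₁ φ₂ (.inr (.inr true)) o [] u t)
      (moveCfg M₁ M₂ φ₁ φ₂ (.inr (.inl M₂.main)) none [] [] (u.reverse ++ t)) := by
    intro u
    induction u with
    | nil => intro o t; exact StepsTo.single (moveCfg_step_nil₂ M₁ M₂ φ₁ φ₂ o t)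
    | cons b u ih =>
      intro o t
      have := ih (some b) (b :: t)
      rw [List.reverse_cons, List.append_assoc]
      exact StepsTo.head (moveCfg_step_cons₂ M₁ M₂ φ₁ φ₂ o b u t) this
  have := (h₁ s o []).trans (h₂ (s.reverse ++ []) none [])
  simp only [List.append_nil, List.length_reverse, List.reverse_reverse] at this
  convert this using 1
  omega

/-- Halting in `haltList` means that the state is reset and all stacks except the output are empty.
Hence moving the output of `M₁` produces precisely a configuration that represents the initial one
of `M₂`, and the two simulations can be glued together. -/
theorem compProgram_stepsTo {x : List (M₁.Γ M₁.k₀)} {y : List B} {z : List (M₂.Γ M₂.k₁)}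
    {n₁ n₂ : ℕ} (h₁ : StepsTo M₁.step n₁ (initList M₁ x) (haltList M₁ (y.map φ₁.symm)))
    (h₂ : StepsTo M₂.step n₂ (initList M₂ (y.map φ₂.symm)) (haltList M₂ z)) :
    StepsTo (TM2.step (compProgram M₁ M₂ φ₁ φ₂)) (n₁ + (2 * y.length + 2) + n₂)
      ⟨some (.inl M₁.main), (M₁.initialState, M₂.initialState, none),
        compStk (Function.update (fun _ => []) M₁.k₀ x) (fun _ => []) []⟩
      ⟨none, (M₁.initialState, M₂.initialState, none),
        compStk (fun _ => []) (Function.update (fun _ => []) M₂.k₁ z) []⟩ := by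
  obtain ⟨d, hd, hr⟩ := stepsTo_of_represents (M' := compProgram M₁ M₂ φ₁ φ₂) (ι := Sum.inl)
    (Γ' := compStacks B M₁ M₂) (lab := Sum.inl) (hl := some (.inr (.inr false)))
    (up := fun k => Equiv.refl (M₁.Γ k)) (e := Equiv.refl _) (r := (M₂.initialState, none))
    (F := fun _ => []) (c' := ⟨some (.inl M₁.main), (M₁.initialState, M₂.initialState, none),
        compStk (Function.update (fun _ => []) M₁.k₀ x) (fun _ => []) []⟩)
    Sum.inl_injective (fun l => rfl) h₁
    ⟨rfl, rfl, fun k => by rw [initList_stk]; exact (List.map_id _).symm, fun k hk => by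
      rcases k with k | k | k
      · exact absurd ⟨k, rfl⟩ hk
      · rfl
      · rfl⟩
  have hdm : d = moveCfg M₁ M₂ φ₁ φ₂ (.inr (.inr false)) none y [] [] := by
    obtain ⟨l, v, S⟩ := d
    obtain ⟨rfl, rfl, hS, hF⟩ := hr
    simp only at hS hF
    unfold moveCfg
    congr 1
    funext k
    rcases k with k | k | k
    · refine (hS k).trans ?_
      rw [haltList_stk]
      exact List.map_id _
    · refine (hF _ (by simp)).trans ?_
      simp [compStk]
    · exact (hF _ (by simp))
  subst hdm
  obtain ⟨d, hd', hr⟩ := stepsTo_of_represents (M' := compProgram M₁ M₂ φ₁ φ₂)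
    (Γ' := compStacks B M₁ M₂)
    (ι := fun k => Sum.inr (Sum.inl k)) (lab := fun l => Sum.inr (Sum.inl l)) (hl := none)
    (up := fun k => Equiv.refl (M₂.Γ k)) (e := compStateEquiv _ _ _)
    (r := (M₁.initialState, none))
    (F := fun _ => []) (c' := moveCfg M₁ M₂ φ₁ φ₂ (.inr (.inl M₂.main)) none [] [] y)
    (Sum.inr_injective.comp Sum.inl_injective) (fun l => rfl) h₂
    ⟨rfl, rfl, fun k => by rw [initList_stk]; exact (List.map_id _).symm, fun k hk => by
      rcases k with k | k | k
      · simp [moveCfg, compStk]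
      · exact absurd ⟨k, rfl⟩ hk
      · rfl⟩
  have hdh : d = ⟨none, (M₁.initialState, M₂.initialState, none),
        compStk (fun _ => []) (Function.update (fun _ => []) M₂.k₁ z) []⟩ := by
    obtain ⟨l, v, S⟩ := d
    obtain ⟨rfl, hv, hS, hF⟩ := hr
    simp only at hS hF hv
    have e₂ : v = (M₁.initialState, M₂.initialState, none) :=
      (compStateEquiv _ _ _).injective hv
    subst e₂
    congr 1
    funext k
    rcases k with k | k | k
    · exact hF _ (by simp)
    · refine (hS k).trans ?_
      rw [haltList_stk]
      exact List.map_id _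
    · exact hF _ (by simp)
  subst hdh
  exact (hd.trans (moveCfg_stepsTo M₁ M₂ φ₁ φ₂ none y)).trans hd'

end composition

/-- The composition of two machines. -/
def compMachine {A B C : Type} [Fintype B] [Inhabited B] (M₁ : TM2ComputableAux A B)
    (M₂ : TM2ComputableAux B C) : TM2ComputableAux A C where
  tm :=
    letI := M₁.tm.kFin
    letI := M₂.tm.kFin
    letI := M₁.tm.ΛFin
    letI := M₂.tm.ΛFin
    letI := M₁.tm.σFin
    letI := M₂.tm.σFin
    { K := M₁.tm.K ⊕ M₂.tm.K ⊕ Unit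
      k₀ := .inl M₁.tm.k₀
      k₁ := .inr (.inl M₂.tm.k₁)
      Γ := compStacks B M₁.tm M₂.tm
      Λ := M₁.tm.Λ ⊕ M₂.tm.Λ ⊕ Bool
      main := .inl M₁.tm.main
      σ := M₁.tm.σ × M₂.tm.σ × Option B
      initialState := (M₁.tm.initialState, M₂.tm.initialState, none)
      Γk₀Fin := M₁.tm.Γk₀Fin
      m := compProgram M₁.tm M₂.tm M₁.outputAlphabet M₂.inputAlphabet }
  inputAlphabet := M₁.inputAlphabet
  outputAlphabet := M₂.outputAlphabet

theorem initList_eq (tm : FinTM2) (s : List (tm.Γ tm.k₀)) :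
    initList tm s = ⟨some tm.main, tm.initialState, Function.update (fun _ => []) tm.k₀ s⟩ := by
  rw [← initList_stk]; rfl

theorem haltList_eq (tm : FinTM2) (s : List (tm.Γ tm.k₁)) :
    haltList tm s = ⟨none, tm.initialState, Function.update (fun _ => []) tm.k₁ s⟩ := by
  rw [← haltList_stk]; rfl

theorem OutputsWithin.comp {Γ Δ Θ : Type} [Fintype Δ] {M₁ : TM2ComputableAux (Option Γ) (Option Δ)}
    {M₂ : TM2ComputableAux (Option Δ) (Option Θ)} {I : List Γ × ℕ} {J : List Δ × ℕ}
    {L : List Θ × ℕ} {t₁ t₂ : ℕ} (h₁ : OutputsWithin M₁ I J t₁) (h₂ : OutputsWithin M₂ J L t₂) :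
    OutputsWithin (compMachine M₁ M₂) I L (t₁ + 2 * instanceSize J + t₂) := by
  obtain ⟨n₁, hn₁, h₁⟩ := outputsInTime_iff.1 h₁
  obtain ⟨n₂, hn₂, h₂⟩ := outputsInTime_iff.1 h₂
  -- The size of `J` exceeds the length of its encoding by one, which pays for the two steps that
  -- find an empty stack.
  refine outputsInTime_iff.2 ⟨n₁ + (2 * (encodeInstance J).length + 2) + n₂, ?_, ?_⟩
  · simp only [encodeInstance, instanceSize, List.length_append, List.length_map,
      List.length_replicate]
    omega
  · rw [initList_eq, haltList_eq]
    have e₁ := update_compStk₁ (M₁ := M₁.tm) (M₂ := M₂.tm) (fun _ => []) (fun _ => [])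
      ([] : List (Option (Option Δ))) M₁.tm.k₀ ((encodeInstance I).map M₁.inputAlphabet.symm)
    have e₂ := update_compStk₂ (M₁ := M₁.tm) (M₂ := M₂.tm) (fun _ => []) (fun _ => [])
      ([] : List (Option (Option Δ))) M₂.tm.k₁ ((encodeInstance L).map M₂.outputAlphabet.symm)
    rw [compStk_nil] at e₁ e₂
    refine (congrArg₂ (StepsTo (compMachine M₁ M₂).tm.step _) (congrArg (TM2.Cfg.mk _ _) e₁)
      (congrArg (TM2.Cfg.mk _ _) e₂)).mpr ?_
    exact compProgram_stepsTo M₁.tm M₂.tm M₁.outputAlphabet M₂.inputAlphabet h₁ h₂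

/-! ### A structured programming language for stack machines -/

/-- Programs over the stacks `0, 1, 2, …`: `case k p` pops a letter from the stack `k` and branches
on it; `loop k p` pops letters from the stack `k` until it is empty, and runs `p a` after popping
the letter `a`. -/
inductive Prog (A : Type) : Type
  | skip : Prog A
  | push : ℕ → A → Prog A
  | seq : Prog A → Prog A → Prog A
  | case : ℕ → (Option A → Prog A) → Prog A
  | loop : ℕ → (A → Prog A) → Prog A

/-- The program `p`, started with the stacks `S`, ends with the stacks `S'` after `t` steps. -/
inductive Exec {A : Type} : Prog A → (ℕ → List A) → (ℕ → List A) → ℕ → Prop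
  | skip (S) : Exec .skip S S 1
  | push (k a S) : Exec (.push k a) S (Function.update S k (a :: S k)) 1
  | seq {p q S S' S'' t t'} : Exec p S S' t → Exec q S' S'' t' → Exec (.seq p q) S S'' (t + t')
  | case {k p S S' t} : Exec (p (S k).head?) (Function.update S k (S k).tail) S' t →
      Exec (.case k p) S S' (t + 1)
  | loop_nil {k p S} : S k = [] → Exec (.loop k p) S S 1
  | loop_cons {k p S S' S'' a l t t'} : S k = a :: l → Exec (p a) (Function.update S k l) S' t →
      Exec (.loop k p) S' S'' t' → Exec (.loop k p) S S'' (t + t' + 1)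

namespace Prog

variable {A : Type}

/-- The labels of the machine for a program. -/
def Lab : Prog A → Type
  | .skip => Unit
  | .push _ _ => Unit
  | .seq p q => Lab p ⊕ Lab q
  | .case _ p => Option (Σ a, Lab (p a))
  | .loop _ p => Option (Σ a, Lab (p a))

/-- The label at which the machine for a program starts. -/
def start : (p : Prog A) → Lab p
  | .skip => ()
  | .push _ _ => ()
  | .seq p _ => .inl (start p)
  | .case _ _ => none
  | .loop _ _ => none

theorem finite_lab [Finite A] (p : Prog A) : Finite (Lab p) := by
  induction p with
  | skip => exact inferInstanceAs (Finite Unit)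
  | push => exact inferInstanceAs (Finite Unit)
  | seq p q ihp ihq => exact inferInstanceAs (Finite (Lab p ⊕ Lab q))
  | case k p ih => exact inferInstanceAs (Finite (Option (Σ a, Lab (p a))))
  | loop k p ih => exact inferInstanceAs (Finite (Option (Σ a, Lab (p a))))

/-- The program uses only the stacks `0, …, R`. -/
def UsesUpTo (R : ℕ) : Prog A → Prop
  | .skip => True
  | .push k _ => k ≤ R
  | .seq p q => UsesUpTo R p ∧ UsesUpTo R q
  | .case k p => k ≤ R ∧ ∀ a, UsesUpTo R (p a)
  | .loop k p => k ≤ R ∧ ∀ a, UsesUpTo R (p a)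

theorem UsesUpTo.mono {R R' : ℕ} (h : R ≤ R') {p : Prog A} (hp : UsesUpTo R p) :
    UsesUpTo R' p := by
  induction p with
  | skip => trivial
  | push k a => exact le_trans hp h
  | seq p q ihp ihq => exact ⟨ihp hp.1, ihq hp.2⟩
  | case k p ih => exact ⟨hp.1.trans h, fun a => ih a (hp.2 a)⟩
  | loop k p ih => exact ⟨hp.1.trans h, fun a => ih a (hp.2 a)⟩

theorem exists_usesUpTo_forall {ι : Type} [Finite ι] {p : ι → Prog A}
    (h : ∀ a, ∃ R, UsesUpTo R (p a)) : ∃ R, ∀ a, UsesUpTo R (p a) := by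
  choose R hR using h
  obtain ⟨B, hB⟩ := (Set.finite_range R).bddAbove
  exact ⟨B, fun a => (hR a).mono (hB ⟨a, rfl⟩)⟩

theorem exists_usesUpTo [Finite A] (p : Prog A) : ∃ R, UsesUpTo R p := by
  induction p with
  | skip => exact ⟨0, trivial⟩
  | push k a => exact ⟨k, le_refl k⟩
  | seq p q ihp ihq =>
    obtain ⟨R₁, h₁⟩ := ihp
    obtain ⟨R₂, h₂⟩ := ihq
    exact ⟨max R₁ R₂, h₁.mono (le_max_left _ _), h₂.mono (le_max_right _ _)⟩
  | case k p ih =>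
    obtain ⟨R, h⟩ := exists_usesUpTo_forall ih
    exact ⟨max k R, le_max_left _ _, fun a => (h a).mono (le_max_right _ _)⟩
  | loop k p ih =>
    obtain ⟨R, h⟩ := exists_usesUpTo_forall ih
    exact ⟨max k R, le_max_left _ _, fun a => (h a).mono (le_max_right _ _)⟩

variable (R : ℕ)

/-- The statements of a machine that runs the program and then goes to the label `exit`. -/
def compile {Λ : Type} : (p : Prog A) → (Lab p → Λ) → Λ → Lab p →
    TM2.Stmt (fun _ : Fin (R + 1) => A) Λ (Option A)
  | .skip, _, exit, _ => .goto fun _ => exit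
  | .push k a, _, exit, _ => .push (Fin.ofNat (R + 1) k) (fun _ => a) <| .goto fun _ => exit
  | .seq p q, inj, exit, l => match l with
    | .inl l => compile p (fun l => inj (.inl l)) (inj (.inr (start q))) l
    | .inr l => compile q (fun l => inj (.inr l)) exit l
  | .case k p, inj, exit, l => match l with
    | none => .pop (Fin.ofNat (R + 1) k) (fun _ a => a) <|
        .goto fun v => inj (some ⟨v, start (p v)⟩)
    | some ⟨a, l⟩ => compile (p a) (fun l => inj (some ⟨a, l⟩)) exit l
  | .loop k p, inj, exit, l => match l with
    | none => .pop (Fin.ofNat (R + 1) k) (fun _ a => a) <|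
        .goto fun v => v.elim exit fun a => inj (some ⟨a, start (p a)⟩)
    | some ⟨a, l⟩ => compile (p a) (fun l => inj (some ⟨a, l⟩)) (inj none) l

variable {R}

theorem update_comp_val (S : ℕ → List A) {k : ℕ} (hk : k ≤ R) (s : List A) :
    Function.update (fun i : Fin (R + 1) => S i) (Fin.ofNat (R + 1) k) s =
      fun i : Fin (R + 1) => Function.update S k s i := by
  funext i
  have hv : (Fin.ofNat (R + 1) k).val = k := Nat.mod_eq_of_lt (by omega)
  by_cases h : i = Fin.ofNat (R + 1) k
  · subst h
    rw [Function.update_self, hv, Function.update_self]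
  · rw [Function.update_of_ne h, Function.update_of_ne]
    intro h'
    exact h (Fin.ext (h'.trans hv.symm))

theorem apply_ofNat (S : ℕ → List A) {k : ℕ} (hk : k ≤ R) :
    S (Fin.ofNat (R + 1) k).val = S k := by
  have hv : (Fin.ofNat (R + 1) k).val = k := Nat.mod_eq_of_lt (by omega)
  rw [hv]

/-- The state `v` may be arbitrary on entry: it is only read directly after a pop, which overwrites
it. The lemma holds for every embedding `inj` of the labels and every `exit`, as the induction
passes to subprograms with their own exits. -/
theorem stepsTo_of_exec {Λ : Type} {M : Λ → TM2.Stmt (fun _ : Fin (R + 1) => A) Λ (Option A)}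
    {p : Prog A} {S S' : ℕ → List A} {t : ℕ} (h : Exec p S S' t) (hp : UsesUpTo R p)
    (inj : Lab p → Λ) (exit : Λ) (hM : ∀ l, M (inj l) = compile R p inj exit l) (v : Option A) :
    ∃ v', StepsTo (TM2.step M) t ⟨some (inj (start p)), v, fun i => S i⟩
      ⟨some exit, v', fun i => S' i⟩ := by
  induction h generalizing exit v with
  | skip S => exact ⟨v, StepsTo.single (by rw [TM2.step, hM]; rfl)⟩
  | push k a S =>
    refine ⟨v, StepsTo.single ?_⟩
    rw [TM2.step, hM]
    simp only [compile, TM2.stepAux, update_comp_val S hp, apply_ofNat S hp]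
  | seq h₁ h₂ ih₁ ih₂ =>
    obtain ⟨v₁, hv₁⟩ := ih₁ hp.1 (fun l => inj (.inl l)) _ (fun l => hM (.inl l)) v
    obtain ⟨v₂, hv₂⟩ := ih₂ hp.2 (fun l => inj (.inr l)) _ (fun l => hM (.inr l)) v₁
    exact ⟨v₂, hv₁.trans hv₂⟩
  | @case k p S S' t h ih =>
    obtain ⟨v₁, hv₁⟩ := ih (hp.2 _) (fun l => inj (some ⟨_, l⟩)) _ (fun l => hM (some ⟨_, l⟩))
      (S k).head?
    refine ⟨v₁, StepsTo.head ?_ hv₁⟩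
    rw [TM2.step, hM]
    simp only [start, compile, TM2.stepAux, update_comp_val S hp.1]
    rw [apply_ofNat S hp.1]
  | @loop_nil k p S h =>
    refine ⟨none, StepsTo.single ?_⟩
    rw [TM2.step, hM]
    simp only [start, compile, TM2.stepAux, update_comp_val S hp.1, apply_ofNat S hp.1, h]
    have hS : Function.update S k [] = S := by rw [← h, Function.update_eq_self]
    simp [hS]
  | @loop_cons k p S S' S'' a l t t' h h₁ h₂ ih₁ ih₂ =>
    obtain ⟨v₁, hv₁⟩ := ih₁ (hp.2 _) (fun l => inj (some ⟨_, l⟩)) _ (fun l => hM (some ⟨_, l⟩))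
      (some a)
    obtain ⟨v₂, hv₂⟩ := ih₂ hp inj exit hM v₁
    refine ⟨v₂, StepsTo.head ?_ (hv₁.trans hv₂)⟩
    rw [TM2.step, hM]
    simp only [start, compile, TM2.stepAux, update_comp_val S hp.1, apply_ofNat S hp.1, h]
    rfl

/-- The machine that runs a program; the input is on the stack `0`, the output on the stack `1`. -/
noncomputable def machine {A : Type} [Fintype A] (R : ℕ) (p : Prog A) : TM2ComputableAux A A where
  tm :=
    letI := p.finite_lab
    letI := Fintype.ofFinite (Lab p)
    { K := Fin (R + 2)
      k₀ := 0
      k₁ := 1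
      Γ := fun _ => A
      Λ := Option (Lab p)
      main := some p.start
      σ := Option A
      initialState := none
      Γk₀Fin := inferInstance
      m := fun l => match l with
        | none => .load (fun _ => none) .halt
        | some l => compile (R + 1) p some none l }
  inputAlphabet := Equiv.refl _
  outputAlphabet := Equiv.refl _

end Prog

/-- The additional step is the one at the label `none`, which resets the state before halting. -/
theorem outputsWithin_machine {Γ : Type} [Fintype Γ] {R : ℕ} {p : Prog (Option Γ)}
    (hp : p.UsesUpTo R) {I J : List Γ × ℕ} {t : ℕ}
    (h : Exec p (Function.update (fun _ => []) 0 (encodeInstance I))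
      (Function.update (fun _ => []) 1 (encodeInstance J)) t) :
    OutputsWithin (Prog.machine R p) I J (t + 1) := by
  refine outputsInTime_iff.2 ⟨t + 1, le_refl _, ?_⟩
  obtain ⟨v, hv⟩ := Prog.stepsTo_of_exec (M := (Prog.machine R p).tm.m) h
    (hp.mono (Nat.le_succ R)) some none (fun l => rfl) none
  have := hv.trans (StepsTo.single (b := ⟨none, none, _⟩) rfl)
  rw [initList_eq, haltList_eq]
  have e₀ := Prog.update_comp_val (R := R + 1) (fun _ => []) (k := 0) (by omega) (encodeInstance I)
  have e₁ := Prog.update_comp_val (R := R + 1) (fun _ => []) (k := 1) (by omega) (encodeInstance J)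
  rw [← e₀, ← e₁] at this
  have i₀ : (encodeInstance I).map (Prog.machine R p).inputAlphabet.symm = encodeInstance I :=
    List.map_id _
  have i₁ : (encodeInstance J).map (Prog.machine R p).outputAlphabet.symm = encodeInstance J :=
    List.map_id _
  rw [i₀, i₁]
  exact this

/-! ### Polynomially bounded functions -/

/-- The function is bounded by a polynomial. -/
def PolyBounded (f : ℕ → ℕ) : Prop := ∃ c, ∀ B, f B ≤ (B + 2) ^ c

namespace PolyBounded

/-- The base `B + 2` is at least two, so constants are absorbed by the exponent and no coefficients
are needed. -/
theorem const (a : ℕ) : PolyBounded fun _ => a :=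
  ⟨a, fun B => (Nat.lt_pow_self (by omega)).le⟩

theorem id : PolyBounded fun B => B := ⟨1, fun B => by simp⟩

theorem add {f g : ℕ → ℕ} (hf : PolyBounded f) (hg : PolyBounded g) :
    PolyBounded fun B => f B + g B := by
  obtain ⟨c, hc⟩ := hf
  obtain ⟨d, hd⟩ := hg
  refine ⟨c + d + 1, fun B => ?_⟩
  have h₁ : (B + 2) ^ c ≤ (B + 2) ^ (c + d) := Nat.pow_le_pow_right (by omega) (by omega)
  have h₂ : (B + 2) ^ d ≤ (B + 2) ^ (c + d) := Nat.pow_le_pow_right (by omega) (by omega)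
  calc f B + g B ≤ (B + 2) ^ (c + d) * 2 := by linarith [hc B, hd B]
    _ ≤ (B + 2) ^ (c + d) * (B + 2) := Nat.mul_le_mul_left _ (by omega)
    _ = (B + 2) ^ (c + d + 1) := (pow_succ _ _).symm

theorem mul {f g : ℕ → ℕ} (hf : PolyBounded f) (hg : PolyBounded g) :
    PolyBounded fun B => f B * g B := by
  obtain ⟨c, hc⟩ := hf
  obtain ⟨d, hd⟩ := hg
  exact ⟨c + d, fun B => (Nat.mul_le_mul (hc B) (hd B)).trans (pow_add _ _ _).ge⟩

theorem comp {f g : ℕ → ℕ} (hf : PolyBounded f) (hg : PolyBounded g) :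
    PolyBounded fun B => f (g B) := by
  obtain ⟨c, hc⟩ := hf
  obtain ⟨d, hd⟩ := hg
  refine ⟨(d + 2) * c, fun B => (hc _).trans ?_⟩
  rw [pow_mul]
  refine Nat.pow_le_pow_left ?_ c
  have h₁ : 1 ≤ (B + 2) ^ d := Nat.one_le_pow _ _ (by omega)
  have h₂ : 2 ^ 2 ≤ (B + 2) ^ 2 := Nat.pow_le_pow_left (by omega) 2
  have := hd B
  rw [pow_add]
  nlinarith

end PolyBounded

/-! ### Arithmetical expressions with bounded sums, and their evaluation by programs -/

/-- Extends an assignment of the variables by a value for a new variable `0`. -/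
def consEnv (a : ℕ) (env : ℕ → ℕ) : ℕ → ℕ
  | 0 => a
  | i + 1 => env i

/-- Arithmetical expressions over an input word: `bit e` is the letter at the position `e`, and
`sum g h` is the sum of the values of `h` when its variable `0` runs over the numbers below `g`. -/
inductive Expr : Type
  | one : Expr
  | var : ℕ → Expr
  | add : Expr → Expr → Expr
  | sub : Expr → Expr → Expr
  | bit : Expr → Expr
  | sum : Expr → Expr → Expr

/-- The value of an expression. -/
def Expr.eval (w : List Bool) : Expr → (ℕ → ℕ) → ℕ
  | .one, _ => 1
  | .var i, env => env i
  | .add a b, env => a.eval w env + b.eval w env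
  | .sub a b, env => a.eval w env - b.eval w env
  | .bit a, env => (w.getD (a.eval w env) false).toNat
  | .sum g h, env => ∑ i ∈ Finset.range (g.eval w env), h.eval w (consEnv i env)

/-- A number in unary, as the contents of a stack. -/
abbrev unary (n : ℕ) : List (Option Bool) := List.replicate n none

/-- The program that writes the value of the expression to the stack `r`; the variables are
on the stacks `ρ i`, and the stacks from `r` on may be used. -/
def Expr.prog : Expr → (ℕ → ℕ) → ℕ → Prog (Option Bool)
  | .one, _, r => .push r none
  | .var i, ρ, r => .seq (.loop (ρ i) fun _ => .push (r + 1) none)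
      (.loop (r + 1) fun _ => .seq (.push (ρ i) none) (.push r none))
  | .add a b, ρ, r => .seq (a.prog ρ r) (.seq (b.prog ρ (r + 1))
      (.loop (r + 1) fun _ => .push r none))
  | .sub a b, ρ, r => .seq (a.prog ρ r) (.seq (b.prog ρ (r + 1))
      (.loop (r + 1) fun _ => .case r fun _ => .skip))
  | .bit a, ρ, r => .seq (a.prog ρ r) (.seq
      (.loop r fun _ => .case 0 fun o => o.elim .skip fun b => .push (r + 1) b) (.seq
      (.case 0 fun o => o.elim .skip fun b =>
        .seq (.push 0 b) (if b = some true then .push r none else .skip))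
      (.loop (r + 1) fun b => .push 0 b)))
  | .sum g h, ρ, r => .seq (g.prog ρ r) (.seq
      (.loop r fun _ => .seq (h.prog (consEnv r ρ) (r + 2))
        (.loop (r + 2) fun _ => .push (r + 1) none))
      (.loop (r + 1) fun _ => .push r none))

/-! ### Two patterns of loops: moving a stack, and counting down a number in unary. -/

theorem exec_loop_push {A : Type} (f : A → A) {k j : ℕ} (hkj : k ≠ j) (l : List A)
    (S : ℕ → List A) (h : S k = l) :
    Exec (.loop k fun a => .push j (f a)) S
      (Function.update (Function.update S k []) j ((l.map f).reverse ++ S j))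
        (2 * l.length + 1) := by
  induction l generalizing S with
  | nil =>
    have e : Function.update S k [] = S := by rw [← h, Function.update_eq_self]
    have : Function.update (Function.update S k []) j (([].map f).reverse ++ S j) = S := by
      simp [e]
    rw [this]
    exact .loop_nil h
  | cons a l ih =>
    have h₁ := Exec.push j (f a) (Function.update S k l)
    have h₂ := ih (Function.update (Function.update S k l) j (f a :: (Function.update S k l) j))
      (by simp [hkj])
    have := Exec.loop_cons (p := fun a => .push j (f a)) h h₁ h₂
    convert this using 1
    · funext x
      by_cases hx : x = j
      · subst hx; simp [hkj.symm]
      · by_cases hx' : x = k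
        · subst hx'; simp [hkj]
        · simp [hx, hx']
    · simp; ring

/-- `F i` is the loop invariant: the contents of all stacks when `i` rounds remain. -/
theorem exec_loop_unary {k : ℕ} {body : Option Bool → Prog (Option Bool)}
    (F : ℕ → ℕ → List (Option Bool)) {n T : ℕ} (hF : ∀ i ≤ n, F i k = unary i)
    (hbody : ∀ i < n, ∃ t ≤ T, Exec (body none) (Function.update (F (i + 1)) k (unary i)) (F i) t) :
    ∃ t ≤ n * (T + 1) + 1, Exec (.loop k body) (F n) (F 0) t := by
  induction n with
  | zero => exact ⟨1, by omega, .loop_nil (hF 0 le_rfl)⟩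
  | succ n ih =>
    obtain ⟨t₁, ht₁, h₁⟩ := ih (fun i hi => hF i (by omega)) (fun i hi => hbody i (by omega))
    obtain ⟨t₂, ht₂, h₂⟩ := hbody n (by omega)
    refine ⟨t₂ + t₁ + 1, ?_, .loop_cons (hF (n + 1) le_rfl) h₂ h₁⟩
    rw [Nat.succ_mul]
    omega

/-- The stack `0` holds the word `w`, the stacks `ρ i` hold the values of the variables, and the
stacks from `r` on are empty. -/
structure Holds (w : List Bool) (env ρ : ℕ → ℕ) (r : ℕ) (S : ℕ → List (Option Bool)) : Prop where
  word : S 0 = w.map some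
  pos : ∀ i, 0 < ρ i
  lt : ∀ i, ρ i < r
  val : ∀ i, S (ρ i) = unary (env i)
  nil : ∀ j, r ≤ j → S j = []

namespace Holds

variable {w : List Bool} {env ρ : ℕ → ℕ} {r : ℕ} {S : ℕ → List (Option Bool)}

theorem r_pos (h : Holds w env ρ r S) : 0 < r := (h.pos 0).trans (h.lt 0)

theorem update (h : Holds w env ρ r S) (l : List (Option Bool)) :
    Holds w env ρ (r + 1) (Function.update S r l) where
  word := by rw [Function.update_of_ne h.r_pos.ne, h.word]
  pos := h.pos
  lt i := (h.lt i).trans (Nat.lt_succ_self r)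
  val i := by rw [Function.update_of_ne (h.lt i).ne, h.val]
  nil j hj := by rw [Function.update_of_ne (by omega), h.nil j (by omega)]

theorem cons (h : Holds w env ρ r S) (i : ℕ) (l : List (Option Bool)) :
    Holds w (consEnv i env) (consEnv r ρ) (r + 2)
      (Function.update (Function.update S r (unary i)) (r + 1) l) where
  word := by
    have := h.r_pos
    rw [Function.update_of_ne (by omega), Function.update_of_ne (by omega), h.word]
  pos j := by
    cases j with
    | zero => exact h.r_pos
    | succ j => exact h.pos j
  lt j := by
    cases j with
    | zero => simp [consEnv]
    | succ j => exact (h.lt j).trans (by omega)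
  val j := by
    cases j with
    | zero => simp [consEnv]
    | succ j =>
      have := h.lt j
      simp only [consEnv]
      rw [Function.update_of_ne (by omega), Function.update_of_ne (by omega), h.val]
  nil j hj := by
    rw [Function.update_of_ne (by omega), Function.update_of_ne (by omega), h.nil j (by omega)]

end Holds

/-! ### Effect and running time of the program for each form of expression. -/

variable {w : List Bool} {env ρ : ℕ → ℕ} {r : ℕ} {S : ℕ → List (Option Bool)}

/-- Reading a stack destroys it, so the variable is moved to the scratch stack `r + 1` and then
written back and copied to `r` at the same time. -/
theorem exec_var (h : Holds w env ρ r S) (i : ℕ) :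
    ∃ t ≤ env i * 3 + 1 + (2 * env i + 1), Exec ((Expr.var i).prog ρ r) S
      (Function.update S r (unary (env i))) t := by
  have hr := h.lt i
  have h₁ := exec_loop_push (fun _ => none) (k := ρ i) (j := r + 1) (by omega) _ S (h.val i)
  obtain ⟨t, ht, h₂⟩ := exec_loop_unary (k := r + 1) (n := env i) (T := 2)
    (body := fun _ => .seq (.push (ρ i) none) (.push r none))
    (fun j => Function.update (Function.update (Function.update S (ρ i) (unary (env i - j)))
      (r + 1) (unary j)) r (unary (env i - j))) (fun j hj => by simp) (fun j hj => by
        refine ⟨2, le_rfl, ?_⟩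
        convert Exec.seq (Exec.push _ _ _) (Exec.push _ _ _) using 1
        have e : env i - j = env i - (j + 1) + 1 := by omega
        funext x
        rw [e]
        by_cases hx : x = r
        · subst hx; simp [hr.ne', List.replicate_succ]
        · by_cases hx' : x = r + 1
          · subst hx'; simp [(show r + 1 ≠ ρ i by omega)]
          · by_cases hx'' : x = ρ i
            · subst hx''; simp [hx, hx', List.replicate_succ]
            · simp [hx, hx', hx''])
  refine ⟨_, ?_, Exec.seq h₁ (?_ : Exec _ _ _ t)⟩
  · simp; omega
  · convert h₂ using 1
    · funext x
      by_cases hx : x = r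
      · subst hx; simp [hr.ne', h.nil]
      · by_cases hx' : x = r + 1
        · subst hx'; simp [h.nil]
        · by_cases hx'' : x = ρ i
          · subst hx''; simp [hx, hx']
          · simp [hx, hx', hx'']
    · funext x
      by_cases hx : x = r
      · subst hx; simp
      · by_cases hx' : x = r + 1
        · subst hx'; simp [h.nil]
        · by_cases hx'' : x = ρ i
          · subst hx''; simp [hx, hx', h.val]
          · simp [hx, hx', hx'']

theorem exec_move_unary {k j n : ℕ} (hkj : k ≠ j) {S : ℕ → List (Option Bool)}
    (h : S k = unary n) : Exec (.loop k fun _ => .push j none) S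
      (Function.update (Function.update S k []) j (unary n ++ S j)) (2 * n + 1) := by
  have := exec_loop_push (fun _ => none) hkj _ S h
  simpa using this

theorem exec_add {n m t₁ t₂ : ℕ} {p q : Prog (Option Bool)} (h : Holds w env ρ r S)
    (h₁ : Exec p S (Function.update S r (unary n)) t₁)
    (h₂ : Exec q (Function.update S r (unary n))
      (Function.update (Function.update S r (unary n)) (r + 1) (unary m)) t₂) :
    Exec (.seq p (.seq q (.loop (r + 1) fun _ => .push r none))) S
      (Function.update S r (unary (n + m))) (t₁ + (t₂ + (2 * m + 1))) := by
  refine .seq h₁ (.seq h₂ ?_)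
  convert exec_move_unary (k := r + 1) (j := r) (n := m)
    (S := Function.update (Function.update S r (unary n)) (r + 1) (unary m)) (by omega) (by simp)
    using 1
  funext x
  by_cases hx : x = r
  · subst hx; simp [Nat.add_comm]
  · by_cases hx' : x = r + 1
    · subst hx'; simp [h.nil]
    · simp [hx, hx']

theorem exec_sub {n m t₁ t₂ : ℕ} {p q : Prog (Option Bool)} (h : Holds w env ρ r S)
    (h₁ : Exec p S (Function.update S r (unary n)) t₁)
    (h₂ : Exec q (Function.update S r (unary n))
      (Function.update (Function.update S r (unary n)) (r + 1) (unary m)) t₂) :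
    ∃ t ≤ m * 3 + 1, Exec (.seq p (.seq q (.loop (r + 1) fun _ => .case r fun _ => .skip))) S
      (Function.update S r (unary (n - m))) (t₁ + (t₂ + t)) := by
  obtain ⟨t, ht, h₃⟩ := exec_loop_unary (k := r + 1) (n := m) (T := 2)
    (body := fun _ => .case r fun _ => .skip)
    (fun j => Function.update (Function.update S r (unary (n - (m - j)))) (r + 1) (unary j))
    (fun j hj => by simp) (fun j hj => by
      refine ⟨2, le_rfl, .case ?_⟩
      convert Exec.skip _ using 1
      funext x
      by_cases hx : x = r
      · subst hx; simp; omega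
      · by_cases hx' : x = r + 1
        · subst hx'; simp
        · simp [hx, hx'])
  refine ⟨t, ht, .seq h₁ (.seq h₂ ?_)⟩
  convert h₃ using 1
  · simp
  · funext x
    by_cases hx' : x = r + 1
    · subst hx'; simp [h.nil]
    · simp [hx']

/-- The first `n` letters of the word are parked on the stack `r + 1`, the next one is inspected and
put back, and the parked letters are returned. Beyond the end of the word the pops find nothing, in
agreement with the default value `false`. -/
theorem exec_bit {n t₁ : ℕ} {p : Prog (Option Bool)} (h : Holds w env ρ r S)
    (h₁ : Exec p S (Function.update S r (unary n)) t₁) :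
    ∃ t ≤ n * 3 + 1 + (4 + (2 * w.length + 1)), Exec (.seq p (.seq
      (.loop r fun _ => .case 0 fun o => o.elim .skip fun b => .push (r + 1) b) (.seq
      (.case 0 fun o => o.elim .skip fun b =>
        .seq (.push 0 b) (if b = some true then .push r none else .skip))
      (.loop (r + 1) fun b => .push 0 b)))) S
      (Function.update S r (unary (w.getD n false).toNat)) (t₁ + t) := by
  have hr := h.r_pos
  obtain ⟨t₂, ht₂, h₂⟩ := exec_loop_unary (k := r) (n := n) (T := 2)
    (body := fun _ => .case 0 fun o => o.elim .skip fun b => .push (r + 1) b)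
    (fun j => Function.update (Function.update (Function.update S 0 ((w.map some).drop (n - j)))
      (r + 1) ((w.map some).take (n - j)).reverse) r (unary j)) (fun j hj => by simp)
    (fun j hj => by
      refine ⟨2, le_rfl, .case ?_⟩
      obtain ⟨d, hd⟩ : ∃ d, d = n - (j + 1) := ⟨_, rfl⟩
      have hd' : n - j = d + 1 := by omega
      rw [← hd, hd']
      by_cases hw : d < (w.map some).length
      · rw [List.drop_eq_getElem_cons hw, List.take_succ_eq_append_getElem hw]
        simp only [hr.ne, Function.update_of_ne, ne_eq, not_false_eq_true,
          (show ¬ (0 = r + 1) by omega), Function.update_self, List.head?_cons, Option.elim]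
        convert Exec.push _ _ _ using 1
        funext x
        by_cases hx : x = r
        · subst hx; simp [hr.ne']
        · by_cases hx' : x = r + 1
          · subst hx'; simp
          · by_cases hx'' : x = 0
            · subst hx''; simp [hx]
            · simp [hx, hx', hx'']
      · rw [List.drop_eq_nil_of_le (by omega : (w.map some).length ≤ d),
          List.drop_eq_nil_of_le (by omega : (w.map some).length ≤ d + 1),
          List.take_of_length_le (by omega : (w.map some).length ≤ d),
          List.take_of_length_le (by omega : (w.map some).length ≤ d + 1)]
        simp only [hr.ne, Function.update_of_ne, ne_eq, not_false_eq_true,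
          (show ¬ (0 = r + 1) by omega), Function.update_self, List.head?_nil, Option.elim]
        convert Exec.skip _ using 1
        funext x
        by_cases hx : x = r
        · subst hx; simp [hr.ne']
        · by_cases hx' : x = r + 1
          · subst hx'; simp
          · by_cases hx'' : x = 0
            · subst hx''; simp [hx]
            · simp [hx, hx', hx''])
  simp only [Nat.sub_self, Nat.sub_zero] at h₂
  obtain ⟨t₃, ht₃, h₃⟩ : ∃ t ≤ 4, Exec (.case 0 fun o => o.elim .skip fun b =>
        .seq (.push 0 b) (if b = some true then .push r none else .skip))
      (Function.update (Function.update (Function.update S 0 ((w.map some).drop n))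
        (r + 1) ((w.map some).take n).reverse) r (unary 0))
      (Function.update (Function.update (Function.update S 0 ((w.map some).drop n))
        (r + 1) ((w.map some).take n).reverse) r (unary (w.getD n false).toNat)) t := by
    by_cases hw : n < (w.map some).length
    · have hw' : n < w.length := by simpa using hw
      refine ⟨3, by omega, .case ?_⟩
      rw [List.drop_eq_getElem_cons hw]
      simp only [hr.ne, Function.update_of_ne, ne_eq, not_false_eq_true,
          (show ¬ (0 = r + 1) by omega), Function.update_self, List.head?_cons, Option.elim,
          List.getElem_map]
      refine .seq (t := 1) (t' := 1) (Exec.push _ _ _) ?_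
      rw [List.getD_eq_getElem _ _ hw']
      cases w[n]
      · rw [if_neg (by simp)]
        convert Exec.skip _ using 1
        funext x
        by_cases hx : x = r
        · subst hx; simp [hr.ne']
        · by_cases hx'' : x = 0
          · subst hx''; simp [hx]
          · simp [hx, hx'']
      · rw [if_pos rfl]
        convert Exec.push _ _ _ using 1
        funext x
        by_cases hx : x = r
        · subst hx; simp [hr.ne']
        · by_cases hx'' : x = 0
          · subst hx''; simp [hx]
          · simp [hx, hx'']
    · have hw' : ¬ n < w.length := by simpa using hw
      refine ⟨2, by omega, .case ?_⟩
      rw [List.drop_eq_nil_of_le (by omega : (w.map some).length ≤ n),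
        List.getD_eq_default _ _ (by omega : w.length ≤ n)]
      simp only [hr.ne, Function.update_of_ne, ne_eq, not_false_eq_true,
        (show ¬ (0 = r + 1) by omega), Function.update_self, List.head?_nil, Option.elim]
      convert Exec.skip _ using 1
      funext x
      by_cases hx : x = r
      · subst hx; simp [hr.ne']
      · by_cases hx'' : x = 0
        · subst hx''; simp [hx]
        · simp [hx, hx'']
  have h₄ := exec_loop_push (fun b => b) (k := r + 1) (j := 0) (by omega)
    ((w.map some).take n).reverse
    (Function.update (Function.update (Function.update S 0 ((w.map some).drop n))
        (r + 1) ((w.map some).take n).reverse) r (unary (w.getD n false).toNat)) (by simp)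
  refine ⟨t₂ + (t₃ + (2 * ((w.map some).take n).reverse.length + 1)), ?_,
    .seq h₁ (.seq ?_ (.seq h₃ ?_))⟩
  · simp only [List.length_reverse, List.length_take, List.length_map]
    omega
  · convert h₂ using 1
    funext x
    by_cases hx : x = r
    · subst hx; simp
    · by_cases hx' : x = r + 1
      · subst hx'; simp [h.nil]
      · by_cases hx'' : x = 0
        · subst hx''; simp [hx, h.word]
        · simp [hx, hx', hx'']
  · convert h₄ using 1
    funext x
    by_cases hx : x = r
    · subst hx; simp [hr.ne']
    · by_cases hx' : x = r + 1
      · subst hx'; simp [h.nil]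
      · by_cases hx'' : x = 0
        · subst hx''
          simp [hx, h.word, Function.comp_def]
        · simp [hx, hx', hx'']

/-- The loop counter itself is the summation variable: when a letter has been popped and `j` letters
are left, the stack `r` holds `j`. So the summands are added from the last to the first, and the
invariant on the stack `r + 1` is the sum over `Finset.Ico j n`. -/
theorem exec_sum {n t₁ T V : ℕ} {p q : Prog (Option Bool)} (f : ℕ → ℕ) (h : Holds w env ρ r S)
    (h₁ : Exec p S (Function.update S r (unary n)) t₁) (hV : ∀ i < n, f i ≤ V)
    (h₂ : ∀ i < n, ∀ S, Holds w (consEnv i env) (consEnv r ρ) (r + 2) S →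
      ∃ t ≤ T, Exec q S (Function.update S (r + 2) (unary (f i))) t) :
    ∃ t ≤ n * (T + (2 * V + 1) + 1) + 1 + (2 * (n * V) + 1), Exec (.seq p (.seq
      (.loop r fun _ => .seq q (.loop (r + 2) fun _ => .push (r + 1) none))
      (.loop (r + 1) fun _ => .push r none))) S
      (Function.update S r (unary (∑ i ∈ Finset.range n, f i))) (t₁ + t) := by
  obtain ⟨t₂, ht₂, h₃⟩ := exec_loop_unary (k := r) (n := n) (T := T + (2 * V + 1))
    (body := fun _ => .seq q (.loop (r + 2) fun _ => .push (r + 1) none))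
    (fun j => Function.update (Function.update S r (unary j)) (r + 1)
      (unary (∑ i ∈ Finset.Ico j n, f i))) (fun j hj => by simp)
    (fun j hj => by
      obtain ⟨t, ht, hq⟩ := h₂ j hj _ (h.cons j (unary (∑ i ∈ Finset.Ico (j + 1) n, f i)))
      have hm := exec_move_unary (k := r + 2) (j := r + 1) (n := f j)
        (S := Function.update (Function.update (Function.update S r (unary j)) (r + 1)
          (unary (∑ i ∈ Finset.Ico (j + 1) n, f i))) (r + 2) (unary (f j))) (by omega) (by simp)
      have hVj := hV j hj
      refine ⟨t + (2 * f j + 1), by omega, ?_⟩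
      convert Exec.seq hq hm using 1
      · funext x
        by_cases hx : x = r
        · subst hx; simp
        · by_cases hx' : x = r + 1
          · subst hx'; simp
          · simp [hx, hx']
      · funext x
        rw [Finset.sum_eq_sum_Ico_succ_bot hj]
        by_cases hx : x = r
        · subst hx; simp
        · by_cases hx' : x = r + 1
          · subst hx'; simp
          · by_cases hx'' : x = r + 2
            · subst hx''; simp [h.nil]
            · simp [hx, hx', hx''])
  have hm := exec_move_unary (k := r + 1) (j := r) (n := ∑ i ∈ Finset.range n, f i)
    (S := Function.update (Function.update S r (unary 0)) (r + 1)
      (unary (∑ i ∈ Finset.range n, f i))) (by omega) (by simp)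
  have hle : ∑ i ∈ Finset.range n, f i ≤ n * V := by
    simpa using Finset.sum_le_card_nsmul (Finset.range n) f V fun i hi => hV i (by simpa using hi)
  refine ⟨t₂ + (2 * (∑ i ∈ Finset.range n, f i) + 1), by omega, .seq h₁ (.seq
    (S' := Function.update (Function.update S r (unary 0)) (r + 1)
      (unary (∑ i ∈ Finset.range n, f i))) ?_ ?_)⟩
  · convert h₃ using 1
    · funext x
      by_cases hx : x = r + 1
      · subst hx; simp [h.nil]
      · simp [hx]
    · simp
  · convert hm using 1
    funext x
    by_cases hx : x = r
    · subst hx; simp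
    · by_cases hx' : x = r + 1
      · subst hx'; simp [h.nil]
      · simp [hx, hx']

/-- The values of an expression and the time for its evaluation are polynomially bounded. -/
theorem Expr.exists_bounds (e : Expr) : ∃ V T : ℕ → ℕ, PolyBounded V ∧ PolyBounded T ∧
    ∀ (B : ℕ) (w : List Bool) (env : ℕ → ℕ), w.length ≤ B → (∀ i, env i ≤ B) →
      e.eval w env ≤ V B ∧ ∀ ρ r S, Holds w env ρ r S →
        ∃ t ≤ T B, Exec (e.prog ρ r) S (Function.update S r (unary (e.eval w env))) t := by
  induction e with
  | one =>
    refine ⟨fun _ => 1, fun _ => 1, .const 1, .const 1, fun B w env hw henv => ⟨le_rfl, ?_⟩⟩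
    intro ρ r S h
    refine ⟨1, le_rfl, ?_⟩
    have := Exec.push r none S
    rwa [h.nil r le_rfl] at this
  | var i =>
    refine ⟨fun B => B, fun B => B * 3 + 1 + (2 * B + 1), .id,
      ((PolyBounded.id.mul (.const 3)).add (.const 1)).add
        (((PolyBounded.const 2).mul .id).add (.const 1)), fun B w env hw henv => ⟨henv i, ?_⟩⟩
    intro ρ r S h
    obtain ⟨t, ht, he⟩ := exec_var h i
    have := henv i
    exact ⟨t, by dsimp only; omega, he⟩
  | add a b iha ihb =>
    obtain ⟨V₁, T₁, hV₁, hT₁, h₁⟩ := iha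
    obtain ⟨V₂, T₂, hV₂, hT₂, h₂⟩ := ihb
    refine ⟨fun B => V₁ B + V₂ B, fun B => T₁ B + (T₂ B + (2 * V₂ B + 1)), hV₁.add hV₂,
      hT₁.add (hT₂.add (((PolyBounded.const 2).mul hV₂).add (.const 1))), ?_⟩
    intro B w env hw henv
    obtain ⟨hv₁, h₁⟩ := h₁ B w env hw henv
    obtain ⟨hv₂, h₂⟩ := h₂ B w env hw henv
    refine ⟨Nat.add_le_add hv₁ hv₂, fun ρ r S h => ?_⟩
    obtain ⟨t₁, ht₁, he₁⟩ := h₁ ρ r S h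
    obtain ⟨t₂, ht₂, he₂⟩ := h₂ ρ (r + 1) _ (h.update _)
    exact ⟨_, by dsimp only; omega, exec_add h he₁ he₂⟩
  | sub a b iha ihb =>
    obtain ⟨V₁, T₁, hV₁, hT₁, h₁⟩ := iha
    obtain ⟨V₂, T₂, hV₂, hT₂, h₂⟩ := ihb
    refine ⟨V₁, fun B => T₁ B + (T₂ B + (V₂ B * 3 + 1)), hV₁,
      hT₁.add (hT₂.add ((hV₂.mul (.const 3)).add (.const 1))), ?_⟩
    intro B w env hw henv
    obtain ⟨hv₁, h₁⟩ := h₁ B w env hw henv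
    obtain ⟨hv₂, h₂⟩ := h₂ B w env hw henv
    refine ⟨(Nat.sub_le _ _).trans hv₁, fun ρ r S h => ?_⟩
    obtain ⟨t₁, ht₁, he₁⟩ := h₁ ρ r S h
    obtain ⟨t₂, ht₂, he₂⟩ := h₂ ρ (r + 1) _ (h.update _)
    obtain ⟨t, ht, he⟩ := exec_sub h he₁ he₂
    exact ⟨_, by dsimp only; omega, he⟩
  | bit a iha =>
    obtain ⟨V₁, T₁, hV₁, hT₁, h₁⟩ := iha
    refine ⟨fun _ => 1, fun B => T₁ B + (V₁ B * 3 + 1 + (4 + (2 * B + 1))), .const 1,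
      hT₁.add (((hV₁.mul (.const 3)).add (.const 1)).add ((PolyBounded.const 4).add
        (((PolyBounded.const 2).mul .id).add (.const 1)))), ?_⟩
    intro B w env hw henv
    obtain ⟨hv₁, h₁⟩ := h₁ B w env hw henv
    refine ⟨Bool.toNat_le _, fun ρ r S h => ?_⟩
    obtain ⟨t₁, ht₁, he₁⟩ := h₁ ρ r S h
    obtain ⟨t, ht, he⟩ := exec_bit h he₁
    exact ⟨_, by dsimp only; omega, he⟩
  | sum g f ihg ihf =>
    obtain ⟨V₁, T₁, hV₁, hT₁, h₁⟩ := ihg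
    obtain ⟨V₂, T₂, hV₂, hT₂, h₂⟩ := ihf
    -- The body is evaluated with a summation variable that can be as large as the value of `g`, so
    -- the bound on the variables has to grow from `B` to `B + V₁ B`.
    have hB : PolyBounded fun B => B + V₁ B := PolyBounded.id.add hV₁
    have hV₂' := hV₂.comp hB
    have hT₂' := hT₂.comp hB
    refine ⟨fun B => V₁ B * V₂ (B + V₁ B), fun B => T₁ B +
      (V₁ B * (T₂ (B + V₁ B) + (2 * V₂ (B + V₁ B) + 1) + 1) + 1 +
        (2 * (V₁ B * V₂ (B + V₁ B)) + 1)), hV₁.mul hV₂', hT₁.add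
      (((hV₁.mul ((hT₂'.add (((PolyBounded.const 2).mul hV₂').add (.const 1))).add
        (.const 1))).add (.const 1)).add
        (((PolyBounded.const 2).mul (hV₁.mul hV₂')).add (.const 1))), ?_⟩
    intro B w env hw henv
    obtain ⟨hv₁, h₁⟩ := h₁ B w env hw henv
    have h₂' := fun i (hi : i < g.eval w env) => h₂ (B + V₁ B) w (consEnv i env) (by omega)
      (fun j => by
        cases j with
        | zero => simp only [consEnv]; omega
        | succ j => exact (henv j).trans (by omega))
    have hsum : ∑ i ∈ Finset.range (g.eval w env), f.eval w (consEnv i env) ≤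
        g.eval w env * V₂ (B + V₁ B) := by
      simpa using Finset.sum_le_card_nsmul (Finset.range (g.eval w env))
        (fun i => f.eval w (consEnv i env)) _ fun i hi => (h₂' i (by simpa using hi)).1
    refine ⟨hsum.trans (Nat.mul_le_mul_right _ hv₁), fun ρ r S h => ?_⟩
    obtain ⟨t₁, ht₁, he₁⟩ := h₁ ρ r S h
    obtain ⟨t, ht, he⟩ := exec_sum (fun i => f.eval w (consEnv i env)) h he₁
      (fun i hi => (h₂' i hi).1) (fun i hi S hS => (h₂' i hi).2 _ _ S hS)
    refine ⟨_, Nat.add_le_add ht₁ (ht.trans ?_), he⟩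
    gcongr

/-! ### Machines for functions that are given by expressions -/

/-- The values of the variables on the instance `I`: the length of the string, and the parameter. -/
def inputEnv (I : List Bool × ℕ) : ℕ → ℕ := consEnv I.1.length fun _ => I.2

/-- The map whose value has `E₁` letters, the parameter `E₃`, and the letters given by `E₂`. -/
def exprMap (E₁ E₂ E₃ : Expr) (I : List Bool × ℕ) : List Bool × ℕ :=
  ((List.range (E₁.eval I.1 (inputEnv I))).map fun t =>
    decide (E₂.eval I.1 (consEnv t (inputEnv I)) ≠ 0), E₃.eval I.1 (inputEnv I))

/-- The stacks of the machine for `exprMap`. -/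
def exprStacks (s₀ s₁ s₂ s₃ s₄ s₆ : List (Option Bool)) : ℕ → List (Option Bool)
  | 0 => s₀ | 1 => s₁ | 2 => s₂ | 3 => s₃ | 4 => s₄ | 5 => [] | 6 => s₆ | _ => []

section exprStacks

variable (s₀ s₁ s₂ s₃ s₄ s₆ s : List (Option Bool))

theorem update_exprStacks₀ : Function.update (exprStacks s₀ s₁ s₂ s₃ s₄ s₆) 0 s =
    exprStacks s s₁ s₂ s₃ s₄ s₆ := by
  funext k; rcases k with _ | _ | _ | _ | _ | _ | _ | k <;> rfl

theorem update_exprStacks₁ : Function.update (exprStacks s₀ s₁ s₂ s₃ s₄ s₆) 1 s =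
    exprStacks s₀ s s₂ s₃ s₄ s₆ := by
  funext k; rcases k with _ | _ | _ | _ | _ | _ | _ | k <;> rfl

theorem update_exprStacks₂ : Function.update (exprStacks s₀ s₁ s₂ s₃ s₄ s₆) 2 s =
    exprStacks s₀ s₁ s s₃ s₄ s₆ := by
  funext k; rcases k with _ | _ | _ | _ | _ | _ | _ | k <;> rfl

theorem update_exprStacks₃ : Function.update (exprStacks s₀ s₁ s₂ s₃ s₄ s₆) 3 s =
    exprStacks s₀ s₁ s₂ s s₄ s₆ := by
  funext k; rcases k with _ | _ | _ | _ | _ | _ | _ | k <;> rfl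

theorem update_exprStacks₄ : Function.update (exprStacks s₀ s₁ s₂ s₃ s₄ s₆) 4 s =
    exprStacks s₀ s₁ s₂ s₃ s s₆ := by
  funext k; rcases k with _ | _ | _ | _ | _ | _ | _ | k <;> rfl

theorem update_exprStacks₆ : Function.update (exprStacks s₀ s₁ s₂ s₃ s₄ s₆) 6 s =
    exprStacks s₀ s₁ s₂ s₃ s₄ s := by
  funext k; rcases k with _ | _ | _ | _ | _ | _ | _ | k <;> rfl

end exprStacks

/-- Where the machine for `exprMap` stores the values of the variables. -/
def inputLoc : ℕ → ℕ := consEnv 2 fun _ => 3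

theorem holds_exprStacks (I : List Bool × ℕ) (s : List (Option Bool)) :
    Holds I.1 (inputEnv I) inputLoc 4
      (exprStacks (I.1.map some) s (unary I.1.length) (unary I.2) [] []) where
  word := rfl
  pos i := by cases i <;> simp [inputLoc, consEnv]
  lt i := by cases i <;> simp [inputLoc, consEnv]
  val i := by cases i <;> rfl
  nil j hj := by
    rcases j with _ | _ | _ | _ | _ | _ | _ | j
    all_goals first | omega | rfl

/-- The program that distributes the input to the stacks. -/
def inputProg : Prog (Option Bool) :=
  .seq (.loop 0 fun a => a.elim (.push 3 none) fun b => .seq (.push 4 (some b)) (.push 2 none))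
    (.loop 4 fun a => .push 0 a)

/-- The program that writes the parameter and the letters of the output. -/
def outputProg (E₁ E₂ E₃ : Expr) : Prog (Option Bool) :=
  .seq (E₃.prog inputLoc 4) <| .seq (.loop 4 fun _ => .push 1 none) <|
  .seq (E₁.prog inputLoc 4) <| .loop 4 fun _ => .seq (E₂.prog (consEnv 4 inputLoc) 6) <|
    .case 6 fun o => o.elim (.push 1 (some false)) fun _ =>
      .seq (.loop 6 fun _ => .skip) (.push 1 (some true))

/-- The program that empties the stacks, except for the output. -/
def clearProg : Prog (Option Bool) :=
  .seq (.loop 0 fun _ => .skip) <| .seq (.loop 2 fun _ => .skip) (.loop 3 fun _ => .skip)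

theorem exec_clear {A : Type} {k : ℕ} (l : List A) (S : ℕ → List A) (h : S k = l) :
    Exec (.loop k fun _ => .skip) S (Function.update S k []) (2 * l.length + 1) := by
  induction l generalizing S with
  | nil =>
    have e : Function.update S k [] = S := by rw [← h, Function.update_eq_self]
    rw [e]
    exact .loop_nil h
  | cons a l ih =>
    have := Exec.loop_cons (p := fun _ => .skip) h (.skip _) (ih (Function.update S k l) (by simp))
    rw [Function.update_idem] at this
    convert this using 1
    simp; ring

/-- The parameter lies in unary below the word, so its part of the first loop (`h₀`) is the base
case for the part that reads the letters (`h₁`). That loop leaves the word reversed on the stack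
`4`, and the second loop restores it. -/
theorem exec_inputProg (I : List Bool × ℕ) : ∃ t ≤ 6 * instanceSize I,
    Exec inputProg (Function.update (fun _ => []) 0 (encodeInstance I))
      (exprStacks (I.1.map some) [] (unary I.1.length) (unary I.2) [] []) t := by
  have h₀ : ∀ n s₂ s₃ s₄, Exec (.loop 0 fun a => a.elim (.push 3 none) fun b =>
      .seq (.push 4 (some b)) (.push 2 none)) (exprStacks (unary n) [] s₂ s₃ s₄ [])
      (exprStacks [] [] s₂ (unary n ++ s₃) s₄ []) (2 * n + 1) := by
    intro n
    induction n with
    | zero => exact fun s₂ s₃ s₄ => .loop_nil rfl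
    | succ n ih =>
      intro s₂ s₃ s₄
      have := Exec.loop_cons (p := fun a : Option Bool => a.elim (.push 3 none) fun b =>
        .seq (.push 4 (some b)) (.push 2 none)) (k := 0)
        (S := exprStacks (unary (n + 1)) [] s₂ s₃ s₄ []) rfl (Exec.push _ _ _)
        (by rw [update_exprStacks₀, update_exprStacks₃]; exact ih _ _ _)
      convert this using 1
      · have : unary (n + 1) ++ s₃ = unary n ++ none :: s₃ := by
          simp [unary, List.replicate_succ']
        rw [this]
        rfl
      · omega
  have h₁ : ∀ (x : List Bool) n s₂ s₄, Exec (.loop 0 fun a => a.elim (.push 3 none) fun b =>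
      .seq (.push 4 (some b)) (.push 2 none)) (exprStacks (x.map some ++ unary n) [] s₂ [] s₄ [])
      (exprStacks [] [] (unary x.length ++ s₂) (unary n) ((x.map some).reverse ++ s₄) [])
      (3 * x.length + (2 * n + 1)) := by
    intro x n
    induction x with
    | nil => intro s₂ s₄; simpa using h₀ n s₂ [] s₄
    | cons b x ih =>
      intro s₂ s₄
      have := Exec.loop_cons (p := fun a : Option Bool => a.elim (.push 3 none) fun b =>
        .seq (.push 4 (some b)) (.push 2 none)) (k := 0) (l := x.map some ++ unary n) (a := some b)
        (S := exprStacks ((b :: x).map some ++ unary n) [] s₂ [] s₄ []) rfl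
        (Exec.seq (Exec.push _ _ _) (Exec.push _ _ _))
        (by rw [update_exprStacks₀, update_exprStacks₄, update_exprStacks₂]; exact ih _ _)
      convert this using 1
      · have : unary (b :: x).length ++ s₂ = unary x.length ++ none :: s₂ := by
          simp [unary, List.replicate_succ']
        rw [this, List.map_cons, List.reverse_cons, List.append_assoc]
        rfl
      · simp; ring
  have h₂ := exec_loop_push (fun a => a) (k := 4) (j := 0) (by omega) (I.1.map some).reverse
    (exprStacks [] [] (unary I.1.length) (unary I.2) (I.1.map some).reverse []) rfl
  rw [update_exprStacks₄, update_exprStacks₀] at h₂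
  have e : (((I.1.map some).reverse.map fun a => a).reverse ++
      exprStacks [] [] (unary I.1.length) (unary I.2) (I.1.map some).reverse [] 0) =
      I.1.map some := by
    rw [List.map_id', List.reverse_reverse]
    exact List.append_nil _
  rw [e] at h₂
  refine ⟨3 * I.1.length + (2 * I.2 + 1) + _, ?_, .seq ?_ h₂⟩
  · simp [instanceSize]; omega
  · have := h₁ I.1 I.2 [] []
    simp only [List.append_nil] at this
    convert this using 1
    have : (fun _ => []) = exprStacks [] [] [] [] [] [] := by
      funext k; rcases k with _ | _ | _ | _ | _ | _ | _ | k <;> rfl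
    rw [this, update_exprStacks₀]
    rfl

theorem exec_clearProg (I : List Bool × ℕ) (s : List (Option Bool)) :
    ∃ t ≤ 6 * instanceSize I, Exec clearProg
      (exprStacks (I.1.map some) s (unary I.1.length) (unary I.2) [] [])
      (Function.update (fun _ => []) 1 s) t := by
  have h₀ := exec_clear (k := 0) _
    (exprStacks (I.1.map some) s (unary I.1.length) (unary I.2) [] []) rfl
  rw [update_exprStacks₀] at h₀
  have h₂ := exec_clear (k := 2) _ (exprStacks [] s (unary I.1.length) (unary I.2) [] []) rfl
  rw [update_exprStacks₂] at h₂
  have h₃ := exec_clear (k := 3) _ (exprStacks [] s [] (unary I.2) [] []) rfl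
  rw [update_exprStacks₃] at h₃
  have e : Function.update (fun _ => []) 1 s = exprStacks [] s [] [] [] [] := by
    funext k; rcases k with _ | _ | _ | _ | _ | _ | _ | k <;> rfl
  rw [e]
  refine ⟨_, ?_, .seq h₀ (.seq h₂ h₃)⟩
  simp [exprStacks, instanceSize]
  omega

theorem exists_exec_outputProg (E₁ E₂ E₃ : Expr) : ∃ T, PolyBounded T ∧ ∀ I,
    ∃ t ≤ T (instanceSize I), Exec (outputProg E₁ E₂ E₃)
      (exprStacks (I.1.map some) [] (unary I.1.length) (unary I.2) [] [])
      (exprStacks (I.1.map some) (encodeInstance (exprMap E₁ E₂ E₃ I)) (unary I.1.length)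
        (unary I.2) [] []) t := by
  obtain ⟨V₁, T₁, hV₁, hT₁, h₁⟩ := E₁.exists_bounds
  obtain ⟨V₂, T₂, hV₂, hT₂, h₂⟩ := E₂.exists_bounds
  obtain ⟨V₃, T₃, hV₃, hT₃, h₃⟩ := E₃.exists_bounds
  have hB : PolyBounded fun B => B + V₁ B := PolyBounded.id.add hV₁
  refine ⟨fun B => T₃ B + ((2 * V₃ B + 1) + (T₁ B +
    (V₁ B * ((T₂ (B + V₁ B) + (2 * V₂ (B + V₁ B) + 3)) + 1) + 1))),
    hT₃.add ((((PolyBounded.const 2).mul hV₃).add (.const 1)).add (hT₁.add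
      ((hV₁.mul (((hT₂.comp hB).add (((PolyBounded.const 2).mul (hV₂.comp hB)).add
        (.const 3))).add (.const 1))).add (.const 1)))), fun I => ?_⟩
  obtain ⟨B, hBI⟩ : ∃ B, B = instanceSize I := ⟨_, rfl⟩
  have hw : I.1.length ≤ B := by rw [hBI, instanceSize]; omega
  have henv : ∀ i, inputEnv I i ≤ B := by
    intro i
    rw [hBI, instanceSize]
    cases i <;> simp only [inputEnv, consEnv] <;> omega
  rw [← hBI]
  obtain ⟨hv₁, h₁⟩ := h₁ B I.1 (inputEnv I) hw henv
  obtain ⟨hv₃, h₃⟩ := h₃ B I.1 (inputEnv I) hw henv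
  obtain ⟨n, hn⟩ : ∃ n, n = E₁.eval I.1 (inputEnv I) := ⟨_, rfl⟩
  obtain ⟨m, hm⟩ : ∃ m, m = E₃.eval I.1 (inputEnv I) := ⟨_, rfl⟩
  rw [← hn] at hv₁ h₁
  rw [← hm] at hv₃ h₃
  obtain ⟨t₃, ht₃, x₃⟩ := h₃ inputLoc 4 _ (holds_exprStacks I [])
  rw [update_exprStacks₄] at x₃
  have y₃ := exec_move_unary (k := 4) (j := 1) (n := m) (by omega)
    (S := exprStacks (I.1.map some) [] (unary I.1.length) (unary I.2) (unary m) []) rfl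
  rw [update_exprStacks₄, update_exprStacks₁] at y₃
  have e₃ : unary m ++ exprStacks (I.1.map some) [] (unary I.1.length) (unary I.2) (unary m) [] 1 =
    unary m := List.append_nil _
  rw [e₃] at y₃
  obtain ⟨t₁, ht₁, x₁⟩ := h₁ inputLoc 4 _ (holds_exprStacks I (unary m))
  rw [update_exprStacks₄] at x₁
  -- The output is built from its end: the parameter is pushed first, and the counter runs
  -- downwards, so that the letters with numbers `j, …, n - 1` are present when `j` rounds remain.
  let out : ℕ → List (Option Bool) := fun j => ((List.Ico j n).map fun t =>
    some (decide (E₂.eval I.1 (consEnv t (inputEnv I)) ≠ 0))) ++ unary m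
  obtain ⟨t₂, ht₂, x₂⟩ := exec_loop_unary (k := 4) (n := n)
    (T := T₂ (B + V₁ B) + (2 * V₂ (B + V₁ B) + 3))
    (body := fun _ => .seq (E₂.prog (consEnv 4 inputLoc) 6) <|
      .case 6 fun o => o.elim (.push 1 (some false)) fun _ =>
        .seq (.loop 6 fun _ => .skip) (.push 1 (some true)))
    (fun j => exprStacks (I.1.map some) (out j) (unary I.1.length) (unary I.2) (unary j) [])
    (fun j hj => rfl) (fun j hj => by
      obtain ⟨hv₂, h₂⟩ := h₂ (B + V₁ B) I.1 (consEnv j (inputEnv I)) (by omega) (fun i => by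
        cases i with
        | zero => simp only [consEnv]; omega
        | succ i => exact (henv i).trans (by omega))
      have hh := (holds_exprStacks I (out (j + 1))).cons j []
      rw [update_exprStacks₄] at hh
      have e₅ : Function.update (exprStacks (I.1.map some) (out (j + 1)) (unary I.1.length)
          (unary I.2) (unary j) []) (4 + 1) [] = exprStacks (I.1.map some) (out (j + 1))
          (unary I.1.length) (unary I.2) (unary j) [] := by
        funext k; rcases k with _ | _ | _ | _ | _ | _ | _ | k <;> rfl
      rw [e₅] at hh
      obtain ⟨t, ht, x⟩ := h₂ _ _ _ hh
      rw [update_exprStacks₄]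
      rw [update_exprStacks₆] at x
      have hout : out j = some (decide (E₂.eval I.1 (consEnv j (inputEnv I)) ≠ 0)) ::
          out (j + 1) := by
        simp only [out]
        rw [List.Ico.eq_cons hj]
        rfl
      rw [hout]
      generalize E₂.eval I.1 (consEnv j (inputEnv I)) = v at hv₂ x ⊢
      rcases v with _ | v
      · refine ⟨t + (1 + 1), by omega, .seq x (.case ?_)⟩
        have := Exec.push 1 (some false) (exprStacks (I.1.map some) (out (j + 1))
          (unary I.1.length) (unary I.2) (unary j) [])
        rw [update_exprStacks₁] at this
        rw [update_exprStacks₆]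
        exact this
      · have hc := exec_clear (k := 6) (unary v) (exprStacks (I.1.map some) (out (j + 1))
          (unary I.1.length) (unary I.2) (unary j) (unary v)) rfl
        rw [update_exprStacks₆] at hc
        have := Exec.push 1 (some true) (exprStacks (I.1.map some) (out (j + 1))
          (unary I.1.length) (unary I.2) (unary j) [])
        rw [update_exprStacks₁] at this
        refine ⟨t + (((2 * (unary v).length + 1) + 1) + 1), ?_, .seq x (.case ?_)⟩
        · simp only [List.length_replicate]; omega
        · rw [update_exprStacks₆]
          exact .seq hc this)
  have e₂ : out n = unary m := by simp [out]
  have e₀ : out 0 = encodeInstance (exprMap E₁ E₂ E₃ I) := by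
    simp only [out, encodeInstance, exprMap, ← hn, ← hm, List.Ico.zero_bot, List.map_map]
    rfl
  rw [e₂, e₀] at x₂
  refine ⟨t₃ + ((2 * m + 1) + (t₁ + t₂)), ?_, .seq x₃ (.seq y₃ (.seq x₁ x₂))⟩
  have : n * (T₂ (B + V₁ B) + (2 * V₂ (B + V₁ B) + 3) + 1) ≤
    V₁ B * (T₂ (B + V₁ B) + (2 * V₂ (B + V₁ B) + 3) + 1) := Nat.mul_le_mul_right _ hv₁
  dsimp only
  omega

/-- The map `exprMap` is computable in polynomial time. -/
theorem exists_machine_exprMap (E₁ E₂ E₃ : Expr) :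
    ∃ (M : TM2ComputableAux (Option Bool) (Option Bool)) (T : ℕ → ℕ), PolyBounded T ∧
      ∀ I, OutputsWithin M I (exprMap E₁ E₂ E₃ I) (T (instanceSize I)) := by
  obtain ⟨T, hT, h⟩ := exists_exec_outputProg E₁ E₂ E₃
  obtain ⟨R, hR⟩ := (Prog.seq inputProg (.seq (outputProg E₁ E₂ E₃) clearProg)).exists_usesUpTo
  refine ⟨Prog.machine R (.seq inputProg (.seq (outputProg E₁ E₂ E₃) clearProg)),
    fun B => 6 * B + (T B + 6 * B) + 1,
    (((PolyBounded.const 6).mul .id).add (hT.add ((PolyBounded.const 6).mul .id))).add (.const 1),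
    fun I => ?_⟩
  obtain ⟨t₁, ht₁, h₁⟩ := exec_inputProg I
  obtain ⟨t₂, ht₂, h₂⟩ := h I
  obtain ⟨t₃, ht₃, h₃⟩ := exec_clearProg I (encodeInstance (exprMap E₁ E₂ E₃ I))
  have := outputsWithin_machine hR (.seq h₁ (.seq h₂ h₃))
  obtain ⟨n, hn, x⟩ := outputsInTime_iff.1 this
  exact outputsInTime_iff.2 ⟨n, by dsimp only; omega, x⟩

/-! ### Composition of an fpt-reduction with a polynomial-time map -/

theorem primrec_pow_const (c : ℕ) : Primrec fun n : ℕ => n ^ c := by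
  induction c with
  | zero => simpa using Primrec.const 1
  | succ c ih => simpa only [pow_succ, id] using Primrec.nat_mul.comp ih Primrec.id

theorem computable_poly {f : ℕ → ℕ} (hf : Computable f) (a b d c : ℕ) :
    Computable fun k => a * (b * f k + d) ^ c := by
  have h : Primrec fun n : ℕ => a * (b * n + d) ^ c :=
    Primrec.nat_mul.comp (.const a) ((primrec_pow_const c).comp
      (Primrec.nat_add.comp (Primrec.nat_mul.comp (.const b) .id) (.const d)))
  exact h.to_comp.comp hf

/-- The intermediate instance is at most linear in the running time of the first machine, so a
polynomial in its size is still of the form `f k * |I| ^ c`. The bound `hc` depends on the parameter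
alone, and therefore the new parameter stays computably bounded. -/
theorem FPTReducible.comp_exprMap {Γ : Type} {P : ParamProblem Γ} {Q Q' : ParamProblem Bool}
    (h : FPTReducible P Q) {E₁ E₂ E₃ : Expr} {c : ℕ}
    (hc : ∀ I, (exprMap E₁ E₂ E₃ I).2 ≤ (I.2 + 2) ^ c)
    (hQ : ∀ I, I ∈ Q ↔ exprMap E₁ E₂ E₃ I ∈ Q') : FPTReducible P Q' := by
  obtain ⟨r, hr, ⟨g, hg, hrg⟩, M₁, f, c₁, hf, hM₁⟩ := h
  obtain ⟨M₂, T, ⟨c₂, hT⟩, hM₂⟩ := exists_machine_exprMap E₁ E₂ E₃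
  obtain ⟨C, hC⟩ := OutputsWithin.length_le M₁
  refine ⟨fun I => exprMap E₁ E₂ E₃ (r I), fun I => (hr I).trans (hQ _),
    ⟨fun k => 1 * (1 * g k + 2) ^ c, computable_poly hg 1 1 2 c, fun I => ?_⟩,
    compMachine M₁ M₂, fun k => 4 * ((C + 1) * f k + 3) ^ (c₂ + 1), (c₁ + 1) * (c₂ + 1),
    computable_poly hf _ _ _ _, fun I => ?_⟩
  · dsimp only
    rw [one_mul, one_mul]
    exact (hc _).trans (Nat.pow_le_pow_left (Nat.add_le_add_right (hrg I) 2) c)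
  · have key := (hM₁ I).comp (hM₂ (r I))
    have hJ := hC _ _ _ (hM₁ I)
    obtain ⟨n, hn, x⟩ := outputsInTime_iff.1 key
    refine outputsInTime_iff.2 ⟨n, hn.trans ?_, x⟩
    have hTJ := hT (instanceSize (r I))
    have hs : 1 ≤ instanceSize I := by unfold instanceSize; omega
    generalize instanceSize (r I) = J at *
    generalize instanceSize I = s at *
    generalize hF : f I.2 = F at *
    have hs₁ : s ^ c₁ ≤ s ^ (c₁ + 1) := Nat.pow_le_pow_right hs (by omega)
    have hs₂ : s ≤ s ^ (c₁ + 1) := Nat.le_self_pow (by omega) s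
    have hs₃ : 1 ≤ s ^ (c₁ + 1) := Nat.one_le_pow _ _ hs
    -- `u` dominates both the running time `F * s ^ c₁` of the first machine and `J + 2`, so the
    -- total time `F * s ^ c₁ + 2 * J + (J + 2) ^ c₂` is at most `4 * u ^ (c₂ + 1)`. The exponent
    -- `c₁ + 1` ensures `s ≤ s ^ (c₁ + 1)` even for `c₁ = 0`.
    obtain ⟨u, hu⟩ : ∃ u, u = ((C + 1) * F + 3) * s ^ (c₁ + 1) := ⟨_, rfl⟩
    have hFs : F * s ^ c₁ ≤ F * s ^ (c₁ + 1) := Nat.mul_le_mul_left _ hs₁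
    have hCs : C * (F * s ^ c₁) ≤ C * (F * s ^ (c₁ + 1)) := Nat.mul_le_mul_left _ hFs
    have hu' : u = C * (F * s ^ (c₁ + 1)) + F * s ^ (c₁ + 1) + 3 * s ^ (c₁ + 1) := by
      rw [hu]; ring
    have h₁ : F * s ^ c₁ ≤ u := by omega
    have h₂ : J + 2 ≤ u := by omega
    have h₃ : (J + 2) ^ c₂ ≤ u ^ c₂ := Nat.pow_le_pow_left h₂ _
    have hu₁ : 1 ≤ u := by omega
    have h₄ : u ^ c₂ ≤ u ^ (c₂ + 1) := Nat.pow_le_pow_right hu₁ (by omega)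
    have h₅ : u ≤ u ^ (c₂ + 1) := Nat.le_self_pow (by omega) u
    have h₆ : 4 * ((C + 1) * F + 3) ^ (c₂ + 1) * s ^ ((c₁ + 1) * (c₂ + 1)) =
        4 * u ^ (c₂ + 1) := by
      rw [hu, mul_pow, ← pow_mul, mul_assoc]
    dsimp only
    rw [hF, h₆]
    omega

/-- A problem is coW[2]-hard if there is a polynomial-time map, given by expressions, to it from the
complement of each weighted Fagin-defined problem of a `Π₂` formula. -/
theorem isCoW2Hard_of_exprMap {Q : ParamProblem Bool}
    (h : ∀ (m : ℕ) (ar : Fin m → ℕ) (s p q : ℕ)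
      (ψ : (vocabularyWithVar ar s).BoundedFormula Empty (p + q)), ψ.IsQF →
      ∃ (E₁ E₂ E₃ : Expr) (c : ℕ), (∀ I, (exprMap E₁ E₂ E₃ I).2 ≤ (I.2 + 2) ^ c) ∧
        ∀ I, I ∉ weightedFagin ar ψ ↔ exprMap E₁ E₂ E₃ I ∈ Q) : IsCoW2Hard Q := by
  rintro Γ _ P ⟨m, ar, s, p, q, ψ, hψ, r, hr, hg, hM⟩
  obtain ⟨E₁, E₂, E₃, c, hc, hQ⟩ := h m ar s p q ψ hψ
  have : FPTReducible P (weightedFagin ar ψ)ᶜ := by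
    refine ⟨r, fun I => ?_, hg, hM⟩
    have := hr I
    rw [Set.mem_compl_iff] at this ⊢
    tauto
  exact this.comp_exprMap hc hQ

/-! ### Closure properties of the functions that are given by expressions -/

/-- The arguments of an expression: a word, and the values of the variables. -/
abbrev Args : Type := List Bool × (ℕ → ℕ)

/-- The arguments with a value for a new variable. -/
def Args.cons (a : ℕ) (z : Args) : Args := (z.1, consEnv a z.2)

/-- The arguments without the variable `0`. -/
def Args.tail (z : Args) : Args := (z.1, fun i => z.2 (i + 1))

/-- The function is given by an expression. -/
def Expressible (f : Args → ℕ) : Prop := ∃ e : Expr, ∀ z : Args, e.eval z.1 z.2 = f z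

open Classical in
/-- The characteristic function of the predicate is given by an expression. -/
def ExpressiblePred (p : Args → Prop) : Prop := Expressible fun z => if p z then 1 else 0

/-- Renames the variables of an expression. -/
def Expr.rename : Expr → (ℕ → ℕ) → Expr
  | .one, _ => .one
  | .var i, ρ => .var (ρ i)
  | .add a b, ρ => .add (a.rename ρ) (b.rename ρ)
  | .sub a b, ρ => .sub (a.rename ρ) (b.rename ρ)
  | .bit a, ρ => .bit (a.rename ρ)
  | .sum g h, ρ => .sum (g.rename ρ) (h.rename (consEnv 0 fun i => ρ i + 1))

theorem Expr.eval_rename (w : List Bool) (e : Expr) (ρ env : ℕ → ℕ) :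
    (e.rename ρ).eval w env = e.eval w (fun i => env (ρ i)) := by
  induction e generalizing ρ env with
  | one => rfl
  | var i => rfl
  | add a b iha ihb => simp only [rename, eval, iha, ihb]
  | sub a b iha ihb => simp only [rename, eval, iha, ihb]
  | bit a iha => simp only [rename, eval, iha]
  | sum g h ihg ihh =>
    simp only [rename, eval, ihg, ihh]
    refine Finset.sum_congr rfl fun i _ => ?_
    congr 1
    funext j
    cases j <;> rfl

namespace Expressible

variable {f g : Args → ℕ}

theorem congr (hf : Expressible f) (h : ∀ z, g z = f z) : Expressible g := by
  obtain ⟨e, he⟩ := hf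
  exact ⟨e, fun z => (he z).trans (h z).symm⟩

theorem var (i : ℕ) : Expressible fun z => z.2 i := ⟨.var i, fun _ => rfl⟩

theorem add (hf : Expressible f) (hg : Expressible g) : Expressible fun z => f z + g z := by
  obtain ⟨a, ha⟩ := hf
  obtain ⟨b, hb⟩ := hg
  exact ⟨.add a b, fun z => by simp only [Expr.eval, ha, hb]⟩

theorem sub (hf : Expressible f) (hg : Expressible g) : Expressible fun z => f z - g z := by
  obtain ⟨a, ha⟩ := hf
  obtain ⟨b, hb⟩ := hg
  exact ⟨.sub a b, fun z => by simp only [Expr.eval, ha, hb]⟩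

theorem bit (hf : Expressible f) : Expressible fun z => (z.1.getD (f z) false).toNat := by
  obtain ⟨a, ha⟩ := hf
  exact ⟨.bit a, fun z => by simp only [Expr.eval, ha]⟩

theorem const (n : ℕ) : Expressible fun _ => n := by
  induction n with
  | zero => exact ⟨.sub .one .one, fun z => rfl⟩
  | succ n ih => exact ih.add ⟨.one, fun z => rfl⟩

theorem tail (hf : Expressible f) : Expressible fun z => f z.tail := by
  obtain ⟨a, ha⟩ := hf
  exact ⟨a.rename fun i => i + 1, fun z => by rw [Expr.eval_rename]; exact ha z.tail⟩

theorem sum {h : ℕ → Args → ℕ} (hg : Expressible g) (hh : Expressible fun z => h (z.2 0) z.tail) :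
    Expressible fun z => ∑ i ∈ Finset.range (g z), h i z := by
  obtain ⟨a, ha⟩ := hg
  obtain ⟨b, hb⟩ := hh
  refine ⟨.sum a b, fun z => ?_⟩
  simp only [Expr.eval, ha]
  exact Finset.sum_congr rfl fun i _ => hb (z.cons i)

/-- The product is the sum of `f z` copies of `g z`. -/
theorem mul (hf : Expressible f) (hg : Expressible g) : Expressible fun z => f z * g z :=
  (sum (h := fun _ => g) hf hg.tail).congr fun z => by simp

theorem pow (hf : Expressible f) (c : ℕ) : Expressible fun z => f z ^ c := by
  induction c with
  | zero => exact const 1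
  | succ c ih => exact (ih.mul hf).congr fun z => pow_succ _ _

theorem finset_sum {ι : Type} (s : Finset ι) {F : ι → Args → ℕ} (hF : ∀ i, Expressible (F i)) :
    Expressible fun z => ∑ i ∈ s, F i z := by
  classical
  induction s using Finset.induction_on with
  | empty => exact (const 0).congr fun z => by simp
  | insert i s hi ih => exact ((hF i).add ih).congr fun z => Finset.sum_insert hi

end Expressible

/-! ### Comparisons, Boolean operations and bounded quantifiers. -/

namespace ExpressiblePred

variable {f g : Args → ℕ} {p q : Args → Prop}

theorem congr (hp : ExpressiblePred p) (h : ∀ z, q z ↔ p z) : ExpressiblePred q := by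
  have : q = p := funext fun z => propext (h z)
  rwa [this]

/-- By truncated subtraction, `1 - (f - g)` is the characteristic function. -/
theorem le (hf : Expressible f) (hg : Expressible g) : ExpressiblePred fun z => f z ≤ g z :=
  ((Expressible.const 1).sub (hf.sub hg)).congr fun z => by split_ifs <;> omega

theorem not (hp : ExpressiblePred p) : ExpressiblePred fun z => ¬ p z :=
  ((Expressible.const 1).sub hp).congr fun z => by by_cases h : p z <;> simp [h]

theorem and (hp : ExpressiblePred p) (hq : ExpressiblePred q) :
    ExpressiblePred fun z => p z ∧ q z :=
  (hp.mul hq).congr fun z => by by_cases h : p z <;> by_cases h' : q z <;> simp [h, h']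

theorem or (hp : ExpressiblePred p) (hq : ExpressiblePred q) :
    ExpressiblePred fun z => p z ∨ q z :=
  (hp.not.and hq.not).not.congr fun z => by tauto

theorem imp (hp : ExpressiblePred p) (hq : ExpressiblePred q) :
    ExpressiblePred fun z => p z → q z :=
  (hp.not.or hq).congr fun z => by tauto

theorem const (P : Prop) : ExpressiblePred fun _ => P :=
  Expressible.const _

theorem lt (hf : Expressible f) (hg : Expressible g) : ExpressiblePred fun z => f z < g z :=
  (le hg hf).not.congr fun _ => not_le.symm

theorem eq (hf : Expressible f) (hg : Expressible g) : ExpressiblePred fun z => f z = g z :=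
  ((le hf hg).and (le hg hf)).congr fun _ => le_antisymm_iff

theorem bit (hf : Expressible f) : ExpressiblePred fun z => z.1.getD (f z) false = true :=
  hf.bit.congr fun z => by rcases h : z.1.getD (f z) false <;> simp only [h] <;> rfl

theorem tail (hp : ExpressiblePred p) : ExpressiblePred fun z => p z.tail :=
  Expressible.tail hp

/-- A bounded existential quantifier says that a sum of values of a characteristic function is
positive. -/
theorem exists_lt {P : ℕ → Args → Prop} (hg : Expressible g)
    (hP : ExpressiblePred fun z => P (z.2 0) z.tail) :
    ExpressiblePred fun z => ∃ i < g z, P i z := by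
  classical
  refine (lt (Expressible.const 0) (Expressible.sum
    (h := fun i z => if P i z then 1 else 0) hg (Expressible.congr hP fun z => by
      congr))).congr fun z => ?_
  rw [Nat.pos_iff_ne_zero, Ne, Finset.sum_eq_zero_iff]
  simp

theorem forall_lt {P : ℕ → Args → Prop} (hg : Expressible g)
    (hP : ExpressiblePred fun z => P (z.2 0) z.tail) :
    ExpressiblePred fun z => ∀ i < g z, P i z :=
  (exists_lt (P := fun i z => ¬ P i z) hg hP.not).not.congr fun z => by simp

theorem forall_finite {ι : Type} [Finite ι] {P : ι → Args → Prop}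
    (hP : ∀ i, ExpressiblePred (P i)) : ExpressiblePred fun z => ∀ i, P i z := by
  classical
  have := Fintype.ofFinite ι
  have : ∀ s : Finset ι, ExpressiblePred fun z => ∀ i ∈ s, P i z := by
    intro s
    induction s using Finset.induction_on with
    | empty => exact (const True).congr fun z => by simp
    | insert i s hi ih => exact ((hP i).and ih).congr fun z => by simp
  exact (this Finset.univ).congr fun z => by simp

theorem exists_finite {ι : Type} [Finite ι] {P : ι → Args → Prop}
    (hP : ∀ i, ExpressiblePred (P i)) : ExpressiblePred fun z => ∃ i, P i z :=
  (forall_finite fun i => (hP i).not).not.congr fun z => by simp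

end ExpressiblePred

namespace Expressible

variable {f g : Args → ℕ} {p : Args → Prop}

open Classical in
theorem ite (hp : ExpressiblePred p) (hf : Expressible f) (hg : Expressible g) :
    Expressible fun z => if p z then f z else g z := by
  refine ((hp.mul hf).add (hp.not.mul hg)).congr fun z => ?_
  by_cases h : p z <;> simp [h]

/-- The quotient counts the `i < f` with `(i + 1) * g ≤ f`; the condition `0 < g` yields the value
`0` for division by zero. -/
theorem div (hf : Expressible f) (hg : Expressible g) : Expressible fun z => f z / g z := by
  classical
  have h₁ : ExpressiblePred fun z => 0 < g z.tail ∧ (z.2 0 + 1) * g z.tail ≤ f z.tail :=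
    (ExpressiblePred.lt (const 0) hg.tail).and
      (ExpressiblePred.le (((var 0).add (const 1)).mul hg.tail) hf.tail)
  refine (sum (h := fun i z => if 0 < g z ∧ (i + 1) * g z ≤ f z then 1 else 0) hf
    (Expressible.congr h₁ fun z => by congr)).congr fun z => ?_
  rw [Finset.sum_boole]
  rcases Nat.eq_zero_or_pos (g z) with h | h
  · simp [h]
  · have : (Finset.range (f z)).filter (fun i => 0 < g z ∧ (i + 1) * g z ≤ f z) =
        Finset.range (f z / g z) := by
      ext i
      simp only [Finset.mem_filter, Finset.mem_range, h, true_and]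
      rw [← Nat.le_div_iff_mul_le h]
      have := Nat.div_le_self (f z) (g z)
      omega
    rw [this]
    simp

theorem mod (hf : Expressible f) (hg : Expressible g) : Expressible fun z => f z % g z :=
  (hf.sub (hg.mul (hf.div hg))).congr fun z => by
    have := Nat.div_add_mod (f z) (g z)
    omega

end Expressible

/-! ### Graphs that consist of cliques, one for each slot, and a clique of checks -/

section slots

variable {V ι : Type} {G : SimpleGraph V} {slot : V → Option ι}

theorem injOn_slot (h : ∀ x y, x ≠ y → slot x = slot y → G.Adj x y) {S : Set V}
    (hS : G.IsIndepSet S) : Set.InjOn slot S := by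
  intro x hx y hy hxy
  by_contra hne
  exact hS hx hy hne (h x y hne hxy)

/-- If the vertices of each slot, and the vertices without a slot, form a clique, and each slot has
a vertex that is adjacent only to vertices of this slot, then there is a maximal independent set of
a size other than the number of slots plus one if and only if one can choose pairwise non-adjacent
vertices from the slots such that each vertex without a slot is adjacent to a chosen one. -/
theorem not_allMaximalIndepSetsHaveSize_iff [Fintype ι]
    (h : ∀ x y, x ≠ y → slot x = slot y → G.Adj x y)
    (hd : ∀ i, ∃ d, slot d = some i ∧ ∀ y, G.Adj d y → slot y = some i) :
    ¬ AllMaximalIndepSetsHaveSize G (Fintype.card ι + 1) ↔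
      ∃ f : ι → V, (∀ i, slot (f i) = some i) ∧ (∀ i j, ¬ G.Adj (f i) (f j)) ∧
        ∀ c, slot c = none → ∃ i, G.Adj (f i) c := by
  classical
  constructor
  · intro hall
    unfold AllMaximalIndepSetsHaveSize at hall
    push Not at hall
    obtain ⟨S, hS, hcard⟩ := hall
    -- Maximality of `S` in the form of domination.
    have hins : ∀ x, x ∉ S → ∃ y ∈ S, G.Adj y x := by
      intro x hx
      by_contra hcon
      push Not at hcon
      have hind : G.IsIndepSet ((insert x S : Finset V) : Set V) := by
        intro a ha b hb hab hadj
        simp only [Finset.coe_insert, Set.mem_insert_iff, Finset.mem_coe] at ha hb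
        rcases ha with rfl | ha <;> rcases hb with rfl | hb
        · exact hab rfl
        · exact hcon _ hb hadj.symm
        · exact hcon _ ha hadj
        · exact hS.1 ha hb hab hadj
      exact hx (hS.2 hind (Finset.subset_insert x S) (Finset.mem_insert_self x S))
    have hinj := injOn_slot h hS.1
    -- The dummy vertex `d` of the slot is in `S` or is dominated by `S`, and it can be dominated
    -- only from within its slot.
    have hslot : ∀ i, ∃ x ∈ S, slot x = some i := by
      intro i
      obtain ⟨d, hdi, hd⟩ := hd i
      by_cases hdS : d ∈ S
      · exact ⟨d, hdS, hdi⟩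
      · obtain ⟨y, hy, hadj⟩ := hins d hdS
        exact ⟨y, hy, hd y hadj.symm⟩
    choose f hfS hf using hslot
    -- A check in `S` would make `slot` a bijection from `S` to `Option ι`, so that `S` would have
    -- the excluded size.
    have hnone : ∀ c, slot c = none → c ∉ S := by
      intro c hc hcS
      apply hcard
      have himg : S.image slot = Finset.univ := by
        ext o
        simp only [Finset.mem_image, Finset.mem_univ, iff_true]
        rcases o with _ | i
        · exact ⟨c, hcS, hc⟩
        · exact ⟨f i, hfS i, hf i⟩
      rw [← Finset.card_image_of_injOn hinj, himg, Finset.card_univ, Fintype.card_option]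
    refine ⟨f, hf, fun i j hadj => hS.1 (hfS i) (hfS j) hadj.ne hadj, fun c hc => ?_⟩
    obtain ⟨y, hy, hadj⟩ := hins c (hnone c hc)
    rcases hyi : slot y with _ | i
    · exact absurd hy (hnone y hyi)
    · have : y = f i := hinj hy (hfS i) (hyi.trans (hf i).symm)
      exact ⟨i, this ▸ hadj⟩
  · rintro ⟨f, hf, hadj, hc⟩ hall
    have hfinj : Function.Injective f := fun i j hij => by
      have := hf i
      rw [hij, hf j] at this
      exact (Option.some.inj this).symm
    have hmax : Maximal (fun T : Finset V => G.IsIndepSet (T : Set V)) (Finset.univ.image f) := by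
      refine ⟨?_, fun T hT hle x hx => ?_⟩
      · intro a ha b hb _
        simp only [Finset.coe_image, Finset.coe_univ, Set.image_univ, Set.mem_range] at ha hb
        obtain ⟨i, rfl⟩ := ha
        obtain ⟨j, rfl⟩ := hb
        exact hadj i j
      · have hmem : ∀ i, f i ∈ T := fun i => hle (Finset.mem_image_of_mem f (Finset.mem_univ i))
        rcases hxi : slot x with _ | i
        · obtain ⟨i, hi⟩ := hc x hxi
          exact absurd hi (hT (hmem i) hx hi.ne)
        · have : x = f i := injOn_slot h hT hx (hmem i) (hxi.trans (hf i).symm)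
          rw [this]
          exact Finset.mem_image_of_mem f (Finset.mem_univ i)
    have := hall _ hmax
    rw [Finset.card_image_of_injective _ hfinj, Finset.card_univ] at this
    omega

end slots

/-! ### The binary encoding of graphs -/

open Classical in
theorem graphCode_eq_ofFn {n : ℕ} (G : SimpleGraph (Fin n)) :
    graphCode G = List.ofFn fun t : Fin (n * n) => decide (G.Adj t.divNat t.modNat) := by
  rw [graphCode, List.ofFn_mul]
  congr 2
  funext i
  congr 1
  funext j
  have hn : 0 < n := i.pos
  have h₁ : (⟨i * n + j, by nlinarith [i.isLt, j.isLt]⟩ : Fin (n * n)).divNat = i := by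
    ext
    simp only [Fin.coe_divNat]
    rw [mul_comm, Nat.mul_add_div hn, Nat.div_eq_of_lt j.isLt, add_zero]
  have h₂ : (⟨i * n + j, by nlinarith [i.isLt, j.isLt]⟩ : Fin (n * n)).modNat = j := by
    ext
    simp only [Fin.coe_modNat]
    rw [mul_comm, Nat.mul_add_mod, Nat.mod_eq_of_lt j.isLt]
  rw [h₁, h₂]

/-- The length `n * n` determines `n`, and then the letters determine the graph. So the existential
quantifier in `kWellCoveredGraph` may be evaluated at any given graph. -/
theorem graphCode_inj {n n' : ℕ} {G : SimpleGraph (Fin n)} {G' : SimpleGraph (Fin n')}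
    (h : graphCode G = graphCode G') : ∃ e : n = n', e ▸ G = G' := by
  classical
  have hlen := congrArg List.length h
  simp only [graphCode_eq_ofFn, List.length_ofFn] at hlen
  obtain rfl : n = n' := Nat.mul_self_inj.1 hlen
  refine ⟨rfl, ?_⟩
  rw [graphCode_eq_ofFn, graphCode_eq_ofFn] at h
  have h := List.ofFn_injective h
  ext i j
  have := congrFun h (finProdFinEquiv (i, j))
  have h₁ : (finProdFinEquiv (i, j)).divNat = i :=
    congrArg Prod.fst (finProdFinEquiv.symm_apply_apply (i, j))
  have h₂ : (finProdFinEquiv (i, j)).modNat = j :=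
    congrArg Prod.snd (finProdFinEquiv.symm_apply_apply (i, j))
  rw [h₁, h₂] at this
  simpa using this

theorem mem_kWellCoveredGraph_iff {n : ℕ} (hn : 0 < n) (G : SimpleGraph (Fin n)) (k : ℕ) :
    (graphCode G, k) ∈ kWellCoveredGraph ↔ AllMaximalIndepSetsHaveSize G k := by
  constructor
  · rintro ⟨n', G', hn', h, hall⟩
    obtain ⟨rfl, rfl⟩ := graphCode_inj h
    exact hall
  · exact fun h => ⟨n, G, hn, rfl, h⟩

-- This writes the adjacency matrix letter by letter as a function of the position, which is the
-- form required for `exprMap`.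
open Classical in
theorem graphCode_fromRel (n : ℕ) (r : ℕ → ℕ → Prop) :
    graphCode (SimpleGraph.fromRel fun x y : Fin n => r x y) = (List.range (n * n)).map fun t =>
      decide (t / n ≠ t % n ∧ (r (t / n) (t % n) ∨ r (t % n) (t / n))) := by
  rw [graphCode_eq_ofFn]
  refine List.ext_getElem (by simp) fun t h₁ h₂ => ?_
  rw [List.getElem_ofFn, List.getElem_map, List.getElem_range]
  refine (@decide_eq_decide _ _ _ _).2 ?_
  rw [SimpleGraph.fromRel_adj, Ne, Fin.ext_iff]
  rfl

/-! ### The binary encoding of structures -/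

/-- The number of letters `true` at the beginning of a word. -/
def leadingTrues (x : List Bool) : ℕ := (x.takeWhile id).length

theorem leadingTrues_le (x : List Bool) : leadingTrues x ≤ x.length :=
  (List.takeWhile_prefix id).length_le

theorem forall_getD_iff_lt_leadingTrues (x : List Bool) (j : ℕ) :
    (∀ i < j + 1, x.getD i false = true) ↔ j < leadingTrues x := by
  induction x generalizing j with
  | nil => simpa [leadingTrues] using ⟨0, by omega⟩
  | cons b x ih =>
    rcases b with _ | _
    · simp only [leadingTrues, List.takeWhile_cons, id, Bool.false_eq_true, if_false,
        List.length_nil, Nat.not_lt_zero, iff_false]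
      intro h
      simpa using h 0 (by omega)
    · have hl : leadingTrues (true :: x) = leadingTrues x + 1 := by simp [leadingTrues]
      rw [hl]
      rcases j with _ | j
      · refine ⟨fun _ => by omega, fun _ i hi => ?_⟩
        obtain rfl : i = 0 := by omega
        rfl
      · rw [Nat.add_lt_add_iff_right, ← ih]
        refine ⟨fun h i hi => by simpa using h (i + 1) (by omega), fun h i hi => ?_⟩
        rcases i with _ | i
        · rfl
        · simpa using h i (by omega)

-- The positions `j` such that all letters up to `j` are `true` are counted; this recovers the size
-- of the universe by a bounded sum.
open Classical in
theorem sum_eq_leadingTrues (x : List Bool) :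
    (∑ j ∈ Finset.range x.length, if ∀ i < j + 1, x.getD i false = true then 1 else 0) =
      leadingTrues x := by
  have : (Finset.range x.length).filter (fun j => ∀ i < j + 1, x.getD i false = true) =
      Finset.range (leadingTrues x) := by
    ext j
    have := leadingTrues_le x
    rw [Finset.mem_filter, forall_getD_iff_lt_leadingTrues, Finset.mem_range, Finset.mem_range]
    omega
  rw [Finset.sum_boole, this]
  simp

theorem leadingTrues_replicate_append (n : ℕ) (y : List Bool) :
    leadingTrues (List.replicate n true ++ false :: y) = n := by
  simp [leadingTrues]

theorem eq_replicate_append_of_leadingTrues_lt {x : List Bool}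
    (h : leadingTrues x < x.length) :
    ∃ y, x = List.replicate (leadingTrues x) true ++ false :: y := by
  induction x with
  | nil => simp at h
  | cons b x ih =>
    rcases b with _ | _
    · exact ⟨x, by simp [leadingTrues]⟩
    · have hl : leadingTrues (true :: x) = leadingTrues x + 1 := by simp [leadingTrues]
      rw [hl, List.length_cons] at h
      obtain ⟨y, hy⟩ := ih (by omega)
      refine ⟨y, ?_⟩
      rw [hl, List.replicate_succ, List.cons_append, ← hy]

theorem length_flatten_ofFn {m : ℕ} {len : Fin m → ℕ} (f : ∀ i, Fin (len i) → Bool) :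
    (List.ofFn fun i => List.ofFn (f i)).flatten.length = ∑ i, len i := by
  rw [List.length_flatten, List.map_ofFn, List.sum_ofFn]
  simp

theorem getD_flatten_ofFn {m : ℕ} {len : Fin m → ℕ} (f : ∀ i, Fin (len i) → Bool) (i : Fin m)
    (t : Fin (len i)) :
    (List.ofFn fun i => List.ofFn (f i)).flatten.getD
      ((∑ j, if j < i then len j else 0) + t) false = f i t := by
  induction m with
  | zero => exact i.elim0
  | succ m ih =>
    rw [List.ofFn_succ, List.flatten_cons]
    refine Fin.cases (fun t => ?_) (fun i t => ?_) i t
    · rw [Finset.sum_eq_zero (by simp), zero_add, List.getD_append _ _ _ _ (by simp)]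
      rw [List.getD_eq_getElem _ _ (by simp)]
      simp
    · rw [Fin.sum_univ_succ, if_pos (Fin.succ_pos i), List.getD_append_right _ _ _ _
        (by simp only [List.length_ofFn]; omega)]
      simp only [List.length_ofFn, Fin.succ_lt_succ_iff]
      rw [add_assoc, Nat.add_sub_cancel_left]
      exact ih (fun i => f i.succ) i t

theorem exists_eq_flatten_ofFn {m : ℕ} (len : Fin m → ℕ) {y : List Bool}
    (h : y.length = ∑ i, len i) :
    ∃ f : ∀ i, Fin (len i) → Bool, y = (List.ofFn fun i => List.ofFn (f i)).flatten := by
  induction m generalizing y with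
  | zero =>
    simp only [Finset.univ_eq_empty, Finset.sum_empty, List.length_eq_zero_iff] at h
    exact ⟨fun i => i.elim0, by simp [h]⟩
  | succ m ih =>
    rw [Fin.sum_univ_succ] at h
    obtain ⟨f, hf⟩ := ih (fun i => len i.succ) (y := y.drop (len 0)) (by simp [h])
    refine ⟨Fin.cons (α := fun i => Fin (len i) → Bool) (fun t => y.getD t false) f, ?_⟩
    rw [List.ofFn_succ, List.flatten_cons]
    simp only [Fin.cons_zero, Fin.cons_succ]
    rw [← hf]
    conv_lhs => rw [← List.take_append_drop (len 0) y]
    congr 1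
    refine List.ext_getElem (by simp; omega) fun t h₁ h₂ => ?_
    simp only [List.length_ofFn] at h₂
    rw [List.getElem_take, List.getElem_ofFn, List.getD_eq_getElem _ _ (by simp; omega)]

section code

variable {m : ℕ} {ar : Fin m → ℕ} {n : ℕ}

theorem Interp.leadingTrues_code (A : Interp ar n) : leadingTrues A.code = n :=
  leadingTrues_replicate_append n _

theorem Interp.length_code (A : Interp ar n) : A.code.length = n + 1 + ∑ i, n ^ ar i := by
  rw [Interp.code, List.length_append, List.length_replicate, List.length_cons,
    length_flatten_ofFn]
  omega

/-- The position in the encoding of a structure of the truth value of the relation `i` for a tuple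
with the number `t`. -/
def codePos (ar : Fin m → ℕ) (n : ℕ) (i : Fin m) (t : ℕ) : ℕ :=
  n + 1 + ((∑ j, if j < i then n ^ ar j else 0) + t)

theorem Interp.getD_code (A : Interp ar n) (i : Fin m) (v : Fin (ar i) → Fin n) :
    A.code.getD (codePos ar n i (finFunctionFinEquiv v)) false = true ↔ A i v := by
  classical
  rw [Interp.code, codePos, List.getD_append_right _ _ _ _
      (by simp only [List.length_replicate]; omega), List.length_replicate, add_assoc n 1,
    Nat.add_sub_cancel_left, Nat.add_comm 1,
    List.getD_cons_succ, getD_flatten_ofFn (len := fun i => n ^ ar i)]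
  simp

/-- Every bit string of the right length is a legitimate sequence of truth tables, so
well-formedness of an encoding can be tested by its length alone. -/
theorem exists_eq_code {x : List Bool}
    (hx : x.length = leadingTrues x + 1 + ∑ i, leadingTrues x ^ ar i) :
    ∃ A : Interp ar (leadingTrues x), x = A.code := by
  obtain ⟨y, hy⟩ := eq_replicate_append_of_leadingTrues_lt (x := x) (by omega)
  have hlen := congrArg List.length hy
  rw [List.length_append, List.length_replicate, List.length_cons] at hlen
  obtain ⟨f, hf⟩ := exists_eq_flatten_ofFn (fun i => leadingTrues x ^ ar i) (y := y) (by omega)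
  refine ⟨fun i v => f i (finFunctionFinEquiv v) = true, ?_⟩
  conv_lhs => rw [hy, hf]
  simp [Interp.code]

theorem Interp.code_inj {n' : ℕ} {A : Interp ar n} {A' : Interp ar n'} (h : A.code = A'.code) :
    ∃ e : n = n', e ▸ A = A' := by
  have hn : n = n' := by rw [← A.leadingTrues_code, h, A'.leadingTrues_code]
  subst hn
  refine ⟨rfl, ?_⟩
  funext i v
  refine propext (show A i v ↔ A' i v from ?_)
  rw [← Interp.getD_code A i v, h, Interp.getD_code]

theorem mem_weightedFagin_iff {s p q : ℕ}
    (ψ : (vocabularyWithVar ar s).BoundedFormula Empty (p + q)) (A : Interp ar n) (hn : 0 < n)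
    (k : ℕ) : (A.code, k) ∈ weightedFagin ar ψ ↔
      ∃ S : Finset (Fin s → Fin n), S.card = k ∧ SatisfiesPiTwo A S ψ := by
  constructor
  · rintro ⟨n', A', -, h, hS⟩
    obtain ⟨rfl, rfl⟩ := Interp.code_inj h
    exact hS
  · exact fun h => ⟨n, A, hn, rfl, h⟩

end code

end ParamComplexity

/-! ### From a `Π₂` formula to the graph, and the description of the graph by expressions. -/

namespace ParamComplexity

open FirstOrder FirstOrder.Language

/-! ### The truth of quantifier-free formulas, in terms of the encoding -/

section formulas

variable {m : ℕ} {ar : Fin m → ℕ} {s l : ℕ}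

/-- The formula `ψ` holds in the structure `A` for the tuple `v` when the relation variable is
interpreted as `X`. -/
def RealizeWith {n : ℕ} (A : Interp ar n) (X : (Fin s → Fin n) → Prop)
    (ψ : (vocabularyWithVar ar s).BoundedFormula Empty l) (v : Fin l → Fin n) : Prop :=
  letI : (vocabulary ar).Structure (Fin n) := A.toStructure
  letI : (vocabulary fun _ : Fin 1 => s).Structure (Fin n) := Interp.toStructure fun _ v => X v
  ψ.Realize (Empty.elim) v

theorem satisfiesPiTwo_iff {n p q : ℕ} (A : Interp ar n) (S : Finset (Fin s → Fin n))
    (ψ : (vocabularyWithVar ar s).BoundedFormula Empty (p + q)) : SatisfiesPiTwo A S ψ ↔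
      ∀ a : Fin p → Fin n, ∃ b : Fin q → Fin n, RealizeWith A (· ∈ S) ψ (Fin.append a b) :=
  Iff.rfl

/-- The number of a tuple. -/
def tupleNum {s : ℕ} (n : ℕ) (u : Fin s → ℕ) : ℕ := ∑ j, u j * n ^ (j : ℕ)

theorem Expressible.tupleNum {ν : Args → ℕ} {u : Fin s → Args → ℕ} (hν : Expressible ν)
    (hu : ∀ j, Expressible (u j)) : Expressible fun z => tupleNum (ν z) fun j => u j z :=
  finset_sum _ fun j => (hu j).mul (hν.pow j)

theorem Expressible.codePos {ν u : Args → ℕ} (hν : Expressible ν) (hu : Expressible u)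
    (i : Fin m) : Expressible fun z => codePos ar (ν z) i (u z) :=
  (hν.add (.const 1)).add ((finset_sum _ fun j => by
    by_cases h : j < i
    · simpa only [h, if_true] using hν.pow (ar j)
    · simpa only [h, if_false] using Expressible.const 0).add hu)

theorem exists_eq_var (t : (vocabularyWithVar ar s).Term (Empty ⊕ Fin l)) :
    ∃ i, t = Term.var (Sum.inr i) := by
  rcases t with (e | i) | ⟨f, _⟩
  · exact e.elim
  · exact ⟨i, rfl⟩
  · rcases f with f | f <;> exact f.elim

/-- The truth of a quantifier-free formula depends in an expressible way on the encoding of the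
structure, on the membership of tuples in the relation variable, and on the assignment. Only the
membership of tuples of assigned elements matters. -/
theorem exists_expressible_realizeWith {ψ : (vocabularyWithVar ar s).BoundedFormula Empty l}
    (hψ : ψ.IsQF) : ∃ Ψ : List Bool → ℕ → (ℕ → Prop) → (Fin l → ℕ) → Prop,
    (∀ (n : ℕ) (A : Interp ar n) (X : (Fin s → Fin n) → Prop) (R : ℕ → Prop) (v : Fin l → Fin n),
      (∀ τ : Fin s → Fin l, R (tupleNum n fun j => v (τ j)) ↔ X fun j => v (τ j)) →
      (Ψ A.code n R (fun i => v i) ↔ RealizeWith A X ψ v)) ∧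
    ∀ (ν : Args → ℕ) (R : Args → ℕ → Prop) (v : Fin l → Args → ℕ), Expressible ν →
      (∀ u, Expressible u → ExpressiblePred fun z => R z (u z)) → (∀ i, Expressible (v i)) →
      ExpressiblePred fun z => Ψ z.1 (ν z) (R z) fun i => v i z := by
  induction hψ with
  | falsum =>
    exact ⟨fun _ _ _ _ => False, fun _ _ _ _ _ _ => Iff.rfl, fun _ _ _ _ _ _ => .const False⟩
  | of_isAtomic h =>
    rcases h with ⟨t₁, t₂⟩ | ⟨R, ts⟩
    · obtain ⟨i, rfl⟩ := exists_eq_var t₁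
      obtain ⟨j, rfl⟩ := exists_eq_var t₂
      refine ⟨fun _ _ _ v => v i = v j, fun n A X R v _ => ?_, fun ν R v _ _ hv =>
        .eq (hv i) (hv j)⟩
      simp only [RealizeWith, BoundedFormula.realize_bdEqual, Term.realize_var, Sum.elim_inr]
      exact Fin.ext_iff.symm
    · choose i hi using fun j => exists_eq_var (ts j)
      obtain rfl : ts = fun j => Term.var (Sum.inr (i j)) := funext hi
      rcases R with ⟨R, rfl⟩ | ⟨R, rfl⟩
      · refine ⟨fun x n _ v => x.getD (codePos ar n R (tupleNum n fun j => v (i j))) false = true,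
          fun n A X T v _ => ?_, fun ν T v hν _ hv =>
            .bit (Expressible.codePos hν (Expressible.tupleNum hν fun j => hv (i j)) R)⟩
        exact (Interp.getD_code A R fun j => v (i j)).trans (by
          simp only [RealizeWith]
          rfl)
      -- The arguments of an atom are variables, so the tuple has the form `v ∘ i`, for which the
      -- hypothesis on `T` and `X` is available.
      · refine ⟨fun x n T v => T (tupleNum n fun j => v (i j)),
          fun n A X T v h => (h i).trans (by
            simp only [RealizeWith]
            rfl), fun ν T v hν hT hv => hT _ (Expressible.tupleNum hν fun j => hv (i j))⟩
  | imp h₁ h₂ ih₁ ih₂ =>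
    obtain ⟨Ψ₁, s₁, e₁⟩ := ih₁
    obtain ⟨Ψ₂, s₂, e₂⟩ := ih₂
    refine ⟨fun x n R v => Ψ₁ x n R v → Ψ₂ x n R v, fun n A X R v h => ?_,
      fun ν R v hν hR hv => (e₁ ν R v hν hR hv).imp (e₂ ν R v hν hR hv)⟩
    simp only [RealizeWith, BoundedFormula.realize_imp]
    exact imp_congr (s₁ n A X R v h) (s₂ n A X R v h)

end formulas

/-! ### The graph of a constraint problem -/

/-- The vertex `σ * W + w`, for `σ < K` and `w < W`, stands for the value `w` in the slot `σ`. The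
vertices from `K * W` on are the checks: first one for each slot, and then those with the witnesses
given by `wit`. -/
def slotRel (K W : ℕ) (valid : ℕ → ℕ → Prop) (cons : ℕ → ℕ → ℕ → ℕ → Prop)
    (wit : ℕ → ℕ → ℕ → Prop) (x y : ℕ) : Prop :=
  (x < K * W ∧ y < K * W ∧ (x / W = y / W ∨ valid (x / W) (x % W) ∧ valid (y / W) (y % W) ∧
    ¬ cons (x / W) (x % W) (y / W) (y % W))) ∨
  (K * W ≤ x ∧ K * W ≤ y) ∨
  (x < K * W ∧ K * W ≤ y ∧ valid (x / W) (x % W) ∧ (x / W = y - K * W ∨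
    K ≤ y - K * W ∧ wit (y - K * W - K) (x / W) (x % W)))

/-- The value `0` is the dummy of each slot: being invalid, it has no neighbours outside the slot.
The first `K` checks force the chosen values to be valid, the edges between valid values of
different slots enforce `cons`, and the last `C` checks demand witnesses. -/
theorem not_allMaximalIndepSetsHaveSize_slotRel {K W C : ℕ} (hW : 0 < W)
    {valid : ℕ → ℕ → Prop} {cons : ℕ → ℕ → ℕ → ℕ → Prop} {wit : ℕ → ℕ → ℕ → Prop}
    (h0 : ∀ σ, ¬ valid σ 0) :
    ¬ AllMaximalIndepSetsHaveSize (SimpleGraph.fromRel fun x y : Fin (K * W + K + C) =>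
        slotRel K W valid cons wit x y) (K + 1) ↔
      ∃ f : ℕ → ℕ, (∀ σ < K, f σ < W ∧ valid σ (f σ)) ∧
        (∀ σ < K, ∀ σ' < K, σ ≠ σ' → cons σ (f σ) σ' (f σ')) ∧
        ∀ a < C, ∃ σ < K, wit a σ (f σ) := by
  have hdiv : ∀ {x}, x < K * W → x / W < K := fun h => Nat.div_lt_of_lt_mul (by rwa [mul_comm])
  have hlt : ∀ {σ w}, σ < K → w < W → σ * W + w < K * W := fun {σ w} hσ hw => by
    calc σ * W + w < (σ + 1) * W := by rw [Nat.succ_mul]; omega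
      _ ≤ K * W := Nat.mul_le_mul_right _ hσ
  have hd : ∀ {σ w}, w < W → (σ * W + w) / W = σ := fun {σ w} hw => by
    rw [mul_comm, Nat.mul_add_div hW, Nat.div_eq_of_lt hw, add_zero]
  have hm : ∀ {σ w}, w < W → (σ * W + w) % W = w := fun {σ w} hw => by
    rw [mul_comm, Nat.mul_add_mod, Nat.mod_eq_of_lt hw]
  let slot : Fin (K * W + K + C) → Option (Fin K) := fun x =>
    if h : x.val < K * W then some ⟨x / W, hdiv h⟩ else none
  have hsome : ∀ x i, slot x = some i ↔ x.val < K * W ∧ x.val / W = i := by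
    intro x i
    by_cases h : x.val < K * W
    · simp [slot, h, Fin.ext_iff]
    · simp [slot, h]
  have hnone : ∀ x, slot x = none ↔ K * W ≤ x.val := by
    intro x
    by_cases h : x.val < K * W
    · simp [slot, h]
    · simp [slot, h]; omega
  have key := not_allMaximalIndepSetsHaveSize_iff (slot := slot)
    (G := SimpleGraph.fromRel fun x y : Fin (K * W + K + C) => slotRel K W valid cons wit x y)
    (fun x y hne hxy => by
      rw [SimpleGraph.fromRel_adj]
      refine ⟨hne, Or.inl ?_⟩
      rcases hy : slot y with _ | i
      · rw [hy] at hxy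
        exact Or.inr (Or.inl ⟨(hnone x).1 hxy, (hnone y).1 hy⟩)
      · rw [hy] at hxy
        have h₁ := (hsome x i).1 hxy
        have h₂ := (hsome y i).1 hy
        exact Or.inl ⟨h₁.1, h₂.1, Or.inl (h₁.2.trans h₂.2.symm)⟩)
    (fun i => by
      have hlti := hlt i.isLt hW
      -- The dummy vertex of slot `i`; every edge that leaves a slot requires validity of the value.
      refine ⟨⟨i * W + 0, by omega⟩, (hsome _ _).2 ⟨hlti, hd hW⟩, fun y hy => ?_⟩
      rw [SimpleGraph.fromRel_adj] at hy
      rw [hsome]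
      have e₁ := hd (σ := i.val) hW
      have e₂ := hm (σ := i.val) hW
      have hv := h0 i.val
      unfold slotRel at hy
      simp only [e₁, e₂] at hy
      rcases hy.2 with (⟨_, h, h' | h'⟩ | h | h) | (⟨h, _, h' | h'⟩ | h | h)
      · exact ⟨h, h'.symm⟩
      · exact absurd h'.1 hv
      · omega
      · exact absurd h.2.2.1 hv
      · exact ⟨h, h'⟩
      · exact absurd h'.2.1 hv
      · omega
      · omega)
  rw [Fintype.card_fin] at key
  rw [key]
  clear key
  constructor
  · rintro ⟨f, hf, hadj, hc⟩
    have hfs : ∀ i, (f i).val < K * W ∧ (f i).val / W = i := fun i => (hsome _ _).1 (hf i)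
    have hvalid : ∀ i : Fin K, valid i ((f i).val % W) := by
      intro i
      -- Among the slot vertices, the check of slot `i` is adjacent only to the valid values of this
      -- slot, so its neighbour `f j` has `j = i`.
      obtain ⟨j, hj⟩ := hc ⟨K * W + i, by omega⟩ ((hnone _).2 (by simp))
      rw [SimpleGraph.fromRel_adj] at hj
      unfold slotRel at hj
      have hjs := hfs j
      simp only at hj
      rcases hj.2 with (h | h | ⟨_, _, h, h' | h'⟩) | (h | h | h)
      · omega
      · omega
      · have : j = i := Fin.ext (by omega)
        subst this
        rwa [hjs.2] at h
      · omega
      · omega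
      · omega
      · omega
    refine ⟨fun σ => if h : σ < K then (f ⟨σ, h⟩).val % W else 0, fun σ hσ => ?_,
      fun σ hσ σ' hσ' hne => ?_, fun a ha => ?_⟩
    · dsimp only
      rw [dif_pos hσ]
      exact ⟨Nat.mod_lt _ hW, hvalid ⟨σ, hσ⟩⟩
    · dsimp only
      rw [dif_pos hσ, dif_pos hσ']
      by_contra hcon
      apply hadj ⟨σ, hσ⟩ ⟨σ', hσ'⟩
      rw [SimpleGraph.fromRel_adj]
      have h₁ := hfs ⟨σ, hσ⟩
      have h₂ := hfs ⟨σ', hσ'⟩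
      have v₁ := hvalid ⟨σ, hσ⟩
      have v₂ := hvalid ⟨σ', hσ'⟩
      simp only at h₁ h₂ v₁ v₂
      refine ⟨fun h => ?_, Or.inl (Or.inl ⟨h₁.1, h₂.1, Or.inr ?_⟩)⟩
      · rw [h] at h₁
        omega
      · rw [h₁.2, h₂.2]
        exact ⟨v₁, v₂, hcon⟩
    · obtain ⟨j, hj⟩ := hc ⟨K * W + (K + a), by omega⟩ ((hnone _).2 (by simp))
      rw [SimpleGraph.fromRel_adj] at hj
      unfold slotRel at hj
      have hjs := hfs j
      have hjK := j.isLt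
      refine ⟨j, hjK, ?_⟩
      dsimp only
      rw [dif_pos hjK]
      simp only at hj
      rcases hj.2 with (h | h | ⟨_, _, h, h' | h'⟩) | (h | h | h)
      · omega
      · omega
      · omega
      · have e : K * W + (K + a) - K * W - K = a := by omega
        rw [e, hjs.2] at h'
        exact h'.2
      · omega
      · omega
      · omega
  · rintro ⟨f, hf, hcons, hwit⟩
    have hfW : ∀ i : Fin K, i * W + f i < K * W := fun i => hlt i.isLt (hf i i.isLt).1
    refine ⟨fun i => ⟨i * W + f i, by have := hfW i; omega⟩, fun i => ?_, fun i j hadj => ?_,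
      fun c hcn => ?_⟩
    · exact (hsome _ _).2 ⟨hfW i, hd (hf i i.isLt).1⟩
    · rw [SimpleGraph.fromRel_adj] at hadj
      unfold slotRel at hadj
      have h₁ := hfW i
      have h₂ := hfW j
      have hij : i.val ≠ j.val := by
        intro h
        apply hadj.1
        rw [Fin.ext_iff]
        simp only [h]
      have w₁ := (hf i i.isLt).1
      have w₂ := (hf j j.isLt).1
      simp only [hd w₁, hm w₁, hd w₂, hm w₂] at hadj
      rcases hadj.2 with (⟨_, _, h | h⟩ | h | h) | (⟨_, _, h | h⟩ | h | h)
      · exact hij h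
      · exact h.2.2 (hcons _ i.isLt _ j.isLt hij)
      · omega
      · omega
      · exact hij h.symm
      · exact h.2.2 (hcons _ j.isLt _ i.isLt hij.symm)
      · omega
      · omega
    · have hc := (hnone c).1 hcn
      have hcl := c.isLt
      by_cases hcK : c.val - K * W < K
      · refine ⟨⟨c - K * W, hcK⟩, ?_⟩
        have h₁ := hfW ⟨c - K * W, hcK⟩
        have w₁ := hf _ hcK
        rw [SimpleGraph.fromRel_adj]
        simp only at h₁
        refine ⟨fun h => ?_, Or.inl (Or.inr (Or.inr ⟨h₁, hc, ?_⟩))⟩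
        · rw [Fin.ext_iff] at h
          simp only at h
          omega
        · simp only [hd w₁.1, hm w₁.1]
          exact ⟨w₁.2, Or.inl trivial⟩
      · obtain ⟨σ, hσ, hw⟩ := hwit (c - K * W - K) (by omega)
        refine ⟨⟨σ, hσ⟩, ?_⟩
        have h₁ := hfW ⟨σ, hσ⟩
        have w₁ := hf _ hσ
        rw [SimpleGraph.fromRel_adj]
        simp only at h₁
        refine ⟨fun h => ?_, Or.inl (Or.inr (Or.inr ⟨h₁, hc, ?_⟩))⟩
        · rw [Fin.ext_iff] at h
          simp only at h
          omega
        · simp only [hd w₁.1, hm w₁.1]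
          exact ⟨w₁.2, Or.inr ⟨by omega, hw⟩⟩

/-! ### Sets of `k` numbers, described by the gaps between their elements -/

/-- The digit `t` of `x` in base `b`. -/
def digit (b t x : ℕ) : ℕ := x / b ^ t % b

theorem exists_digit_eq {b : ℕ} (D : ℕ) (g : ℕ → ℕ) (hg : ∀ t < D, g t < b) :
    ∃ w < b ^ D, ∀ t < D, digit b t w = g t := by
  refine ⟨finFunctionFinEquiv fun t : Fin D => ⟨g t, hg t t.isLt⟩, Fin.isLt _, fun t ht => ?_⟩
  have := congrFun (finFunctionFinEquiv.symm_apply_apply fun t : Fin D =>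
    (⟨g t, hg t t.isLt⟩ : Fin b)) ⟨t, ht⟩
  exact congrArg Fin.val this

/-- The functions `l` and `h` give the lower and upper ends of the `k + 1` gaps that are left by
the `k` numbers `h 0 - 1 < … < h (k - 1) - 1` below `N`. -/
structure IsGaps (N k : ℕ) (l h : ℕ → ℕ) : Prop where
  zero : l 0 = 0
  last : h k = N + 1
  succ : ∀ i < k, l (i + 1) = h i
  lt : ∀ i ≤ k, l i < h i

/-! ### Correspondence between sets of `k` numbers and sequences of gaps. -/

namespace IsGaps

variable {N k : ℕ} {l h : ℕ → ℕ}

theorem h_lt (H : IsGaps N k l h) {i j : ℕ} (hij : i < j) (hj : j ≤ k) : h i < h j := by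
  induction j with
  | zero => omega
  | succ j ih =>
    have h₁ := H.succ j (by omega)
    have h₂ := H.lt (j + 1) hj
    rcases Nat.lt_succ_iff_lt_or_eq.1 hij with hij | rfl
    · have := ih hij (by omega)
      omega
    · omega

theorem h_le (H : IsGaps N k l h) {i j : ℕ} (hij : i ≤ j) (hj : j ≤ k) : h i ≤ h j := by
  rcases hij.lt_or_eq with hij | rfl
  · exact (H.h_lt hij hj).le
  · exact le_rfl

/-- Upper ends increase and each lower end is the preceding upper end, so the half-open gaps are
disjoint: an upper end that lies in a gap is the end of this gap. -/
theorem eq_of_mem_gap (H : IsGaps N k l h) {i j : ℕ} (hi : i ≤ k) (hj : j ≤ k)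
    (h₁ : l j < h i) (h₂ : h i ≤ h j) : i = j := by
  rcases lt_trichotomy i j with hij | hij | hij
  · obtain ⟨j, rfl⟩ : ∃ j', j = j' + 1 := ⟨j - 1, by omega⟩
    have e := H.succ j (by omega)
    have := H.h_le (show i ≤ j by omega) (by omega)
    omega
  · exact hij
  · have := H.h_lt hij hi
    omega

theorem exists_gap (H : IsGaps N k l h) {u : ℕ} (hu : u < N) :
    ∃ i ≤ k, l i < u + 1 ∧ u + 1 ≤ h i := by
  classical
  have hex : ∃ i, u + 1 ≤ h i := ⟨k, by rw [H.last]; omega⟩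
  have hle : Nat.find hex ≤ k := Nat.find_min' hex (by rw [H.last]; omega)
  refine ⟨Nat.find hex, hle, ?_, Nat.find_spec hex⟩
  rcases hi : Nat.find hex with _ | i
  · rw [H.zero]; omega
  · rw [H.succ i (by omega)]
    have := Nat.find_min hex (show i < Nat.find hex by omega)
    omega

/-- The elements of the described set. -/
theorem mem_image_iff (H : IsGaps N k l h) (u : ℕ) :
    u ∈ (Finset.range k).image (fun i => h i - 1) ↔ ∃ i < k, h i = u + 1 := by
  rw [Finset.mem_image]
  refine exists_congr fun i => ?_
  rw [Finset.mem_range]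
  refine and_congr_right fun hi => ?_
  have := H.lt i hi.le
  omega

theorem card_image (H : IsGaps N k l h) :
    ((Finset.range k).image (fun i => h i - 1)).card = k := by
  rw [Finset.card_image_of_injOn, Finset.card_range]
  intro i hi j hj hij
  simp only [Finset.coe_range, Set.mem_Iio] at hi hj
  have h₁ := H.lt i hi.le
  have h₂ := H.lt j hj.le
  simp only at hij
  exact H.eq_of_mem_gap hi.le hj.le (by omega) (by omega)

theorem image_subset (H : IsGaps N k l h) :
    (Finset.range k).image (fun i => h i - 1) ⊆ Finset.range N := by
  intro u hu
  obtain ⟨i, hi, hiu⟩ := (H.mem_image_iff u).1 hu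
  have := H.h_lt hi le_rfl
  rw [H.last] at this
  rw [Finset.mem_range]
  omega

/-- The elements are shifted by one so that `0` and `N + 1` are free to serve as the outermost ends.
All ends are therefore digits in base `N + 2`. -/
theorem exists_of_finset {T : Finset ℕ} (hT : T ⊆ Finset.range N) (hk : T.card = k) :
    ∃ l h : ℕ → ℕ, IsGaps N k l h ∧ (∀ i, l i < N + 2 ∧ h i < N + 2) ∧
      ∀ u, u ∈ T ↔ ∃ i < k, h i = u + 1 := by
  classical
  let e := T.orderEmbOfFin hk
  have heN : ∀ i, e i < N := fun i => Finset.mem_range.1 (hT (T.orderEmbOfFin_mem hk i))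
  let h : ℕ → ℕ := fun i => if hi : i < k then e ⟨i, hi⟩ + 1 else N + 1
  have hpos : ∀ i (hi : i < k), h i = e ⟨i, hi⟩ + 1 := fun i hi => dif_pos hi
  have hneg : ∀ i, ¬ i < k → h i = N + 1 := fun i hi => dif_neg hi
  have hN : ∀ i, h i < N + 2 := by
    intro i
    by_cases hi : i < k
    · have := heN ⟨i, hi⟩
      rw [hpos i hi]; omega
    · rw [hneg i hi]; omega
  refine ⟨fun i => if i = 0 then 0 else h (i - 1), h, ⟨rfl, hneg k (by omega), fun i hi => rfl,
    fun i hi => ?_⟩, fun i => ⟨?_, hN i⟩, fun u => ?_⟩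
  · rcases i with _ | i
    · by_cases h0 : 0 < k
      · rw [hpos 0 h0]; simp
      · rw [hneg 0 h0]; simp
    · simp only [Nat.add_eq_zero_iff, one_ne_zero, and_false, if_false, Nat.add_sub_cancel]
      rw [hpos i (by omega)]
      by_cases hi' : i + 1 < k
      · rw [hpos _ hi']
        have : e ⟨i, by omega⟩ < e ⟨i + 1, hi'⟩ := e.strictMono (by simp [Fin.lt_def])
        omega
      · rw [hneg _ hi']
        have := heN ⟨i, by omega⟩
        omega
  · dsimp only
    split_ifs
    · omega
    · exact hN _
  · constructor
    · intro hu
      have : u ∈ Set.range (T.orderEmbOfFin hk) := by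
        rw [Finset.range_orderEmbOfFin]; exact hu
      obtain ⟨i, rfl⟩ := this
      exact ⟨i, i.isLt, hpos i i.isLt⟩
    · rintro ⟨i, hi, hiu⟩
      rw [hpos i hi] at hiu
      have : e ⟨i, hi⟩ = u := by omega
      rw [← this]
      exact T.orderEmbOfFin_mem hk _

end IsGaps

/-! ### The constraints on the values of the slots -/

/-- The index of the `j`-th gap in the slot `σ`. -/
def gapIndex (k j σ : ℕ) : ℕ := digit (k + 1) j σ

/-- The lower end of the `j`-th gap in the value `w`. -/
def gapLow (N j w : ℕ) : ℕ := digit (N + 2) (2 * j) w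

/-- The upper end of the `j`-th gap in the value `w`. -/
def gapHigh (N j w : ℕ) : ℕ := digit (N + 2) (2 * j + 1) w

/-- The gaps in two values are consistent. -/
def GapCons (N k d σ w σ' w' : ℕ) : Prop :=
  ∀ j j' : Fin d,
    (gapIndex k j σ = gapIndex k j' σ' → gapLow N j w = gapLow N j' w' ∧
      gapHigh N j w = gapHigh N j' w') ∧
    (gapIndex k j' σ' = gapIndex k j σ + 1 → gapLow N j' w' = gapHigh N j w)

/-- The value `w` is possible for the slot `σ`. -/
def GapValid (N k d σ w : ℕ) : Prop :=
  GapCons N k d σ w σ w ∧ ∀ j : Fin d, gapLow N j w < gapHigh N j w ∧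
    (gapIndex k j σ = 0 → gapLow N j w = 0) ∧ (gapIndex k j σ = k → gapHigh N j w = N + 1)

/-- The value `w` determines whether `u` is in the set. -/
def GapKnows (N d w u : ℕ) : Prop := ∃ j : Fin d, gapLow N j w < u + 1 ∧ u + 1 ≤ gapHigh N j w

/-- According to the value `w`, the number `u` is in the set. -/
def GapMem (N d w u : ℕ) : Prop := ∃ j : Fin d, gapHigh N j w = u + 1

theorem gapIndex_le (k j σ : ℕ) : gapIndex k j σ ≤ k :=
  Nat.lt_succ_iff.1 (Nat.mod_lt _ (Nat.succ_pos k))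

/-- A number in a known gap can be an element only as the upper end of this gap. The last end `N +
1` is not the shift of a number below `N`, so it does not produce a spurious element. -/
theorem IsGaps.gapMem_iff {N k d σ w u : ℕ} {l h : ℕ → ℕ} (H : IsGaps N k l h)
    (hl : ∀ j : Fin d, gapLow N j w = l (gapIndex k j σ))
    (hh : ∀ j : Fin d, gapHigh N j w = h (gapIndex k j σ)) (hu : u < N)
    (hK : GapKnows N d w u) : GapMem N d w u ↔ ∃ i < k, h i = u + 1 := by
  constructor
  · rintro ⟨j, hj⟩
    rw [hh] at hj
    refine ⟨_, lt_of_le_of_ne (gapIndex_le k j σ) fun he => ?_, hj⟩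
    rw [he, H.last] at hj
    omega
  · rintro ⟨i, hi, hiu⟩
    obtain ⟨j, h₁, h₂⟩ := hK
    rw [hl] at h₁
    rw [hh] at h₂
    have := H.eq_of_mem_gap hi.le (gapIndex_le k j σ) (by omega) (by omega)
    exact ⟨j, by rw [hh, ← this, hiu]⟩

/-- There is a consistent choice of values for the slots such that each `a` has a witness if and
only if there is a set of `k` numbers for which the property `Φ` holds. -/
theorem exists_slot_values_iff {ι : Type} [Fintype ι] {N k d Cp Cq : ℕ}
    (hd : Fintype.card ι + 1 = d) (U : ℕ → ℕ → ι → ℕ) (hU : ∀ a < Cp, ∀ b < Cq, ∀ τ, U a b τ < N)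
    (Φ : ℕ → ℕ → (ℕ → Prop) → Prop) (hΦ : ∀ a < Cp, ∀ b < Cq, ∀ R R' : ℕ → Prop,
      (∀ τ, R (U a b τ) ↔ R' (U a b τ)) → (Φ a b R ↔ Φ a b R')) :
    (∃ f : ℕ → ℕ, (∀ σ < (k + 1) ^ d, f σ < (N + 2) ^ (2 * d) ∧ GapValid N k d σ (f σ)) ∧
        (∀ σ < (k + 1) ^ d, ∀ σ' < (k + 1) ^ d, σ ≠ σ' → GapCons N k d σ (f σ) σ' (f σ')) ∧
        ∀ a < Cp, ∃ σ < (k + 1) ^ d, ∃ b < Cq, (∀ τ, GapKnows N d (f σ) (U a b τ)) ∧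
          Φ a b (GapMem N d (f σ))) ↔
      ∃ T ⊆ Finset.range N, T.card = k ∧ ∀ a < Cp, ∃ b < Cq, Φ a b (· ∈ T) := by
  classical
  constructor
  · rintro ⟨f, hf, hcons, hwit⟩
    -- The graph compares only values of different slots; consistency of a value with itself is part
    -- of validity.
    have hcons' : ∀ σ < (k + 1) ^ d, ∀ σ' < (k + 1) ^ d, GapCons N k d σ (f σ) σ' (f σ') := by
      intro σ hσ σ' hσ'
      by_cases h : σ = σ'
      · subst h; exact (hf σ hσ).2.1
      · exact hcons σ hσ σ' hσ' h
    -- The number `i ≤ k` is itself a slot, and its digit `0` in base `k + 1` is `i`. These slots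
    -- give the reference gaps; here `d` must be positive, also when `ι` is empty.
    have hlt : ∀ i ≤ k, i < (k + 1) ^ d := fun i hi =>
      (Nat.lt_succ_iff.2 hi).trans_le (Nat.le_self_pow (by omega) _)
    have hidx : ∀ i ≤ k, gapIndex k 0 i = i := fun i hi => by
      simp [gapIndex, digit, Nat.mod_eq_of_lt (Nat.lt_succ_iff.2 hi)]
    let j₀ : Fin d := ⟨0, by omega⟩
    have H : IsGaps N k (fun i => gapLow N 0 (f i)) (fun i => gapHigh N 0 (f i)) := by
      refine ⟨?_, ?_, fun i hi => ?_, fun i hi => ?_⟩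
      · exact ((hf 0 (hlt 0 (by omega))).2.2 j₀).2.1 (hidx 0 (by omega))
      · exact ((hf k (hlt k le_rfl)).2.2 j₀).2.2 (hidx k le_rfl)
      · refine (hcons' i (hlt i hi.le) (i + 1) (hlt _ hi) j₀ j₀).2 ?_
        exact (hidx _ hi).trans (congrArg (· + 1) (hidx i hi.le).symm)
      · exact ((hf i (hlt i hi)).2.2 j₀).1
    refine ⟨_, H.image_subset, H.card_image, fun a ha => ?_⟩
    obtain ⟨σ, hσ, b, hb, hK, hφ⟩ := hwit a ha
    refine ⟨b, hb, (hΦ a ha b hb _ _ fun τ => ?_).1 hφ⟩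
    rw [H.mem_image_iff]
    -- Each gap in the value of the witnessing slot `σ` agrees with the reference gap of the same
    -- index.
    have hpair := fun j : Fin d => (hcons' σ hσ (gapIndex k j σ) (hlt _ (gapIndex_le k j σ))
      j j₀).1 (hidx _ (gapIndex_le k j σ)).symm
    exact H.gapMem_iff (fun j => (hpair j).1) (fun j => (hpair j).2) (hU a ha b hb τ) (hK τ)
  · rintro ⟨T, hT, hk, hφ⟩
    obtain ⟨l, h, H, hlt, hTm⟩ := IsGaps.exists_of_finset hT hk
    -- The true gaps are packed into one number: even digits are lower ends, odd digits are upper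
    -- ends.
    have hex : ∀ σ, ∃ w < (N + 2) ^ (2 * d), ∀ j : Fin d, gapLow N j w = l (gapIndex k j σ) ∧
        gapHigh N j w = h (gapIndex k j σ) := by
      intro σ
      obtain ⟨w, hw, hdig⟩ := exists_digit_eq (b := N + 2) (2 * d) (fun t =>
        if t % 2 = 0 then l (gapIndex k (t / 2) σ) else h (gapIndex k (t / 2) σ)) (fun t _ => by
          split_ifs
          · exact (hlt _).1
          · exact (hlt _).2)
      refine ⟨w, hw, fun j => ⟨(hdig (2 * j) (by omega)).trans ?_,
        (hdig (2 * j + 1) (by omega)).trans ?_⟩⟩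
      · rw [if_pos (by omega), Nat.mul_div_cancel_left _ (by omega)]
      · rw [if_neg (by omega), show (2 * j.val + 1) / 2 = j by omega]
    choose f hfW hf using hex
    have hcons : ∀ σ σ', GapCons N k d σ (f σ) σ' (f σ') := by
      intro σ σ' j j'
      rw [(hf σ j).1, (hf σ j).2, (hf σ' j').1, (hf σ' j').2]
      refine ⟨fun e => by rw [e]; exact ⟨rfl, rfl⟩, fun e => ?_⟩
      have := gapIndex_le k j' σ'
      rw [e, H.succ _ (by omega)]
    refine ⟨f, fun σ hσ => ⟨hfW σ, hcons σ σ, fun j => ?_⟩, fun σ _ σ' _ _ => hcons σ σ',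
      fun a ha => ?_⟩
    · rw [(hf σ j).1, (hf σ j).2]
      exact ⟨H.lt _ (gapIndex_le k j σ), fun e => by rw [e, H.zero], fun e => by rw [e, H.last]⟩
    · obtain ⟨b, hb, hφ⟩ := hφ a ha
      choose I hIk hI using fun τ => H.exists_gap (hU a ha b hb τ)
      let e := Fintype.equivFin ι
      -- The witnessing slot has as its digits the indices of the gaps that contain the numbers `U a
      -- b τ`; the one remaining digit is set to `0`.
      obtain ⟨σ, hσ, hdig⟩ := exists_digit_eq (b := k + 1) d (fun t =>
        if ht : t < Fintype.card ι then I (e.symm ⟨t, ht⟩) else 0) (fun t _ => by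
          split_ifs
          · exact Nat.lt_succ_iff.2 (hIk _)
          · omega)
      have hσI : ∀ τ, gapIndex k (e τ) σ = I τ := fun τ => by
        refine (hdig (e τ) (by have := (e τ).isLt; omega)).trans ?_
        rw [dif_pos (e τ).isLt]
        simp
      have hK : ∀ τ, GapKnows N d (f σ) (U a b τ) := fun τ => by
        refine ⟨⟨e τ, by have := (e τ).isLt; omega⟩, ?_⟩
        rw [(hf σ _).1, (hf σ _).2]
        simp only [hσI]
        exact hI τ
      refine ⟨σ, hσ, b, hb, hK, (hΦ a ha b hb _ _ fun τ => ?_).2 hφ⟩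
      rw [hTm]
      exact H.gapMem_iff (fun j => (hf σ j).1) (fun j => (hf σ j).2) (hU a ha b hb τ) (hK τ)

/-! ### The graph of a structure -/

section graph

variable {m : ℕ} {ar : Fin m → ℕ} {s p q : ℕ}

/-- The assignment of the variables of a `Π₂` formula that is given by the numbers of a tuple for
the first block and of a tuple for the second block. -/
def pairTuple (p q n a b : ℕ) : Fin (p + q) → ℕ :=
  Fin.append (fun i : Fin p => digit n i a) fun i : Fin q => digit n i b

theorem pairTuple_eq {n : ℕ} (a : Fin (n ^ p)) (b : Fin (n ^ q)) :
    pairTuple p q n a b = fun i =>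
      ((Fin.append (finFunctionFinEquiv.symm a) (finFunctionFinEquiv.symm b) :
        Fin (p + q) → Fin n) i : ℕ) := by
  funext i
  refine Fin.addCases (fun i => ?_) (fun i => ?_) i
  · rw [pairTuple, Fin.append_left, Fin.append_left]
    rfl
  · rw [pairTuple, Fin.append_right, Fin.append_right]
    rfl

theorem tupleNum_coe {n : ℕ} (u : Fin s → Fin n) :
    tupleNum n (fun j => u j) = finFunctionFinEquiv u := by
  rw [finFunctionFinEquiv_apply]
  rfl

theorem tupleNum_pairTuple_lt {n a b : ℕ} (ha : a < n ^ p) (hb : b < n ^ q)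
    (τ : Fin s → Fin (p + q)) : tupleNum n (fun j => pairTuple p q n a b (τ j)) < n ^ s := by
  rw [pairTuple_eq ⟨a, ha⟩ ⟨b, hb⟩]
  exact (tupleNum_coe _).trans_lt (Fin.isLt _)

/-- The evaluation `Ψ` of `ψ` with numbers instead of tuples is correct. -/
def EvaluatesFormula (Ψ : List Bool → ℕ → (ℕ → Prop) → (Fin (p + q) → ℕ) → Prop)
    (ψ : (vocabularyWithVar ar s).BoundedFormula Empty (p + q)) : Prop :=
  ∀ (n : ℕ) (A : Interp ar n) (X : (Fin s → Fin n) → Prop) (R : ℕ → Prop)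
    (v : Fin (p + q) → Fin n),
    (∀ τ : Fin s → Fin (p + q), R (tupleNum n fun j => v (τ j)) ↔ X fun j => v (τ j)) →
    (Ψ A.code n R (fun i => v i) ↔ RealizeWith A X ψ v)

variable {Ψ : List Bool → ℕ → (ℕ → Prop) → (Fin (p + q) → ℕ) → Prop}
  {ψ : (vocabularyWithVar ar s).BoundedFormula Empty (p + q)}

/-- Both sides are equivalent to the truth of `ψ` when the relation variable is interpreted by `R`
read on tuple numbers. This is what allows a slot that knows only the relevant memberships to
evaluate `ψ`. -/
theorem EvaluatesFormula.congr (hΨ : EvaluatesFormula Ψ ψ) {n : ℕ} (A : Interp ar n) {a b : ℕ}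
    (ha : a < n ^ p) (hb : b < n ^ q) {R R' : ℕ → Prop}
    (h : ∀ τ : Fin s → Fin (p + q), R (tupleNum n fun j => pairTuple p q n a b (τ j)) ↔
      R' (tupleNum n fun j => pairTuple p q n a b (τ j))) :
    Ψ A.code n R (pairTuple p q n a b) ↔ Ψ A.code n R' (pairTuple p q n a b) := by
  rw [pairTuple_eq ⟨a, ha⟩ ⟨b, hb⟩] at h ⊢
  rw [hΨ n A (fun u => R (tupleNum n fun j => u j)) R _ fun τ => Iff.rfl,
    hΨ n A (fun u => R (tupleNum n fun j => u j)) R' _ fun τ => (h τ).symm]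

theorem EvaluatesFormula.satisfiesPiTwo_iff (hΨ : EvaluatesFormula Ψ ψ) {n : ℕ} (A : Interp ar n)
    {S : Finset (Fin s → Fin n)} {T : Finset ℕ}
    (h : ∀ u, (finFunctionFinEquiv u : ℕ) ∈ T ↔ u ∈ S) : SatisfiesPiTwo A S ψ ↔
      ∀ a < n ^ p, ∃ b < n ^ q, Ψ A.code n (· ∈ T) (pairTuple p q n a b) := by
  rw [ParamComplexity.satisfiesPiTwo_iff, ← finFunctionFinEquiv.symm.forall_congr_right,
    Fin.forall_iff]
  refine forall₂_congr fun a ha => ?_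
  rw [← finFunctionFinEquiv.symm.exists_congr_right, Fin.exists_iff]
  refine exists_congr fun b => ?_
  rw [← exists_prop]
  refine exists_congr fun hb => ?_
  rw [pairTuple_eq ⟨a, ha⟩ ⟨b, hb⟩]
  exact (hΨ n A _ _ _ fun τ => by rw [tupleNum_coe]; exact h _).symm

theorem EvaluatesFormula.exists_finset_iff (hΨ : EvaluatesFormula Ψ ψ) {n : ℕ} (A : Interp ar n)
    (k : ℕ) : (∃ T ⊆ Finset.range (n ^ s), T.card = k ∧
      ∀ a < n ^ p, ∃ b < n ^ q, Ψ A.code n (· ∈ T) (pairTuple p q n a b)) ↔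
      ∃ S : Finset (Fin s → Fin n), S.card = k ∧ SatisfiesPiTwo A S ψ := by
  classical
  let e : (Fin s → Fin n) ↪ ℕ := finFunctionFinEquiv.toEmbedding.trans Fin.valEmbedding
  have he : ∀ S u, (finFunctionFinEquiv u : ℕ) ∈ Finset.map e S ↔ u ∈ S := fun S u =>
    Finset.mem_map' e
  constructor
  · rintro ⟨T, hT, hk, h⟩
    obtain ⟨S, rfl⟩ : ∃ S : Finset (Fin s → Fin n), T = S.map e := by
      refine ⟨Finset.univ.filter fun u => e u ∈ T, Finset.ext fun x => ?_⟩
      simp only [Finset.mem_map, Finset.mem_filter, Finset.mem_univ, true_and]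
      constructor
      · intro hx
        have : e (finFunctionFinEquiv.symm ⟨x, Finset.mem_range.1 (hT hx)⟩) = x := by simp [e]
        exact ⟨_, by rwa [this], this⟩
      · rintro ⟨u, hu, rfl⟩
        exact hu
    exact ⟨S, by rw [← hk, Finset.card_map], (hΨ.satisfiesPiTwo_iff A (he S)).2 h⟩
  · rintro ⟨S, hk, h⟩
    refine ⟨S.map e, fun x hx => ?_, by rw [Finset.card_map, hk],
      (hΨ.satisfiesPiTwo_iff A (he S)).1 h⟩
    obtain ⟨u, _, rfl⟩ := Finset.mem_map.1 hx
    exact Finset.mem_range.2 (Fin.isLt _)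

/-- The number of gaps in a slot. -/
def slotWidth (s l : ℕ) : ℕ := Fintype.card (Fin s → Fin l) + 1

/-- The relation that generates the graph of the structure with the encoding `x`. -/
def faginRel (s : ℕ) (Ψ : List Bool → ℕ → (ℕ → Prop) → (Fin (p + q) → ℕ) → Prop) (x : List Bool)
    (n k : ℕ) : ℕ → ℕ → Prop :=
  slotRel ((k + 1) ^ slotWidth s (p + q)) ((n ^ s + 2) ^ (2 * slotWidth s (p + q)))
    (GapValid (n ^ s) k (slotWidth s (p + q))) (GapCons (n ^ s) k (slotWidth s (p + q)))
    fun a _ w => ∃ b < n ^ q, (∀ τ : Fin s → Fin (p + q), GapKnows (n ^ s) (slotWidth s (p + q)) w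
      (tupleNum n fun j => pairTuple p q n a b (τ j))) ∧
      Ψ x n (GapMem (n ^ s) (slotWidth s (p + q)) w) (pairTuple p q n a b)

/-- The number of vertices of the graph of a structure. -/
def faginOrder (s p q n k : ℕ) : ℕ :=
  (k + 1) ^ slotWidth s (p + q) * (n ^ s + 2) ^ (2 * slotWidth s (p + q)) +
    (k + 1) ^ slotWidth s (p + q) + n ^ p

theorem faginOrder_pos (s p q n k : ℕ) : 0 < faginOrder s p q n k := by
  unfold faginOrder
  positivity

/-- All digits of `0` vanish, so its gaps are empty; there is at least one gap because `slotWidth`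
is positive. -/
theorem not_gapValid_zero (N k s l σ : ℕ) : ¬ GapValid N k (slotWidth s l) σ 0 := by
  rintro ⟨_, h⟩
  have := (h ⟨0, Nat.succ_pos _⟩).1
  simp [gapLow, gapHigh, digit] at this

/-- This joins the three equivalences: the graph to slot values, slot values to a set of `k`
numbers, and this set to a relation of size `k`. -/
theorem EvaluatesFormula.not_allMaximalIndepSetsHaveSize_iff (hΨ : EvaluatesFormula Ψ ψ) {n : ℕ}
    (A : Interp ar n) (k : ℕ) :
    ¬ AllMaximalIndepSetsHaveSize (SimpleGraph.fromRel fun x y : Fin (faginOrder s p q n k) =>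
        faginRel s Ψ A.code n k x y) ((k + 1) ^ slotWidth s (p + q) + 1) ↔
      ∃ S : Finset (Fin s → Fin n), S.card = k ∧ SatisfiesPiTwo A S ψ := by
  refine (not_allMaximalIndepSetsHaveSize_slotRel (by positivity)
    (not_gapValid_zero (n ^ s) k s (p + q))).trans ?_
  rw [← hΨ.exists_finset_iff A k]
  exact exists_slot_values_iff rfl
    (fun a b τ => tupleNum n fun j => pairTuple p q n a b (τ j))
    (fun a ha b hb τ => tupleNum_pairTuple_lt ha hb τ)
    (fun a b R => Ψ A.code n R (pairTuple p q n a b))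
    fun a ha b hb R R' h => hΨ.congr A ha hb h

end graph

/-! ### The graph of a structure is expressible -/

theorem Expressible.digit {b x : Args → ℕ} (hb : Expressible b) (t : ℕ) (hx : Expressible x) :
    Expressible fun z => digit (b z) t (x z) :=
  (hx.div (hb.pow t)).mod hb

theorem Expressible.pairTuple {p q : ℕ} {n a b : Args → ℕ} (hn : Expressible n)
    (ha : Expressible a) (hb : Expressible b) (i : Fin (p + q)) :
    Expressible fun z => pairTuple p q (n z) (a z) (b z) i := by
  refine Fin.addCases (fun i => ?_) (fun i => ?_) i
  · simp only [ParamComplexity.pairTuple, Fin.append_left]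
    exact hn.digit i ha
  · simp only [ParamComplexity.pairTuple, Fin.append_right]
    exact hn.digit i hb

namespace ExpressiblePred

variable {N k σ w σ' w' u : Args → ℕ}

theorem gapCons (hN : Expressible N) (hk : Expressible k) (d : ℕ) (hσ : Expressible σ)
    (hw : Expressible w) (hσ' : Expressible σ') (hw' : Expressible w') :
    ExpressiblePred fun z => GapCons (N z) (k z) d (σ z) (w z) (σ' z) (w' z) := by
  have hk₁ := hk.add (.const 1)
  have hN₂ := hN.add (.const 2)
  refine forall_finite fun j => forall_finite fun j' => ?_
  exact (imp (eq (hk₁.digit j hσ) (hk₁.digit j' hσ'))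
    (and (eq (hN₂.digit _ hw) (hN₂.digit _ hw')) (eq (hN₂.digit _ hw) (hN₂.digit _ hw')))).and
    (imp (eq (hk₁.digit j' hσ') ((hk₁.digit j hσ).add (.const 1)))
      (eq (hN₂.digit _ hw') (hN₂.digit _ hw)))

theorem gapValid (hN : Expressible N) (hk : Expressible k) (d : ℕ) (hσ : Expressible σ)
    (hw : Expressible w) : ExpressiblePred fun z => GapValid (N z) (k z) d (σ z) (w z) := by
  have hk₁ := hk.add (.const 1)
  have hN₂ := hN.add (.const 2)
  refine (gapCons hN hk d hσ hw hσ hw).and (forall_finite fun j => ?_)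
  exact (lt (hN₂.digit _ hw) (hN₂.digit _ hw)).and
    ((imp (eq (hk₁.digit j hσ) (.const 0)) (eq (hN₂.digit _ hw) (.const 0))).and
      (imp (eq (hk₁.digit j hσ) hk) (eq (hN₂.digit _ hw) (hN.add (.const 1)))))

theorem gapKnows (hN : Expressible N) (d : ℕ) (hw : Expressible w) (hu : Expressible u) :
    ExpressiblePred fun z => GapKnows (N z) d (w z) (u z) := by
  have hN₂ := hN.add (.const 2)
  have hu₁ := hu.add (.const 1)
  exact exists_finite fun j => (lt (hN₂.digit _ hw) hu₁).and (le hu₁ (hN₂.digit _ hw))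

theorem gapMem (hN : Expressible N) (d : ℕ) (hw : Expressible w) (hu : Expressible u) :
    ExpressiblePred fun z => GapMem (N z) d (w z) (u z) :=
  exists_finite fun _ => eq ((hN.add (.const 2)).digit _ hw) (hu.add (.const 1))

theorem slotRel {K W x y : Args → ℕ} {valid : Args → ℕ → ℕ → Prop}
    {cons : Args → ℕ → ℕ → ℕ → ℕ → Prop} {wit : Args → ℕ → ℕ → ℕ → Prop}
    (hK : Expressible K) (hW : Expressible W)
    (hvalid : ∀ {σ w}, Expressible σ → Expressible w →
      ExpressiblePred fun z => valid z (σ z) (w z))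
    (hcons : ∀ {σ w σ' w'}, Expressible σ → Expressible w → Expressible σ' → Expressible w' →
      ExpressiblePred fun z => cons z (σ z) (w z) (σ' z) (w' z))
    (hwit : ∀ {a σ w}, Expressible a → Expressible σ → Expressible w →
      ExpressiblePred fun z => wit z (a z) (σ z) (w z))
    (hx : Expressible x) (hy : Expressible y) :
    ExpressiblePred fun z => slotRel (K z) (W z) (valid z) (cons z) (wit z) (x z) (y z) := by
  have hKW := hK.mul hW
  have vx := hvalid (hx.div hW) (hx.mod hW)
  refine ((lt hx hKW).and ((lt hy hKW).and ((eq (hx.div hW) (hy.div hW)).or (vx.and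
    ((hvalid (hy.div hW) (hy.mod hW)).and
      (hcons (hx.div hW) (hx.mod hW) (hy.div hW) (hy.mod hW)).not))))).or (((le hKW hx).and
    (le hKW hy)).or ((lt hx hKW).and ((le hKW hy).and (vx.and ((eq (hx.div hW) (hy.sub hKW)).or
      ((le hK (hy.sub hKW)).and
        (hwit ((hy.sub hKW).sub hK) (hx.div hW) (hx.mod hW))))))))

theorem faginRel {s p q : ℕ} {Ψ : List Bool → ℕ → (ℕ → Prop) → (Fin (p + q) → ℕ) → Prop}
    (hΨ : ∀ (ν : Args → ℕ) (R : Args → ℕ → Prop) (v : Fin (p + q) → Args → ℕ), Expressible ν →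
      (∀ u, Expressible u → ExpressiblePred fun z => R z (u z)) → (∀ i, Expressible (v i)) →
      ExpressiblePred fun z => Ψ z.1 (ν z) (R z) fun i => v i z)
    {n x y : Args → ℕ} (hn : Expressible n) (hk : Expressible k) (hx : Expressible x)
    (hy : Expressible y) :
    ExpressiblePred fun z => faginRel s Ψ z.1 (n z) (k z) (x z) (y z) := by
  have hN := hn.pow s
  refine slotRel ((hk.add (.const 1)).pow _) ((hN.add (.const 2)).pow _)
    (fun hσ hw => gapValid hN hk _ hσ hw)
    (fun hσ hw hσ' hw' => gapCons hN hk _ hσ hw hσ' hw') (fun {a σ w} ha hσ hw => ?_) hx hy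
  -- Under the quantifier over `b` the variable `0` is `b`, and all other functions are shifted by
  -- `tail`.
  have hN' := hN.tail
  have hv : ∀ i, Expressible fun z => pairTuple p q (n z.tail) (a z.tail) (z.2 0) i :=
    Expressible.pairTuple hn.tail ha.tail (.var 0)
  refine exists_lt (P := fun b z => (∀ τ : Fin s → Fin (p + q), GapKnows (n z ^ s)
    (slotWidth s (p + q)) (w z) (tupleNum (n z) fun j => pairTuple p q (n z) (a z) b (τ j))) ∧
      Ψ z.1 (n z) (GapMem (n z ^ s) (slotWidth s (p + q)) (w z))
        (pairTuple p q (n z) (a z) b)) (hn.pow q) (and (forall_finite fun τ => ?_) ?_)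
  · exact gapKnows hN' _ hw.tail (Expressible.tupleNum hn.tail fun j => hv (τ j))
  · exact hΨ (fun z => n z.tail) (fun z => GapMem (n z.tail ^ s) (slotWidth s (p + q)) (w z.tail))
      (fun i z => pairTuple p q (n z.tail) (a z.tail) (z.2 0) i) hn.tail
      (fun u hu => gapMem hN' _ hw.tail hu) hv

end ExpressiblePred

/-! ### The reduction -/

-- Expressions have no access to the length of the word, which is why it has to be supplied as the
-- variable `0`.
open Classical in
theorem exists_expressible_leadingTrues : ∃ ν : Args → ℕ, Expressible ν ∧
    ∀ z : Args, z.2 0 = z.1.length → ν z = leadingTrues z.1 :=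
  ⟨fun z => ∑ j ∈ Finset.range (z.2 0), if ∀ i < j + 1, z.1.getD i false = true then 1 else 0,
    .sum (h := fun j z => if ∀ i < j + 1, z.1.getD i false = true then 1 else 0) (.var 0)
      (Expressible.congr (ExpressiblePred.forall_lt (P := fun i z => z.1.getD i false = true)
        ((Expressible.var 0).add (.const 1)) (.bit (.var 0))) fun z => by congr),
    fun z hz => by simp only [hz, sum_eq_leadingTrues]⟩

/-- The string `x` is the encoding of a structure with a non-empty universe. -/
def IsStructureCode {m : ℕ} (ar : Fin m → ℕ) (x : List Bool) : Prop :=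
  0 < leadingTrues x ∧ x.length = leadingTrues x + 1 + ∑ i, leadingTrues x ^ ar i

open Classical in
/-- The instance of `kWellCoveredGraph` for an instance of a weighted Fagin-defined problem. -/
noncomputable def faginToGraph {m : ℕ} (ar : Fin m → ℕ) (s : ℕ) {p q : ℕ}
    (Ψ : List Bool → ℕ → (ℕ → Prop) → (Fin (p + q) → ℕ) → Prop) (I : List Bool × ℕ) :
    List Bool × ℕ :=
  if IsStructureCode ar I.1 then
    (graphCode (SimpleGraph.fromRel fun x y : Fin (faginOrder s p q (leadingTrues I.1) I.2) =>
      faginRel s Ψ I.1 (leadingTrues I.1) I.2 x y), (I.2 + 1) ^ slotWidth s (p + q) + 1)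
  else ([false], 1)

/-- This is the image of the malformed inputs: they lie in the complement of the Fagin-defined
problem and must be sent to a yes-instance. -/
theorem singleton_false_mem_kWellCoveredGraph : ([false], 1) ∈ kWellCoveredGraph := by
  have h : graphCode (⊥ : SimpleGraph (Fin 1)) = [false] := by simp [graphCode]
  rw [← h, mem_kWellCoveredGraph_iff one_pos]
  intro S hS
  have : S = Finset.univ := Finset.eq_univ_of_forall fun x => by
    have : ({x} : Finset (Fin 1)) ⊆ S := by
      have hsub : S ⊆ {x} := fun y _ => Finset.mem_singleton.2 (Subsingleton.elim y x)
      exact hS.2 (by simp [SimpleGraph.IsIndepSet]) hsub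
    exact this (Finset.mem_singleton_self x)
  rw [this]
  rfl

theorem not_mem_weightedFagin_iff {m s p q : ℕ} {ar : Fin m → ℕ}
    {ψ : (vocabularyWithVar ar s).BoundedFormula Empty (p + q)}
    {Ψ : List Bool → ℕ → (ℕ → Prop) → (Fin (p + q) → ℕ) → Prop} (hΨ : EvaluatesFormula Ψ ψ)
    (I : List Bool × ℕ) :
    I ∉ weightedFagin ar ψ ↔ faginToGraph ar s Ψ I ∈ kWellCoveredGraph := by
  classical
  obtain ⟨x, k⟩ := I
  unfold faginToGraph
  by_cases h : IsStructureCode ar x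
  · rw [if_pos h, mem_kWellCoveredGraph_iff (faginOrder_pos _ _ _ _ _), ← not_iff_not, not_not]
    obtain ⟨A, hA⟩ := exists_eq_code h.2
    have h₁ := hΨ.not_allMaximalIndepSetsHaveSize_iff A k
    rw [← mem_weightedFagin_iff ψ A h.1 k, ← hA] at h₁
    exact h₁.symm
  · rw [if_neg h]
    refine iff_of_true ?_ singleton_false_mem_kWellCoveredGraph
    rintro ⟨n, A, hn, rfl, _⟩
    exact h ⟨by rwa [A.leadingTrues_code], by rw [A.leadingTrues_code]; exact A.length_code⟩

theorem exists_exprMap_eq_faginToGraph {m s p q : ℕ} (ar : Fin m → ℕ)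
    {Ψ : List Bool → ℕ → (ℕ → Prop) → (Fin (p + q) → ℕ) → Prop}
    (hΨ : ∀ (ν : Args → ℕ) (R : Args → ℕ → Prop) (v : Fin (p + q) → Args → ℕ), Expressible ν →
      (∀ u, Expressible u → ExpressiblePred fun z => R z (u z)) → (∀ i, Expressible (v i)) →
      ExpressiblePred fun z => Ψ z.1 (ν z) (R z) fun i => v i z) :
    ∃ E₁ E₂ E₃ : Expr, ∀ I, exprMap E₁ E₂ E₃ I = faginToGraph ar s Ψ I := by
  classical
  obtain ⟨ν, hν, hνeq⟩ := exists_expressible_leadingTrues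
  -- In `inputEnv` the variable `0` is the length of the word and the variable `1` is the parameter.
  have hk : Expressible fun z => z.2 1 := .var 1
  have hvalid : ExpressiblePred fun z =>
      0 < ν z ∧ z.2 0 = ν z + 1 + ∑ i, ν z ^ ar i :=
    (ExpressiblePred.lt (.const 0) hν).and (.eq (.var 0)
      ((hν.add (.const 1)).add (.finset_sum _ fun i => hν.pow (ar i))))
  have hd := (hk.add (.const 1)).pow (slotWidth s (p + q))
  have hV : Expressible fun z => faginOrder s p q (ν z) (z.2 1) :=
    ((hd.mul (((hν.pow s).add (.const 2)).pow _)).add hd).add (hν.pow p)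
  -- The letter at position `t`, now the variable `0`, is the matrix entry in row `t / V` and column
  -- `t % V`, where `V` is the number of vertices.
  have hi := (Expressible.var 0).div hV.tail
  have hj := (Expressible.var 0).mod hV.tail
  obtain ⟨E₁, h₁⟩ := Expressible.ite hvalid (hV.mul hV) (.const 1)
  obtain ⟨E₂, h₂⟩ := hvalid.tail.and ((ExpressiblePred.eq hi hj).not.and
    ((ExpressiblePred.faginRel (s := s) hΨ hν.tail hk.tail hi hj).or
      (ExpressiblePred.faginRel (s := s) hΨ hν.tail hk.tail hj hi)))
  obtain ⟨E₃, h₃⟩ := Expressible.ite hvalid (hd.add (.const 1)) (.const 1)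
  refine ⟨E₁, E₂, E₃, fun I => ?_⟩
  have e : ν (I.1, inputEnv I) = leadingTrues I.1 := hνeq _ rfl
  have htail : ∀ t, Args.tail (I.1, consEnv t (inputEnv I)) = (I.1, inputEnv I) := fun t => rfl
  have e₀ : inputEnv I 0 = I.1.length := rfl
  have e₁ : inputEnv I 1 = I.2 := rfl
  have e₂ : ∀ t, consEnv t (inputEnv I) 0 = t := fun t => rfl
  have h₁ := h₁ (I.1, inputEnv I)
  have h₂ := fun t => h₂ (I.1, consEnv t (inputEnv I))
  have h₃ := h₃ (I.1, inputEnv I)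
  simp only [htail, e, e₀, e₁, e₂] at h₁ h₂ h₃
  unfold exprMap faginToGraph IsStructureCode
  simp only [h₁, h₂, h₃]
  by_cases h : 0 < leadingTrues I.1 ∧
      I.1.length = leadingTrues I.1 + 1 + ∑ i, leadingTrues I.1 ^ ar i
  · rw [if_pos h, if_pos h, if_pos h, graphCode_fromRel]
    refine Prod.ext (List.map_congr_left fun t _ => decide_eq_decide.2 ?_) rfl
    rw [ite_ne_right_iff]
    exact ⟨fun hh => hh.1.2, fun hh => ⟨⟨h, hh⟩, one_ne_zero⟩⟩
  · rw [if_neg h, if_neg h, if_neg h]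
    simp [h]

end ParamComplexity

theorem mainTheorem9 : ParamComplexity.IsCoW2Hard ParamComplexity.kWellCoveredGraph := by
  classical
  refine ParamComplexity.isCoW2Hard_of_exprMap fun m ar s p q ψ hψ => ?_
  obtain ⟨Ψ, hΨ, hexpr⟩ := ParamComplexity.exists_expressible_realizeWith hψ
  obtain ⟨E₁, E₂, E₃, hE⟩ := ParamComplexity.exists_exprMap_eq_faginToGraph (s := s) ar hexpr
  refine ⟨E₁, E₂, E₃, ParamComplexity.slotWidth s (p + q) + 1, fun I => ?_, fun I => ?_⟩
  · rw [hE, ParamComplexity.faginToGraph]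
    split_ifs
    -- With `D` the slot width, `(k + 1) ^ D + 1 ≤ 2 * (k + 2) ^ D ≤ (k + 2) ^ (D + 1)`.
    · have h₁ := Nat.pow_le_pow_left (show I.2 + 1 ≤ I.2 + 2 by omega)
        (ParamComplexity.slotWidth s (p + q))
      have h₂ := Nat.one_le_pow (ParamComplexity.slotWidth s (p + q)) (I.2 + 2) (by omega)
      have h₃ := Nat.mul_le_mul_left ((I.2 + 2) ^ ParamComplexity.slotWidth s (p + q))
        (show 2 ≤ I.2 + 2 by omega)
      rw [pow_succ]
      dsimp only
      omega
    · exact Nat.one_le_pow _ _ (by omega)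
  · rw [hE]
    exact ParamComplexity.not_mem_weightedFagin_iff hΨ I
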